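/- Let $\mathcal V$ be a cartesian closed category with finite limits and small coproducts, with terminal object $1$. For a small set $I$ let $I\bullet 1=\coprod_{i\in I}1$, with coprojections $\bar\imath:1\to I\bullet 1$; a map $u:I\to K$ of sets induces $u\bullet 1:I\bullet 1\to K\bullet 1$. * For each small set $I$ there is an adjunction $\coprod\dashv\langle \bar\imath^{\,*}\rangle_{i\in I}:\mathcal V/(I\bullet 1)\to\mathcal V^I$, where the left adjoint sends $(A_i)_{i\in I}$ to $\coprod_i A_i\to\coprod_i 1=I\bullet 1$ and the right adjoint sends an object over $I\bullet 1$ to its pullbacks along the coprojections $\bar\imath$. * $\mathcal V$ is *extensive* if it has all small coproducts and, for each small family $(X_i)_{i\in I}$ of objects, the functor $\prod_{i\in I}(\mathcal V/X_i)\to\mathcal V/(\coprod_{i\in I}X_i)$, $(f_i)_i\mapsto\coprod_i f_i$, is an equivalence of categories. * $\mathcal V\text{-}\mathrm{Mat}$ is the pseudo-double category whose 0-cells are small sets, whose vertical 1-cells are maps of sets, whose horizontal 1-cells $I\to J$ are matrices $M=(M(i,j))_{i\in I,j\in J}$ of objects of $\mathcal V$, and whose 2-cells from $M$ to $N$ with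 vertical sides $u:I\to K$, $v:J\to L$ are families of morphisms $M(i,j)\to N(u(i),v(j))$ of $\mathcal V$. The horizontal composite of $M:I\to J$ and $N:J\to K$ is $(i,k)\mapsto\coprod_{j\in J}N(j,k)\times M(i,j)$, and the horizontal identity of $I$ is the matrix with $1$ on the diagonal and the initial object elsewhere. * $\mathrm{Span}_d(\mathcal V)$ is the pseudo-double category with the same 0-cells and vertical 1-cells, whose horizontal 1-cells $I\to J$ are spans $I\bullet 1\leftarrow A\to J\bullet 1$ in $\mathcal V$, and whose 2-cells from $A$ to $B$ with vertical sides $u,v$ are morphisms $A\to B$ of $\mathcal V$ compatible with the legs of the spans and with $u\bullet 1$, $v\bullet 1$. Horizontal composition is given by pullback. * $\mathrm{Int}:\mathcal V\text{-}\mathrm{Mat}\to\mathrm{Span}_d(\mathcal V)$ is the oplax double functor that is the identity on 0-cells and vertical 1-cells, sends a matrix $M$ to the span $I\bullet 1\leftarrow\coprod_{i,j}M(i,j)\to J\bullet 1$ whose legs restrict on $M(i,j)$ to $M(i,j)\to 1\xrightarrow{\bar\imath}I\bullet 1$ and $M(i,j)\to 1\xrightarrow{\bar\jmath}J\bullet 1$,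 and sends a 2-cell to the morphism induced between the coproducts, with the canonical comparison 2-cells. * $\mathrm{En}:\mathrm{Span}_d(\mathcal V)\to\mathcal V\text{-}\mathrm{Mat}$ is the lax double functor that is the identity on 0-cells and vertical 1-cells, sends a span $A$ to the matrix whose $(i,j)$ entry is the pullback of $A\to(I\bullet 1)\times(J\bullet 1)$ along $\langle\bar\imath,\bar\jmath\rangle:1\to(I\bullet 1)\times(J\bullet 1)$, and sends a 2-cell to the morphisms induced between the pullbacks, with the canonical comparison 2-cells. * An (op)lax double functor $F:\mathbb D\to\mathbb E$ is a *double equivalence* if its comparison 2-cells are invertible and there is an (op)lax double functor $G:\mathbb E\to\mathbb D$ with invertible comparison 2-cells such that $GF$ and $FG$ are isomorphic to the identities through invertible vertical transformations that are compatible with the comparison 2-cells. Then the following are equivalent: 1. for every small set $I$ the adjunction $\mathcal V^I\rightleftarrows\mathcal V/(I\bullet 1)$ is an adjoint equivalence; 2. $\mathcal V$ is extensive; 3. the oplax double functor $\mathrm{Int}:\mathcal V\text{-}\mathrm{Mat}\to\mathrm{Span}_d(\mathcal V)$ is a double equivalence; 4. the lax double functor $\mathrm{En}:\mathrm{Span}_d(\mathcal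 V)\to\mathcal V\text{-}\mathrm{Mat}$ is a double equivalence. -/

import Mathlib

open CategoryTheory Category Limits MonoidalCategory CartesianMonoidalCategory

universe w v u

namespace MatSpan

/-! ### Pseudo-double categories -/

/-- A pseudo-double category. The vertical direction is strict and is given by a category structure
on the 0-cells; `Hor A B` is the type of horizontal 1-cells, and `Sq f g M N` is the type of 2-cells
with horizontal source `M`, horizontal target `N`, left vertical side `f` and right vertical
side `g`. Two 2-cells whose vertical sides are only propositionally equal (such as `(f ≫ g) ≫ h`
and `f ≫ (g ≫ h)`) are compared by heterogeneous equality. Horizontal composition is written in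
diagrammatic order. -/
structure PseudoDoubleCategory.{uo, uv, uh, us} where
  /-- 0-cells -/
  Obj : Type uo
  /-- vertical 1-cells and their strictly associative composition -/
  [vert : Category.{uv} Obj]
  /-- horizontal 1-cells -/
  Hor : Obj → Obj → Type uh
  /-- 2-cells -/
  Sq : ∀ {A B C D : Obj}, (A ⟶ C) → (B ⟶ D) → Hor A B → Hor C D → Type us
  /-- vertical identity 2-cells -/
  vid : ∀ {A B : Obj} (M : Hor A B), Sq (𝟙 A) (𝟙 B) M M
  /-- vertical composition of 2-cells -/
  vcomp : ∀ {A B C D E F : Obj} {f : A ⟶ C} {g : B ⟶ D} {f' : C ⟶ E} {g' : D ⟶ F}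
    {M : Hor A B} {N : Hor C D} {P : Hor E F},
    Sq f g M N → Sq f' g' N P → Sq (f ≫ f') (g ≫ g') M P
  vid_vcomp : ∀ {A B C D : Obj} {f : A ⟶ C} {g : B ⟶ D} {M : Hor A B} {N : Hor C D}
    (α : Sq f g M N), vcomp (vid M) α ≍ α
  vcomp_vid : ∀ {A B C D : Obj} {f : A ⟶ C} {g : B ⟶ D} {M : Hor A B} {N : Hor C D}
    (α : Sq f g M N), vcomp α (vid N) ≍ α
  vcomp_assoc : ∀ {A B C D E F G H : Obj} {f : A ⟶ C} {g : B ⟶ D} {f' : C ⟶ E} {g' : D ⟶ F}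
    {f'' : E ⟶ G} {g'' : F ⟶ H} {M : Hor A B} {N : Hor C D} {P : Hor E F} {Q : Hor G H}
    (α : Sq f g M N) (β : Sq f' g' N P) (γ : Sq f'' g'' P Q),
    vcomp (vcomp α β) γ ≍ vcomp α (vcomp β γ)
  /-- horizontal identity 1-cells -/
  hid : ∀ A : Obj, Hor A A
  /-- horizontal identity 2-cells -/
  hidSq : ∀ {A B : Obj} (f : A ⟶ B), Sq f f (hid A) (hid B)
  hidSq_id : ∀ A : Obj, hidSq (𝟙 A) = vid (hid A)
  hidSq_comp : ∀ {A B C : Obj} (f : A ⟶ B) (g : B ⟶ C),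
    hidSq (f ≫ g) = vcomp (hidSq f) (hidSq g)
  /-- horizontal composition of horizontal 1-cells -/
  hcomp : ∀ {A B C : Obj}, Hor A B → Hor B C → Hor A C
  /-- horizontal composition of 2-cells -/
  hcompSq : ∀ {A B C A' B' C' : Obj} {f : A ⟶ A'} {g : B ⟶ B'} {h : C ⟶ C'}
    {M : Hor A B} {M' : Hor A' B'} {N : Hor B C} {N' : Hor B' C'},
    Sq f g M M' → Sq g h N N' → Sq f h (hcomp M N) (hcomp M' N')
  hcompSq_vid : ∀ {A B C : Obj} (M : Hor A B) (N : Hor B C),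
    hcompSq (vid M) (vid N) = vid (hcomp M N)
  interchange : ∀ {A B C A' B' C' A'' B'' C'' : Obj} {f : A ⟶ A'} {g : B ⟶ B'} {h : C ⟶ C'}
    {f' : A' ⟶ A''} {g' : B' ⟶ B''} {h' : C' ⟶ C''}
    {M : Hor A B} {M' : Hor A' B'} {M'' : Hor A'' B''}
    {N : Hor B C} {N' : Hor B' C'} {N'' : Hor B'' C''}
    (α : Sq f g M M') (α' : Sq f' g' M' M'') (β : Sq g h N N') (β' : Sq g' h' N' N''),
    hcompSq (vcomp α α') (vcomp β β') = vcomp (hcompSq α β) (hcompSq α' β')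
  /-- the associator and its inverse -/
  assoc : ∀ {A B C D : Obj} (M : Hor A B) (N : Hor B C) (P : Hor C D),
    Sq (𝟙 A) (𝟙 D) (hcomp (hcomp M N) P) (hcomp M (hcomp N P))
  assocInv : ∀ {A B C D : Obj} (M : Hor A B) (N : Hor B C) (P : Hor C D),
    Sq (𝟙 A) (𝟙 D) (hcomp M (hcomp N P)) (hcomp (hcomp M N) P)
  assoc_assocInv : ∀ {A B C D : Obj} (M : Hor A B) (N : Hor B C) (P : Hor C D),
    vcomp (assoc M N P) (assocInv M N P) ≍ vid (hcomp (hcomp M N) P)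
  assocInv_assoc : ∀ {A B C D : Obj} (M : Hor A B) (N : Hor B C) (P : Hor C D),
    vcomp (assocInv M N P) (assoc M N P) ≍ vid (hcomp M (hcomp N P))
  assoc_naturality : ∀ {A B C D A' B' C' D' : Obj}
    {f : A ⟶ A'} {g : B ⟶ B'} {h : C ⟶ C'} {k : D ⟶ D'}
    {M : Hor A B} {M' : Hor A' B'} {N : Hor B C} {N' : Hor B' C'} {P : Hor C D} {P' : Hor C' D'}
    (α : Sq f g M M') (β : Sq g h N N') (γ : Sq h k P P'),
    vcomp (hcompSq (hcompSq α β) γ) (assoc M' N' P') ≍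
      vcomp (assoc M N P) (hcompSq α (hcompSq β γ))
  /-- the left unitor and its inverse -/
  lunit : ∀ {A B : Obj} (M : Hor A B), Sq (𝟙 A) (𝟙 B) (hcomp (hid A) M) M
  lunitInv : ∀ {A B : Obj} (M : Hor A B), Sq (𝟙 A) (𝟙 B) M (hcomp (hid A) M)
  lunit_lunitInv : ∀ {A B : Obj} (M : Hor A B),
    vcomp (lunit M) (lunitInv M) ≍ vid (hcomp (hid A) M)
  lunitInv_lunit : ∀ {A B : Obj} (M : Hor A B), vcomp (lunitInv M) (lunit M) ≍ vid M
  lunit_naturality : ∀ {A B A' B' : Obj} {f : A ⟶ A'} {g : B ⟶ B'}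
    {M : Hor A B} {M' : Hor A' B'} (α : Sq f g M M'),
    vcomp (hcompSq (hidSq f) α) (lunit M') ≍ vcomp (lunit M) α
  /-- the right unitor and its inverse -/
  runit : ∀ {A B : Obj} (M : Hor A B), Sq (𝟙 A) (𝟙 B) (hcomp M (hid B)) M
  runitInv : ∀ {A B : Obj} (M : Hor A B), Sq (𝟙 A) (𝟙 B) M (hcomp M (hid B))
  runit_runitInv : ∀ {A B : Obj} (M : Hor A B),
    vcomp (runit M) (runitInv M) ≍ vid (hcomp M (hid B))
  runitInv_runit : ∀ {A B : Obj} (M : Hor A B), vcomp (runitInv M) (runit M) ≍ vid M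
  runit_naturality : ∀ {A B A' B' : Obj} {f : A ⟶ A'} {g : B ⟶ B'}
    {M : Hor A B} {M' : Hor A' B'} (α : Sq f g M M'),
    vcomp (hcompSq α (hidSq g)) (runit M') ≍ vcomp (runit M) α
  pentagon : ∀ {A B C D E : Obj} (M : Hor A B) (N : Hor B C) (P : Hor C D) (Q : Hor D E),
    vcomp (hcompSq (assoc M N P) (vid Q))
      (vcomp (assoc M (hcomp N P) Q) (hcompSq (vid M) (assoc N P Q))) ≍
    vcomp (assoc (hcomp M N) P Q) (assoc M N (hcomp P Q))
  triangle : ∀ {A B C : Obj} (M : Hor A B) (N : Hor B C),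
    vcomp (assoc M (hid B) N) (hcompSq (vid M) (lunit N)) ≍ hcompSq (runit M) (vid N)

attribute [instance] PseudoDoubleCategory.vert

namespace PseudoDoubleCategory

variable (D : PseudoDoubleCategory)

/-- A horizontal 1-cell bundled with its source and target. -/
structure Tot where
  src : D.Obj
  tgt : D.Obj
  hor : D.Hor src tgt

/-- A 2-cell bundled with its vertical sides. -/
structure TotHom (X Y : D.Tot) where
  left : X.src ⟶ Y.src
  right : X.tgt ⟶ Y.tgt
  sq : D.Sq left right X.hor Y.hor

variable {D}

theorem TotHom.ext' {X Y : D.Tot} {a b : D.TotHom X Y} (h : a.left = b.left)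
    (h' : a.right = b.right) (h'' : a.sq ≍ b.sq) : a = b := by
  cases a; cases b; cases h; cases h'; cases h''; rfl

/-- The category of horizontal 1-cells and 2-cells. -/
instance : Category D.Tot where
  Hom := D.TotHom
  id X := ⟨𝟙 _, 𝟙 _, D.vid X.hor⟩
  comp a b := ⟨a.left ≫ b.left, a.right ≫ b.right, D.vcomp a.sq b.sq⟩
  id_comp _ := TotHom.ext' (Category.id_comp _) (Category.id_comp _) (D.vid_vcomp _)
  comp_id _ := TotHom.ext' (Category.comp_id _) (Category.comp_id _) (D.vcomp_vid _)
  assoc _ _ _ := TotHom.ext' (Category.assoc _ _ _) (Category.assoc _ _ _) (D.vcomp_assoc _ _ _)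

section
variable {A B C E F G : D.Obj} {f f' : A ⟶ C} {g g' : B ⟶ E} {h : C ⟶ F} {k : E ⟶ G}
  {M : D.Hor A B} {N : D.Hor C E} {P : D.Hor F G}

/-- A 2-cell as a morphism of `Tot`. -/
def tot (α : D.Sq f g M N) : (⟨A, B, M⟩ : D.Tot) ⟶ ⟨C, E, N⟩ := ⟨f, g, α⟩

/-- Transport of a 2-cell along equalities of its vertical sides. -/
def recast (hf : f = f') (hg : g = g') (α : D.Sq f g M N) : D.Sq f' g' M N :=
  hf ▸ hg ▸ α

theorem recast_heq (hf : f = f') (hg : g = g') (α : D.Sq f g M N) : recast hf hg α ≍ α := by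
  subst hf; subst hg; rfl

theorem tot_eq (hf : f = f') (hg : g = g') {α : D.Sq f g M N} {β : D.Sq f' g' M N}
    (e : α ≍ β) : tot α = tot β := by
  subst hf; subst hg; cases e; rfl

theorem heq_of_tot {α : D.Sq f g M N} {β : D.Sq f' g' M N} (e : tot α = tot β) : α ≍ β := by
  have hh : f = f' ∧ g = g' ∧ α ≍ β := by
    simpa [tot] using (TotHom.mk.injEq (D := D) (X := ⟨A, B, M⟩) (Y := ⟨C, E, N⟩)
      f g α f' g' β).mp e
  exact hh.2.2

theorem tot_recast (hf : f = f') (hg : g = g') (α : D.Sq f g M N) :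
    tot (recast hf hg α) = tot α := by
  subst hf; subst hg; rfl

theorem tot_vcomp (α : D.Sq f g M N) (β : D.Sq h k N P) :
    tot (D.vcomp α β) = tot α ≫ tot β := rfl

theorem tot_vid (M : D.Hor A B) : tot (D.vid M) = 𝟙 (⟨A, B, M⟩ : D.Tot) := rfl

end

theorem hcompSq_congr {A B C A' B' C' : D.Obj} {f f₁ : A ⟶ A'} {g g₁ : B ⟶ B'} {h h₁ : C ⟶ C'}
    {M : D.Hor A B} {M' : D.Hor A' B'} {N : D.Hor B C} {N' : D.Hor B' C'}
    {α : D.Sq f g M M'} {β : D.Sq g h N N'} {α₁ : D.Sq f₁ g₁ M M'} {β₁ : D.Sq g₁ h₁ N N'}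
    (e : tot α = tot α₁) (e' : tot β = tot β₁) :
    tot (D.hcompSq α β) = tot (D.hcompSq α₁ β₁) := by
  have hf : f = f₁ := congrArg TotHom.left e
  have hg : g = g₁ := congrArg TotHom.right e
  have hh : h = h₁ := congrArg TotHom.right e'
  have ha := heq_of_tot e
  have hb := heq_of_tot e'
  subst hf; subst hg; subst hh; cases ha; cases hb; rfl

/-- `tot_eq` for two vertical composites. -/
theorem tot_vcomp_eq {A B A' B' C C' E F : D.Obj} {f : A ⟶ A'} {g : B ⟶ B'} {f' : A' ⟶ C}
    {g' : B' ⟶ C'} {h : A ⟶ E} {k : B ⟶ F} {h' : E ⟶ C} {k' : F ⟶ C'}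
    {M : D.Hor A B} {M' : D.Hor A' B'} {N : D.Hor C C'} {P : D.Hor E F}
    {α : D.Sq f g M M'} {β : D.Sq f' g' M' N} {α' : D.Sq h k M P} {β' : D.Sq h' k' P N}
    (e₁ : f ≫ f' = h ≫ h') (e₂ : g ≫ g' = k ≫ k') (e : D.vcomp α β ≍ D.vcomp α' β') :
    tot α ≫ tot β = tot α' ≫ tot β' :=
  tot_eq (α := D.vcomp α β) (β := D.vcomp α' β') e₁ e₂ e

theorem tot_interchange {A B C A' B' C' A'' B'' C'' : D.Obj} {f : A ⟶ A'} {g : B ⟶ B'}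
    {h : C ⟶ C'} {f' : A' ⟶ A''} {g' : B' ⟶ B''} {h' : C' ⟶ C''}
    {M : D.Hor A B} {M' : D.Hor A' B'} {M'' : D.Hor A'' B''}
    {N : D.Hor B C} {N' : D.Hor B' C'} {N'' : D.Hor B'' C''}
    (α : D.Sq f g M M') (α' : D.Sq f' g' M' M'') (β : D.Sq g h N N') (β' : D.Sq g' h' N' N'') :
    tot (D.hcompSq (D.vcomp α α') (D.vcomp β β')) =
      tot (D.hcompSq α β) ≫ tot (D.hcompSq α' β') :=
  congrArg tot (D.interchange α α' β β')

end PseudoDoubleCategory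

open PseudoDoubleCategory

/-- The common part of a lax and of an oplax double functor: a functor on 0-cells and vertical
1-cells, and an action on horizontal 1-cells and on 2-cells that strictly preserves vertical
identities and vertical composition. -/
structure VerticallyStrictFunctor (D E : PseudoDoubleCategory) where
  /-- the action on 0-cells and vertical 1-cells -/
  obj : D.Obj ⥤ E.Obj
  /-- the action on horizontal 1-cells -/
  hor : ∀ {A B : D.Obj}, D.Hor A B → E.Hor (obj.obj A) (obj.obj B)
  /-- the action on 2-cells -/
  sq : ∀ {A B A' B' : D.Obj} {f : A ⟶ A'} {g : B ⟶ B'} {M : D.Hor A B} {M' : D.Hor A' B'},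
    D.Sq f g M M' → E.Sq (obj.map f) (obj.map g) (hor M) (hor M')
  sq_vid : ∀ {A B : D.Obj} (M : D.Hor A B), sq (D.vid M) ≍ E.vid (hor M)
  sq_vcomp : ∀ {A B A' B' A'' B'' : D.Obj} {f : A ⟶ A'} {g : B ⟶ B'} {f' : A' ⟶ A''}
    {g' : B' ⟶ B''} {M : D.Hor A B} {M' : D.Hor A' B'} {M'' : D.Hor A'' B''}
    (α : D.Sq f g M M') (β : D.Sq f' g' M' M''),
    sq (D.vcomp α β) ≍ E.vcomp (sq α) (sq β)

namespace VerticallyStrictFunctor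

/-- The identity. -/
def id (D : PseudoDoubleCategory) : VerticallyStrictFunctor D D where
  obj := 𝟭 _
  hor M := M
  sq α := α
  sq_vid _ := HEq.rfl
  sq_vcomp _ _ := HEq.rfl

variable {D E K : PseudoDoubleCategory} (F : VerticallyStrictFunctor D E)
  (G : VerticallyStrictFunctor E K)

theorem tot_sq_congr {A B A' B' : D.Obj} {f f₁ : A ⟶ A'} {g g₁ : B ⟶ B'} {M : D.Hor A B}
    {M' : D.Hor A' B'} {α : D.Sq f g M M'} {β : D.Sq f₁ g₁ M M'} (e : tot α = tot β) :
    tot (F.sq α) = tot (F.sq β) := by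
  have hf : f = f₁ := congrArg TotHom.left e
  have hg : g = g₁ := congrArg TotHom.right e
  have ha := heq_of_tot e
  subst hf; subst hg; cases ha; rfl

theorem tot_sq_vid {A B : D.Obj} (M : D.Hor A B) : tot (F.sq (D.vid M)) = 𝟙 _ :=
  tot_eq (F.obj.map_id _) (F.obj.map_id _) (F.sq_vid M)

theorem tot_sq_vcomp {A B A' B' A'' B'' : D.Obj} {f : A ⟶ A'} {g : B ⟶ B'} {f' : A' ⟶ A''}
    {g' : B' ⟶ B''} {M : D.Hor A B} {M' : D.Hor A' B'} {M'' : D.Hor A'' B''}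
    (α : D.Sq f g M M') (β : D.Sq f' g' M' M'') :
    tot (F.sq (D.vcomp α β)) = tot (F.sq α) ≫ tot (F.sq β) :=
  tot_eq (F.obj.map_comp _ _) (F.obj.map_comp _ _) (F.sq_vcomp α β)

/-- The composite, first `F` and then `G`. -/
def comp : VerticallyStrictFunctor D K where
  obj := F.obj ⋙ G.obj
  hor M := G.hor (F.hor M)
  sq α := G.sq (F.sq α)
  sq_vid M := heq_of_tot ((G.tot_sq_congr (F.tot_sq_vid M)).trans (G.tot_sq_vid _))
  sq_vcomp α β := heq_of_tot ((G.tot_sq_congr (F.tot_sq_vcomp α β)).trans (G.tot_sq_vcomp _ _))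

end VerticallyStrictFunctor

/-- An oplax double functor: horizontal composition and horizontal identities are preserved up to
comparison 2-cells `F (M ⊙ N) ⟶ F M ⊙ F N` and `F (hid A) ⟶ hid (F A)`, natural and coherent. -/
structure OplaxDoubleFunctor (D E : PseudoDoubleCategory) extends VerticallyStrictFunctor D E where
  /-- comparison for horizontal composition -/
  δ : ∀ {A B C : D.Obj} (M : D.Hor A B) (N : D.Hor B C),
    E.Sq (𝟙 (obj.obj A)) (𝟙 (obj.obj C)) (hor (D.hcomp M N)) (E.hcomp (hor M) (hor N))
  /-- comparison for horizontal identities -/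
  η : ∀ A : D.Obj, E.Sq (𝟙 (obj.obj A)) (𝟙 (obj.obj A)) (hor (D.hid A)) (E.hid (obj.obj A))
  δ_naturality : ∀ {A B C A' B' C' : D.Obj} {f : A ⟶ A'} {g : B ⟶ B'} {h : C ⟶ C'}
    {M : D.Hor A B} {M' : D.Hor A' B'} {N : D.Hor B C} {N' : D.Hor B' C'}
    (α : D.Sq f g M M') (β : D.Sq g h N N'),
    E.vcomp (sq (D.hcompSq α β)) (δ M' N') ≍ E.vcomp (δ M N) (E.hcompSq (sq α) (sq β))
  η_naturality : ∀ {A B : D.Obj} (f : A ⟶ B),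
    E.vcomp (sq (D.hidSq f)) (η B) ≍ E.vcomp (η A) (E.hidSq (obj.map f))
  associativity : ∀ {A B C C' : D.Obj} (M : D.Hor A B) (N : D.Hor B C) (P : D.Hor C C'),
    E.vcomp (δ (D.hcomp M N) P)
      (E.vcomp (E.hcompSq (δ M N) (E.vid (hor P))) (E.assoc (hor M) (hor N) (hor P))) ≍
    E.vcomp (sq (D.assoc M N P))
      (E.vcomp (δ M (D.hcomp N P)) (E.hcompSq (E.vid (hor M)) (δ N P)))
  left_unitality : ∀ {A B : D.Obj} (M : D.Hor A B),
    E.vcomp (δ (D.hid A) M) (E.vcomp (E.hcompSq (η A) (E.vid (hor M))) (E.lunit (hor M))) ≍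
      sq (D.lunit M)
  right_unitality : ∀ {A B : D.Obj} (M : D.Hor A B),
    E.vcomp (δ M (D.hid B)) (E.vcomp (E.hcompSq (E.vid (hor M)) (η B)) (E.runit (hor M))) ≍
      sq (D.runit M)

/-- A lax double functor: horizontal composition and horizontal identities are preserved up to
comparison 2-cells `F M ⊙ F N ⟶ F (M ⊙ N)` and `hid (F A) ⟶ F (hid A)`, natural and coherent. -/
structure LaxDoubleFunctor (D E : PseudoDoubleCategory) extends VerticallyStrictFunctor D E where
  /-- comparison for horizontal composition -/
  μ : ∀ {A B C : D.Obj} (M : D.Hor A B) (N : D.Hor B C),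
    E.Sq (𝟙 (obj.obj A)) (𝟙 (obj.obj C)) (E.hcomp (hor M) (hor N)) (hor (D.hcomp M N))
  /-- comparison for horizontal identities -/
  ε : ∀ A : D.Obj, E.Sq (𝟙 (obj.obj A)) (𝟙 (obj.obj A)) (E.hid (obj.obj A)) (hor (D.hid A))
  μ_naturality : ∀ {A B C A' B' C' : D.Obj} {f : A ⟶ A'} {g : B ⟶ B'} {h : C ⟶ C'}
    {M : D.Hor A B} {M' : D.Hor A' B'} {N : D.Hor B C} {N' : D.Hor B' C'}
    (α : D.Sq f g M M') (β : D.Sq g h N N'),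
    E.vcomp (E.hcompSq (sq α) (sq β)) (μ M' N') ≍ E.vcomp (μ M N) (sq (D.hcompSq α β))
  ε_naturality : ∀ {A B : D.Obj} (f : A ⟶ B),
    E.vcomp (E.hidSq (obj.map f)) (ε B) ≍ E.vcomp (ε A) (sq (D.hidSq f))
  associativity : ∀ {A B C C' : D.Obj} (M : D.Hor A B) (N : D.Hor B C) (P : D.Hor C C'),
    E.vcomp (E.hcompSq (μ M N) (E.vid (hor P)))
      (E.vcomp (μ (D.hcomp M N) P) (sq (D.assoc M N P))) ≍
    E.vcomp (E.assoc (hor M) (hor N) (hor P))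
      (E.vcomp (E.hcompSq (E.vid (hor M)) (μ N P)) (μ M (D.hcomp N P)))
  left_unitality : ∀ {A B : D.Obj} (M : D.Hor A B),
    E.vcomp (E.hcompSq (ε A) (E.vid (hor M))) (E.vcomp (μ (D.hid A) M) (sq (D.lunit M))) ≍
      E.lunit (hor M)
  right_unitality : ∀ {A B : D.Obj} (M : D.Hor A B),
    E.vcomp (E.hcompSq (E.vid (hor M)) (ε B)) (E.vcomp (μ M (D.hid B)) (sq (D.runit M))) ≍
      E.runit (hor M)

/-- Invertibility of a 2-cell with identity vertical sides. -/
def PseudoDoubleCategory.IsInvertible {D : PseudoDoubleCategory} {A B : D.Obj} {M N : D.Hor A B}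
    (α : D.Sq (𝟙 A) (𝟙 B) M N) : Prop :=
  ∃ β : D.Sq (𝟙 A) (𝟙 B) N M, D.vcomp α β ≍ D.vid M ∧ D.vcomp β α ≍ D.vid N

namespace OplaxDoubleFunctor

/-- The identity oplax double functor. -/
def id (D : PseudoDoubleCategory) : OplaxDoubleFunctor D D where
  toVerticallyStrictFunctor := .id D
  δ M N := D.vid _
  η A := D.vid _
  δ_naturality α β := (D.vcomp_vid _).trans (D.vid_vcomp _).symm
  η_naturality f := (D.vcomp_vid _).trans (D.vid_vcomp _).symm
  associativity M N P := by
    apply heq_of_tot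
    simp only [VerticallyStrictFunctor.id, tot_vcomp, D.hcompSq_vid, tot_vid]
    erw [Category.id_comp, Category.id_comp, Category.id_comp, Category.comp_id]
  left_unitality M := by
    apply heq_of_tot
    simp only [VerticallyStrictFunctor.id, tot_vcomp, D.hcompSq_vid, tot_vid]
    erw [Category.id_comp, Category.id_comp]
  right_unitality M := by
    apply heq_of_tot
    simp only [VerticallyStrictFunctor.id, tot_vcomp, D.hcompSq_vid, tot_vid]
    erw [Category.id_comp, Category.id_comp]

variable {D E K : PseudoDoubleCategory} (F : OplaxDoubleFunctor D E) (G : OplaxDoubleFunctor E K)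

theorem tot_δ_naturality {A B C A' B' C' : D.Obj} {f : A ⟶ A'} {g : B ⟶ B'} {h : C ⟶ C'}
    {M : D.Hor A B} {M' : D.Hor A' B'} {N : D.Hor B C} {N' : D.Hor B' C'}
    (α : D.Sq f g M M') (β : D.Sq g h N N') :
    tot (F.sq (D.hcompSq α β)) ≫ tot (F.δ M' N') =
      tot (F.δ M N) ≫ tot (E.hcompSq (F.sq α) (F.sq β)) :=
  tot_vcomp_eq (by simp) (by simp) (F.δ_naturality α β)

/-- The comparison 2-cells of a composite. -/
def compδ {A B C : D.Obj} (M : D.Hor A B) (N : D.Hor B C) :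
    K.Sq (𝟙 (G.obj.obj (F.obj.obj A))) (𝟙 (G.obj.obj (F.obj.obj C)))
      (G.hor (F.hor (D.hcomp M N))) (K.hcomp (G.hor (F.hor M)) (G.hor (F.hor N))) :=
  recast (by simp) (by simp) (K.vcomp (G.sq (F.δ M N)) (G.δ (F.hor M) (F.hor N)))

/-- The comparison 2-cells of a composite. -/
def compη (A : D.Obj) :
    K.Sq (𝟙 (G.obj.obj (F.obj.obj A))) (𝟙 (G.obj.obj (F.obj.obj A)))
      (G.hor (F.hor (D.hid A))) (K.hid (G.obj.obj (F.obj.obj A))) :=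
  recast (by simp) (by simp) (K.vcomp (G.sq (F.η A)) (G.η (F.obj.obj A)))

theorem tot_compδ {A B C : D.Obj} (M : D.Hor A B) (N : D.Hor B C) :
    tot (compδ F G M N) = tot (G.sq (F.δ M N)) ≫ tot (G.δ (F.hor M) (F.hor N)) :=
  tot_recast _ _ _

theorem tot_compη (A : D.Obj) :
    tot (compη F G A) = tot (G.sq (F.η A)) ≫ tot (G.η (F.obj.obj A)) :=
  tot_recast _ _ _

theorem tot_δ_naturality_assoc {A B C A' B' C' : D.Obj} {f : A ⟶ A'} {g : B ⟶ B'} {h : C ⟶ C'}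
    {M : D.Hor A B} {M' : D.Hor A' B'} {N : D.Hor B C} {N' : D.Hor B' C'}
    (α : D.Sq f g M M') (β : D.Sq g h N N') {Z : E.Tot}
    (k : (⟨_, _, E.hcomp (F.hor M') (F.hor N')⟩ : E.Tot) ⟶ Z) :
    tot (F.sq (D.hcompSq α β)) ≫ tot (F.δ M' N') ≫ k =
      tot (F.δ M N) ≫ tot (E.hcompSq (F.sq α) (F.sq β)) ≫ k := by
  rw [← Category.assoc, tot_δ_naturality, Category.assoc]

theorem tot_η_naturality {A B : D.Obj} (f : A ⟶ B) :
    tot (F.sq (D.hidSq f)) ≫ tot (F.η B) = tot (F.η A) ≫ tot (E.hidSq (F.obj.map f)) :=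
  tot_vcomp_eq (by simp) (by simp) (F.η_naturality f)

theorem tot_associativity {A B C C' : D.Obj} (M : D.Hor A B) (N : D.Hor B C) (P : D.Hor C C') :
    tot (F.δ (D.hcomp M N) P) ≫ tot (E.hcompSq (F.δ M N) (E.vid (F.hor P))) ≫
      tot (E.assoc (F.hor M) (F.hor N) (F.hor P)) =
    tot (F.sq (D.assoc M N P)) ≫
      tot (F.δ M (D.hcomp N P)) ≫ tot (E.hcompSq (E.vid (F.hor M)) (F.δ N P)) :=
  tot_vcomp_eq (by simp [tot]) (by simp [tot]) (F.associativity M N P)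

theorem tot_left_unitality {A B : D.Obj} (M : D.Hor A B) :
    tot (F.δ (D.hid A) M) ≫ tot (E.hcompSq (F.η A) (E.vid (F.hor M))) ≫
      tot (E.lunit (F.hor M)) = tot (F.sq (D.lunit M)) :=
  tot_eq (α := E.vcomp _ (E.vcomp _ _)) (by simp [tot]) (by simp [tot]) (F.left_unitality M)

theorem tot_right_unitality {A B : D.Obj} (M : D.Hor A B) :
    tot (F.δ M (D.hid B)) ≫ tot (E.hcompSq (E.vid (F.hor M)) (F.η B)) ≫
      tot (E.runit (F.hor M)) = tot (F.sq (D.runit M)) :=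
  tot_eq (α := E.vcomp _ (E.vcomp _ _)) (by simp [tot]) (by simp [tot]) (F.right_unitality M)

theorem tot_hcompSq_compδ_left {A B C C' : D.Obj} (M : D.Hor A B) (N : D.Hor B C)
    (P : D.Hor C C') :
    tot (K.hcompSq (compδ F G M N) (K.vid (G.hor (F.hor P)))) =
      tot (K.hcompSq (G.sq (F.δ M N)) (G.sq (E.vid (F.hor P)))) ≫
        tot (K.hcompSq (G.δ (F.hor M) (F.hor N)) (K.vid (G.hor (F.hor P)))) := by
  rw [← tot_interchange]
  refine hcompSq_congr (tot_recast _ _ _) ?_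
  rw [tot_vcomp, G.tot_sq_vid, tot_vid, Category.comp_id]

theorem tot_hcompSq_compδ_right {A B C C' : D.Obj} (M : D.Hor A B) (N : D.Hor B C)
    (P : D.Hor C C') :
    tot (K.hcompSq (K.vid (G.hor (F.hor M))) (compδ F G N P)) =
      tot (K.hcompSq (G.sq (E.vid (F.hor M))) (G.sq (F.δ N P))) ≫
        tot (K.hcompSq (K.vid (G.hor (F.hor M))) (G.δ (F.hor N) (F.hor P))) := by
  rw [← tot_interchange]
  refine hcompSq_congr ?_ (tot_recast _ _ _)
  rw [tot_vcomp, G.tot_sq_vid, tot_vid, Category.comp_id]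

theorem tot_hcompSq_compη_left {A B : D.Obj} (M : D.Hor A B) :
    tot (K.hcompSq (compη F G A) (K.vid (G.hor (F.hor M)))) =
      tot (K.hcompSq (G.sq (F.η A)) (G.sq (E.vid (F.hor M)))) ≫
        tot (K.hcompSq (G.η (F.obj.obj A)) (K.vid (G.hor (F.hor M)))) := by
  rw [← tot_interchange]
  refine hcompSq_congr (tot_recast _ _ _) ?_
  rw [tot_vcomp, G.tot_sq_vid, tot_vid, Category.comp_id]

theorem tot_hcompSq_compη_right {A B : D.Obj} (M : D.Hor A B) :
    tot (K.hcompSq (K.vid (G.hor (F.hor M))) (compη F G B)) =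
      tot (K.hcompSq (G.sq (E.vid (F.hor M))) (G.sq (F.η B))) ≫
        tot (K.hcompSq (K.vid (G.hor (F.hor M))) (G.η (F.obj.obj B))) := by
  rw [← tot_interchange]
  refine hcompSq_congr ?_ (tot_recast _ _ _)
  rw [tot_vcomp, G.tot_sq_vid, tot_vid, Category.comp_id]

/-- The composite oplax double functor, first `F` and then `G`. -/
def comp : OplaxDoubleFunctor D K where
  toVerticallyStrictFunctor := F.toVerticallyStrictFunctor.comp G.toVerticallyStrictFunctor
  δ M N := compδ F G M N
  η A := compη F G A
  δ_naturality {_ _ _ _ _ _ _ _ _ M M' N N'} α β := by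
    apply heq_of_tot
    change tot (G.sq (F.sq (D.hcompSq α β))) ≫ tot (compδ F G M' N') =
      tot (compδ F G M N) ≫ tot (K.hcompSq (G.sq (F.sq α)) (G.sq (F.sq β)))
    rw [tot_compδ, tot_compδ, Category.assoc, ← G.tot_δ_naturality, ← Category.assoc,
      ← Category.assoc, ← G.tot_sq_vcomp, ← G.tot_sq_vcomp]
    congr 1
    exact G.tot_sq_congr (F.tot_δ_naturality α β)
  η_naturality {A B} f := by
    apply heq_of_tot
    change tot (G.sq (F.sq (D.hidSq f))) ≫ tot (compη F G B) =
      tot (compη F G A) ≫ tot (K.hidSq (G.obj.map (F.obj.map f)))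
    rw [tot_compη, tot_compη, Category.assoc, ← G.tot_η_naturality, ← Category.assoc,
      ← Category.assoc, ← G.tot_sq_vcomp, ← G.tot_sq_vcomp]
    congr 1
    exact G.tot_sq_congr (F.tot_η_naturality f)
  associativity M N P := by
    apply heq_of_tot
    change tot (compδ F G (D.hcomp M N) P) ≫
        tot (K.hcompSq (compδ F G M N) (K.vid (G.hor (F.hor P)))) ≫
          tot (K.assoc (G.hor (F.hor M)) (G.hor (F.hor N)) (G.hor (F.hor P))) =
      tot (G.sq (F.sq (D.assoc M N P))) ≫ tot (compδ F G M (D.hcomp N P)) ≫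
        tot (K.hcompSq (K.vid (G.hor (F.hor M))) (compδ F G N P))
    rw [tot_compδ, tot_compδ, F.tot_hcompSq_compδ_left G, F.tot_hcompSq_compδ_right G]
    simp only [Category.assoc]
    rw [← G.tot_δ_naturality_assoc, G.tot_associativity, ← G.tot_δ_naturality_assoc]
    simp only [← Category.assoc]
    congr 2
    simp only [← G.tot_sq_vcomp]
    apply G.tot_sq_congr
    simp only [tot_vcomp, Category.assoc]
    exact F.tot_associativity M N P
  left_unitality {A B} M := by
    apply heq_of_tot
    change tot (compδ F G (D.hid A) M) ≫
        tot (K.hcompSq (compη F G A) (K.vid (G.hor (F.hor M)))) ≫ tot (K.lunit (G.hor (F.hor M))) =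
      tot (G.sq (F.sq (D.lunit M)))
    rw [tot_compδ, F.tot_hcompSq_compη_left G]
    simp only [Category.assoc]
    rw [← G.tot_δ_naturality_assoc, G.tot_left_unitality]
    simp only [← G.tot_sq_vcomp]
    exact G.tot_sq_congr (F.tot_left_unitality M)
  right_unitality {A B} M := by
    apply heq_of_tot
    change tot (compδ F G M (D.hid B)) ≫
        tot (K.hcompSq (K.vid (G.hor (F.hor M))) (compη F G B)) ≫ tot (K.runit (G.hor (F.hor M))) =
      tot (G.sq (F.sq (D.runit M)))
    rw [tot_compδ, F.tot_hcompSq_compη_right G]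
    simp only [Category.assoc]
    rw [← G.tot_δ_naturality_assoc, G.tot_right_unitality]
    simp only [← G.tot_sq_vcomp]
    exact G.tot_sq_congr (F.tot_right_unitality M)

end OplaxDoubleFunctor

namespace LaxDoubleFunctor

/-- The identity lax double functor. -/
def id (D : PseudoDoubleCategory) : LaxDoubleFunctor D D where
  toVerticallyStrictFunctor := .id D
  μ M N := D.vid _
  ε A := D.vid _
  μ_naturality α β := (D.vcomp_vid _).trans (D.vid_vcomp _).symm
  ε_naturality f := (D.vcomp_vid _).trans (D.vid_vcomp _).symm
  associativity M N P := by
    apply heq_of_tot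
    simp only [VerticallyStrictFunctor.id, tot_vcomp, D.hcompSq_vid, tot_vid]
    erw [Category.id_comp, Category.id_comp, Category.id_comp, Category.comp_id]
  left_unitality M := by
    apply heq_of_tot
    simp only [VerticallyStrictFunctor.id, tot_vcomp, D.hcompSq_vid, tot_vid]
    erw [Category.id_comp, Category.id_comp]
  right_unitality M := by
    apply heq_of_tot
    simp only [VerticallyStrictFunctor.id, tot_vcomp, D.hcompSq_vid, tot_vid]
    erw [Category.id_comp, Category.id_comp]

variable {D E K : PseudoDoubleCategory} (F : LaxDoubleFunctor D E) (G : LaxDoubleFunctor E K)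

/-- The comparison 2-cells of a composite. -/
def compμ {A B C : D.Obj} (M : D.Hor A B) (N : D.Hor B C) :
    K.Sq (𝟙 (G.obj.obj (F.obj.obj A))) (𝟙 (G.obj.obj (F.obj.obj C)))
      (K.hcomp (G.hor (F.hor M)) (G.hor (F.hor N))) (G.hor (F.hor (D.hcomp M N))) :=
  recast (by simp) (by simp) (K.vcomp (G.μ (F.hor M) (F.hor N)) (G.sq (F.μ M N)))

/-- The comparison 2-cells of a composite. -/
def compε (A : D.Obj) :
    K.Sq (𝟙 (G.obj.obj (F.obj.obj A))) (𝟙 (G.obj.obj (F.obj.obj A)))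
      (K.hid (G.obj.obj (F.obj.obj A))) (G.hor (F.hor (D.hid A))) :=
  recast (by simp) (by simp) (K.vcomp (G.ε (F.obj.obj A)) (G.sq (F.ε A)))

theorem tot_compμ {A B C : D.Obj} (M : D.Hor A B) (N : D.Hor B C) :
    tot (compμ F G M N) = tot (G.μ (F.hor M) (F.hor N)) ≫ tot (G.sq (F.μ M N)) :=
  tot_recast _ _ _

theorem tot_compε (A : D.Obj) :
    tot (compε F G A) = tot (G.ε (F.obj.obj A)) ≫ tot (G.sq (F.ε A)) :=
  tot_recast _ _ _

theorem tot_μ_naturality {A B C A' B' C' : D.Obj} {f : A ⟶ A'} {g : B ⟶ B'} {h : C ⟶ C'}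
    {M : D.Hor A B} {M' : D.Hor A' B'} {N : D.Hor B C} {N' : D.Hor B' C'}
    (α : D.Sq f g M M') (β : D.Sq g h N N') :
    tot (E.hcompSq (F.sq α) (F.sq β)) ≫ tot (F.μ M' N') =
      tot (F.μ M N) ≫ tot (F.sq (D.hcompSq α β)) :=
  tot_vcomp_eq (by simp) (by simp) (F.μ_naturality α β)

theorem tot_μ_naturality_assoc {A B C A' B' C' : D.Obj} {f : A ⟶ A'} {g : B ⟶ B'} {h : C ⟶ C'}
    {M : D.Hor A B} {M' : D.Hor A' B'} {N : D.Hor B C} {N' : D.Hor B' C'}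
    (α : D.Sq f g M M') (β : D.Sq g h N N') {Z : E.Tot}
    (k : (⟨_, _, F.hor (D.hcomp M' N')⟩ : E.Tot) ⟶ Z) :
    tot (E.hcompSq (F.sq α) (F.sq β)) ≫ tot (F.μ M' N') ≫ k =
      tot (F.μ M N) ≫ tot (F.sq (D.hcompSq α β)) ≫ k := by
  rw [← Category.assoc, tot_μ_naturality, Category.assoc]

theorem tot_ε_naturality {A B : D.Obj} (f : A ⟶ B) :
    tot (E.hidSq (F.obj.map f)) ≫ tot (F.ε B) = tot (F.ε A) ≫ tot (F.sq (D.hidSq f)) :=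
  tot_vcomp_eq (by simp) (by simp) (F.ε_naturality f)

theorem tot_associativity {A B C C' : D.Obj} (M : D.Hor A B) (N : D.Hor B C) (P : D.Hor C C') :
    tot (E.hcompSq (F.μ M N) (E.vid (F.hor P))) ≫
      tot (F.μ (D.hcomp M N) P) ≫ tot (F.sq (D.assoc M N P)) =
    tot (E.assoc (F.hor M) (F.hor N) (F.hor P)) ≫
      tot (E.hcompSq (E.vid (F.hor M)) (F.μ N P)) ≫ tot (F.μ M (D.hcomp N P)) :=
  tot_vcomp_eq (by simp [tot]) (by simp [tot]) (F.associativity M N P)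

theorem tot_associativity_assoc {A B C C' : D.Obj} (M : D.Hor A B) (N : D.Hor B C)
    (P : D.Hor C C') {Z : E.Tot}
    (k : (⟨_, _, F.hor (D.hcomp M (D.hcomp N P))⟩ : E.Tot) ⟶ Z) :
    tot (E.hcompSq (F.μ M N) (E.vid (F.hor P))) ≫
      tot (F.μ (D.hcomp M N) P) ≫ tot (F.sq (D.assoc M N P)) ≫ k =
    tot (E.assoc (F.hor M) (F.hor N) (F.hor P)) ≫
      tot (E.hcompSq (E.vid (F.hor M)) (F.μ N P)) ≫ tot (F.μ M (D.hcomp N P)) ≫ k := by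
  have e := congrArg (fun t => t ≫ k) (F.tot_associativity M N P)
  simpa only [Category.assoc] using e

theorem tot_left_unitality {A B : D.Obj} (M : D.Hor A B) :
    tot (E.hcompSq (F.ε A) (E.vid (F.hor M))) ≫ tot (F.μ (D.hid A) M) ≫
      tot (F.sq (D.lunit M)) = tot (E.lunit (F.hor M)) :=
  tot_eq (α := E.vcomp _ (E.vcomp _ _)) (by simp [tot]) (by simp [tot]) (F.left_unitality M)

theorem tot_right_unitality {A B : D.Obj} (M : D.Hor A B) :
    tot (E.hcompSq (E.vid (F.hor M)) (F.ε B)) ≫ tot (F.μ M (D.hid B)) ≫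
      tot (F.sq (D.runit M)) = tot (E.runit (F.hor M)) :=
  tot_eq (α := E.vcomp _ (E.vcomp _ _)) (by simp [tot]) (by simp [tot]) (F.right_unitality M)

theorem tot_hcompSq_compμ_left {A B C C' : D.Obj} (M : D.Hor A B) (N : D.Hor B C)
    (P : D.Hor C C') :
    tot (K.hcompSq (compμ F G M N) (K.vid (G.hor (F.hor P)))) =
      tot (K.hcompSq (G.μ (F.hor M) (F.hor N)) (K.vid (G.hor (F.hor P)))) ≫
        tot (K.hcompSq (G.sq (F.μ M N)) (G.sq (E.vid (F.hor P)))) := by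
  rw [← tot_interchange]
  refine hcompSq_congr (tot_recast _ _ _) ?_
  rw [tot_vcomp, G.tot_sq_vid, tot_vid, Category.comp_id]

theorem tot_hcompSq_compμ_right {A B C C' : D.Obj} (M : D.Hor A B) (N : D.Hor B C)
    (P : D.Hor C C') :
    tot (K.hcompSq (K.vid (G.hor (F.hor M))) (compμ F G N P)) =
      tot (K.hcompSq (K.vid (G.hor (F.hor M))) (G.μ (F.hor N) (F.hor P))) ≫
        tot (K.hcompSq (G.sq (E.vid (F.hor M))) (G.sq (F.μ N P))) := by
  rw [← tot_interchange]
  refine hcompSq_congr ?_ (tot_recast _ _ _)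
  rw [tot_vcomp, G.tot_sq_vid, tot_vid, Category.comp_id]

theorem tot_hcompSq_compε_left {A B : D.Obj} (M : D.Hor A B) :
    tot (K.hcompSq (compε F G A) (K.vid (G.hor (F.hor M)))) =
      tot (K.hcompSq (G.ε (F.obj.obj A)) (K.vid (G.hor (F.hor M)))) ≫
        tot (K.hcompSq (G.sq (F.ε A)) (G.sq (E.vid (F.hor M)))) := by
  rw [← tot_interchange]
  refine hcompSq_congr (tot_recast _ _ _) ?_
  rw [tot_vcomp, G.tot_sq_vid, tot_vid, Category.comp_id]

theorem tot_hcompSq_compε_right {A B : D.Obj} (M : D.Hor A B) :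
    tot (K.hcompSq (K.vid (G.hor (F.hor M))) (compε F G B)) =
      tot (K.hcompSq (K.vid (G.hor (F.hor M))) (G.ε (F.obj.obj B))) ≫
        tot (K.hcompSq (G.sq (E.vid (F.hor M))) (G.sq (F.ε B))) := by
  rw [← tot_interchange]
  refine hcompSq_congr ?_ (tot_recast _ _ _)
  rw [tot_vcomp, G.tot_sq_vid, tot_vid, Category.comp_id]

/-- The composite lax double functor, first `F` and then `G`. -/
def comp : LaxDoubleFunctor D K where
  toVerticallyStrictFunctor := F.toVerticallyStrictFunctor.comp G.toVerticallyStrictFunctor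
  μ M N := compμ F G M N
  ε A := compε F G A
  μ_naturality {_ _ _ _ _ _ _ _ _ M M' N N'} α β := by
    apply heq_of_tot
    change tot (K.hcompSq (G.sq (F.sq α)) (G.sq (F.sq β))) ≫ tot (compμ F G M' N') =
      tot (compμ F G M N) ≫ tot (G.sq (F.sq (D.hcompSq α β)))
    rw [tot_compμ, tot_compμ, G.tot_μ_naturality_assoc, Category.assoc,
      ← G.tot_sq_vcomp, ← G.tot_sq_vcomp]
    congr 1
    exact G.tot_sq_congr (F.tot_μ_naturality α β)
  ε_naturality {A B} f := by
    apply heq_of_tot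
    change tot (K.hidSq (G.obj.map (F.obj.map f))) ≫ tot (compε F G B) =
      tot (compε F G A) ≫ tot (G.sq (F.sq (D.hidSq f)))
    rw [tot_compε, tot_compε, ← Category.assoc, G.tot_ε_naturality, Category.assoc,
      Category.assoc, ← G.tot_sq_vcomp, ← G.tot_sq_vcomp]
    congr 1
    exact G.tot_sq_congr (F.tot_ε_naturality f)
  associativity M N P := by
    apply heq_of_tot
    change tot (K.hcompSq (compμ F G M N) (K.vid (G.hor (F.hor P)))) ≫
        tot (compμ F G (D.hcomp M N) P) ≫ tot (G.sq (F.sq (D.assoc M N P))) =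
      tot (K.assoc (G.hor (F.hor M)) (G.hor (F.hor N)) (G.hor (F.hor P))) ≫
        tot (K.hcompSq (K.vid (G.hor (F.hor M))) (compμ F G N P)) ≫
          tot (compμ F G M (D.hcomp N P))
    rw [tot_compμ, tot_compμ, F.tot_hcompSq_compμ_left G, F.tot_hcompSq_compμ_right G]
    simp only [Category.assoc]
    rw [G.tot_μ_naturality_assoc, G.tot_μ_naturality_assoc, ← G.tot_associativity_assoc]
    congr 2
    simp only [← G.tot_sq_vcomp]
    apply G.tot_sq_congr
    simp only [tot_vcomp]
    exact F.tot_associativity M N P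
  left_unitality {A B} M := by
    apply heq_of_tot
    change tot (K.hcompSq (compε F G A) (K.vid (G.hor (F.hor M)))) ≫
        tot (compμ F G (D.hid A) M) ≫ tot (G.sq (F.sq (D.lunit M))) =
      tot (K.lunit (G.hor (F.hor M)))
    rw [tot_compμ, F.tot_hcompSq_compε_left G, ← G.tot_left_unitality]
    simp only [Category.assoc]
    rw [G.tot_μ_naturality_assoc]
    congr 2
    simp only [← G.tot_sq_vcomp]
    exact G.tot_sq_congr (F.tot_left_unitality M)
  right_unitality {A B} M := by
    apply heq_of_tot
    change tot (K.hcompSq (K.vid (G.hor (F.hor M))) (compε F G B)) ≫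
        tot (compμ F G M (D.hid B)) ≫ tot (G.sq (F.sq (D.runit M))) =
      tot (K.runit (G.hor (F.hor M)))
    rw [tot_compμ, F.tot_hcompSq_compε_right G, ← G.tot_right_unitality]
    simp only [Category.assoc]
    rw [G.tot_μ_naturality_assoc]
    congr 2
    simp only [← G.tot_sq_vcomp]
    exact G.tot_sq_congr (F.tot_right_unitality M)

end LaxDoubleFunctor

/-! ### Double equivalences -/

/-- The data of a vertical transformation between vertically strict functors, natural with respect
to vertical 1-cells and 2-cells. -/
structure VerticalTransformation {D E : PseudoDoubleCategory} (F G : VerticallyStrictFunctor D E)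
    where
  /-- the components at 0-cells -/
  app : F.obj ⟶ G.obj
  /-- the components at horizontal 1-cells -/
  sq : ∀ {A B : D.Obj} (M : D.Hor A B), E.Sq (app.app A) (app.app B) (F.hor M) (G.hor M)
  naturality : ∀ {A B A' B' : D.Obj} {f : A ⟶ A'} {g : B ⟶ B'} {M : D.Hor A B}
    {M' : D.Hor A' B'} (α : D.Sq f g M M'),
    E.vcomp (F.sq α) (sq M') ≍ E.vcomp (sq M) (G.sq α)

/-- Two vertical transformations are mutually inverse. -/
structure VerticalTransformation.AreInverse {D E : PseudoDoubleCategory}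
    {F G : VerticallyStrictFunctor D E}
    (σ : VerticalTransformation F G) (τ : VerticalTransformation G F) : Prop where
  app_left : σ.app ≫ τ.app = 𝟙 F.obj
  app_right : τ.app ≫ σ.app = 𝟙 G.obj
  sq_left : ∀ {A B : D.Obj} (M : D.Hor A B), E.vcomp (σ.sq M) (τ.sq M) ≍ E.vid (F.hor M)
  sq_right : ∀ {A B : D.Obj} (M : D.Hor A B), E.vcomp (τ.sq M) (σ.sq M) ≍ E.vid (G.hor M)

namespace OplaxDoubleFunctor

variable {D E : PseudoDoubleCategory}

/-- A vertical transformation of oplax double functors: one that is compatible with the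
comparison 2-cells. -/
structure Transformation (F G : OplaxDoubleFunctor D E) extends
    VerticalTransformation F.toVerticallyStrictFunctor G.toVerticallyStrictFunctor where
  comp_δ : ∀ {A B C : D.Obj} (M : D.Hor A B) (N : D.Hor B C),
    E.vcomp (sq (D.hcomp M N)) (G.δ M N) ≍ E.vcomp (F.δ M N) (E.hcompSq (sq M) (sq N))
  comp_η : ∀ A : D.Obj,
    E.vcomp (sq (D.hid A)) (G.η A) ≍ E.vcomp (F.η A) (E.hidSq (app.app A))

/-- Two oplax double functors are isomorphic: there are mutually inverse vertical transformations
between them. -/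
def Isomorphic (F G : OplaxDoubleFunctor D E) : Prop :=
  ∃ (σ : Transformation F G) (τ : Transformation G F),
    σ.toVerticalTransformation.AreInverse τ.toVerticalTransformation

/-- An oplax double functor is a pseudo-double functor if its comparison 2-cells are invertible. -/
def IsPseudo (F : OplaxDoubleFunctor D E) : Prop :=
  (∀ {A B C : D.Obj} (M : D.Hor A B) (N : D.Hor B C), IsInvertible (F.δ M N)) ∧
    ∀ A : D.Obj, IsInvertible (F.η A)

/-- An oplax double functor is a double equivalence if it is a pseudo-double functor and there is a
pseudo-double functor in the other direction such that both composites are isomorphic to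
identities. -/
def IsDoubleEquivalence (F : OplaxDoubleFunctor D E) : Prop :=
  F.IsPseudo ∧ ∃ G : OplaxDoubleFunctor E D, G.IsPseudo ∧
    (F.comp G).Isomorphic (id D) ∧ (G.comp F).Isomorphic (id E)

end OplaxDoubleFunctor

namespace LaxDoubleFunctor

variable {D E : PseudoDoubleCategory}

/-- A vertical transformation of lax double functors: one that is compatible with the
comparison 2-cells. -/
structure Transformation (F G : LaxDoubleFunctor D E) extends
    VerticalTransformation F.toVerticallyStrictFunctor G.toVerticallyStrictFunctor where
  μ_comp : ∀ {A B C : D.Obj} (M : D.Hor A B) (N : D.Hor B C),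
    E.vcomp (F.μ M N) (sq (D.hcomp M N)) ≍ E.vcomp (E.hcompSq (sq M) (sq N)) (G.μ M N)
  ε_comp : ∀ A : D.Obj,
    E.vcomp (F.ε A) (sq (D.hid A)) ≍ E.vcomp (E.hidSq (app.app A)) (G.ε A)

/-- Two lax double functors are isomorphic: there are mutually inverse vertical transformations
between them. -/
def Isomorphic (F G : LaxDoubleFunctor D E) : Prop :=
  ∃ (σ : Transformation F G) (τ : Transformation G F),
    σ.toVerticalTransformation.AreInverse τ.toVerticalTransformation

/-- A lax double functor is a pseudo-double functor if its comparison 2-cells are invertible. -/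
def IsPseudo (F : LaxDoubleFunctor D E) : Prop :=
  (∀ {A B C : D.Obj} (M : D.Hor A B) (N : D.Hor B C), IsInvertible (F.μ M N)) ∧
    ∀ A : D.Obj, IsInvertible (F.ε A)

/-- A lax double functor is a double equivalence if it is a pseudo-double functor and there is a
pseudo-double functor in the other direction such that both composites are isomorphic to
identities. -/
def IsDoubleEquivalence (F : LaxDoubleFunctor D E) : Prop :=
  F.IsPseudo ∧ ∃ G : LaxDoubleFunctor E D, G.IsPseudo ∧
    (F.comp G).Isomorphic (id D) ∧ (G.comp F).Isomorphic (id E)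

end LaxDoubleFunctor

/-! ### Extensivity and the adjunction between families and slices over copowers -/

section Extensive

variable (V : Type u) [Category.{v} V]

/-- The functor `∏ᵢ V / Xᵢ ⥤ V / ∐ᵢ Xᵢ` that sends a family of morphisms to its coproduct. -/
noncomputable def coprodOver [HasCoproducts.{w} V] {I : Type w} (X : I → V) :
    (∀ i, Over (X i)) ⥤ Over (∐ X) where
  obj A := Over.mk (Limits.Sigma.map fun i => (A i).hom)
  map {A B} f := Over.homMk (Limits.Sigma.map fun i => (f i).left) (by
    apply Limits.Sigma.hom_ext; intro i; simp)
  map_id A := by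
    ext1; apply Limits.Sigma.hom_ext; intro i; simp
  map_comp f g := by
    ext1; apply Limits.Sigma.hom_ext; intro i; simp

/-- `V` is extensive: it has all small coproducts, and for every small family `X` the functor
`∏ᵢ V / Xᵢ ⥤ V / ∐ᵢ Xᵢ` is an equivalence of categories. -/
structure IsExtensive : Prop where
  hasCoproducts : HasCoproducts.{w} V
  isEquivalence : ∀ (I : Type w) (X : I → V), (coprodOver V X).IsEquivalence

end Extensive

section Copower

variable (V : Type u) [Category.{v} V] [CartesianMonoidalCategory V] [HasCoproducts.{w} V]

/-- The copower `I • 1`. -/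
noncomputable abbrev copow (I : Type w) : V := ∐ fun _ : I => 𝟙_ V

/-- The coprojection `1 ⟶ I • 1` of index `i`. -/
noncomputable abbrev copowι {I : Type w} (i : I) : 𝟙_ V ⟶ copow V I :=
  Limits.Sigma.ι (fun _ : I => 𝟙_ V) i

variable {V}

/-- The morphism `A ⟶ 1 ⟶ I • 1`. -/
noncomputable abbrev const (A : V) {I : Type w} (i : I) : A ⟶ copow V I :=
  toUnit A ≫ copowι V i

@[simp]
theorem comp_const {A B : V} (f : A ⟶ B) {I : Type w} (i : I) : f ≫ const B i = const A i := by
  rw [const, const, ← Category.assoc, toUnit_unique (f ≫ toUnit B) (toUnit A)]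

variable (V)

/-- The functor `V^I ⥤ V / (I • 1)`, sending `A` to `∐ᵢ Aᵢ ⟶ ∐ᵢ 1`. -/
noncomputable def coprodFunctor (I : Type w) : (I → V) ⥤ Over (copow V I) where
  obj A := Over.mk (Limits.Sigma.map fun i => toUnit (A i))
  map {A B} f := Over.homMk (Limits.Sigma.map f) (by
    apply Limits.Sigma.hom_ext; intro i; simp)
  map_id A := by
    ext1; apply Limits.Sigma.hom_ext; intro i; simp
  map_comp f g := by
    ext1; apply Limits.Sigma.hom_ext; intro i; simp

/-- The functor `V / (I • 1) ⥤ V^I` whose component of index `i` is the pullback along the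
coprojection of index `i`. -/
noncomputable def fibresFunctor [HasFiniteLimits V] (I : Type w) : Over (copow V I) ⥤ (I → V) :=
  Functor.pi' fun i => Over.pullback (copowι V i) ⋙ Over.forget _

section Adjunction

variable {V} {I : Type w} {A : I → V} {B : Over (copow V I)}

/-- The morphism of `V` underlying a morphism over `I • 1` out of a coproduct. -/
noncomputable def coprodHom (f : (coprodFunctor V I).obj A ⟶ B) : ∐ A ⟶ B.left := f.left

theorem coprodHom_w (f : (coprodFunctor V I).obj A ⟶ B) :
    coprodHom f ≫ B.hom = Limits.Sigma.map fun i => toUnit (A i) := Over.w f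

theorem over_hom_ext {f g : (coprodFunctor V I).obj A ⟶ B}
    (e : ∀ i, Limits.Sigma.ι A i ≫ coprodHom f = Limits.Sigma.ι A i ≫ coprodHom g) : f = g :=
  Over.OverMorphism.ext (Limits.Sigma.hom_ext (coprodHom f) (coprodHom g) e)

variable [HasFiniteLimits V]

/-- The family of morphisms into the fibres induced by a morphism over `I • 1`. -/
noncomputable def toFibre (f : (coprodFunctor V I).obj A ⟶ B) (i : I) :
    A i ⟶ pullback B.hom (copowι V i) :=
  pullback.lift (Limits.Sigma.ι A i ≫ coprodHom f) (toUnit (A i)) (by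
    rw [Category.assoc, coprodHom_w, Limits.Sigma.ι_map])

/-- The morphism over `I • 1` induced by a family of morphisms into the fibres. -/
noncomputable def ofFibre (g : ∀ i, A i ⟶ pullback B.hom (copowι V i)) :
    (coprodFunctor V I).obj A ⟶ B :=
  Over.homMk (Limits.Sigma.desc fun i => g i ≫ pullback.fst B.hom (copowι V i)) (by
    change (Limits.Sigma.desc fun i => g i ≫ pullback.fst B.hom (copowι V i)) ≫ B.hom =
      Limits.Sigma.map fun i => toUnit (A i)
    apply Limits.Sigma.hom_ext
    intro i
    rw [Limits.Sigma.ι_desc_assoc, Limits.Sigma.ι_map, Category.assoc, pullback.condition,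
      ← Category.assoc]
    exact congrArg (· ≫ copowι V i) (toUnit_unique _ _))

theorem toFibre_fst (f : (coprodFunctor V I).obj A ⟶ B) (i : I) :
    toFibre f i ≫ pullback.fst B.hom (copowι V i) = Limits.Sigma.ι A i ≫ coprodHom f :=
  pullback.lift_fst _ _ _

theorem ι_ofFibre (g : ∀ i, A i ⟶ pullback B.hom (copowι V i)) (i : I) :
    Limits.Sigma.ι A i ≫ coprodHom (ofFibre g) = g i ≫ pullback.fst B.hom (copowι V i) :=
  Limits.Sigma.ι_desc _ _

theorem fibre_hom_ext {X : V} {i : I} {g h : X ⟶ pullback B.hom (copowι V i)}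
    (e : g ≫ pullback.fst B.hom (copowι V i) = h ≫ pullback.fst B.hom (copowι V i)) : g = h :=
  pullback.hom_ext e (toUnit_unique _ _)

theorem ofFibre_comp {A' : I → V} (f : ∀ i, A' i ⟶ A i)
    (g : ∀ i, A i ⟶ pullback B.hom (copowι V i)) :
    coprodHom (ofFibre fun i => f i ≫ g i) = Limits.Sigma.map f ≫ coprodHom (ofFibre g) := by
  apply Limits.Sigma.hom_ext
  intro i
  rw [ι_ofFibre, Limits.Sigma.ι_map_assoc, ι_ofFibre, Category.assoc]

theorem toFibre_comp {B' : Over (copow V I)} (f : (coprodFunctor V I).obj A ⟶ B) (g : B ⟶ B')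
    (i : I) (h) :
    toFibre (f ≫ g) i = toFibre f i ≫
      pullback.lift (f := B'.hom) (g := copowι V i)
        (pullback.fst B.hom (copowι V i) ≫ g.left) (pullback.snd B.hom (copowι V i)) h := by
  apply fibre_hom_ext
  rw [Category.assoc, pullback.lift_fst, ← Category.assoc, toFibre_fst, toFibre_fst,
    Category.assoc]
  rfl

end Adjunction

/-- The adjunction between `V^I` and `V / (I • 1)`. -/
noncomputable def coprodAdj [HasFiniteLimits V] (I : Type w) :
    coprodFunctor V I ⊣ fibresFunctor V I :=
  Adjunction.mkOfHomEquiv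
    { homEquiv := fun _ _ =>
        { toFun := fun f i => toFibre f i
          invFun := fun g => ofFibre g
          left_inv := fun f => over_hom_ext fun i =>
            (ι_ofFibre _ _).trans (toFibre_fst _ _)
          right_inv := fun g => funext fun i => fibre_hom_ext
            ((toFibre_fst _ _).trans (ι_ofFibre _ _)) }
      homEquiv_naturality_left_symm := fun f g => Over.OverMorphism.ext (ofFibre_comp f g)
      homEquiv_naturality_right := fun f g => funext fun i => toFibre_comp f g i _ }

end Copower

/-! ### The pseudo-double category of discrete spans -/

section Copower

variable {V : Type u} [Category.{v} V] [CartesianMonoidalCategory V] [HasCoproducts.{w} V]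

/-- The morphism `u • 1 : I • 1 ⟶ K • 1` induced by a map `u : I ⟶ K` of sets. -/
noncomputable def copowMap {I K : Type w} (u : I ⟶ K) : copow V I ⟶ copow V K :=
  Limits.Sigma.desc fun i => copowι V (u i)

@[simp]
theorem copowι_map {I K : Type w} (u : I ⟶ K) (i : I) :
    copowι V i ≫ copowMap u = copowι V (u i) :=
  Limits.Sigma.ι_desc _ _

@[simp]
theorem const_map (A : V) {I K : Type w} (u : I ⟶ K) (i : I) :
    const A i ≫ copowMap u = const A (u i) := by
  rw [const, Category.assoc, copowι_map]

theorem copow_hom_ext {I : Type w} {A : V} {f g : copow V I ⟶ A}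
    (e : ∀ i, copowι V i ≫ f = copowι V i ≫ g) : f = g :=
  Limits.Sigma.hom_ext _ _ e

@[simp]
theorem copowMap_id (I : Type w) : copowMap (𝟙 I) = 𝟙 (copow V I) :=
  copow_hom_ext fun i => by rw [copowι_map, Category.comp_id]; rfl

@[simp]
theorem copowMap_comp {I J K : Type w} (u : I ⟶ J) (v : J ⟶ K) :
    copowMap (V := V) (u ≫ v) = copowMap u ≫ copowMap v :=
  copow_hom_ext fun i => by
    rw [copowι_map, ← Category.assoc, copowι_map, copowι_map]; rfl

end Copower

section Spans

variable (V : Type u) [Category.{v} V] [CartesianMonoidalCategory V] [HasCoproducts.{w} V]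

/-- A discrete span `I • 1 ⟵ A ⟶ J • 1`. -/
structure DSpan (I J : Type w) where
  apex : V
  l : apex ⟶ copow V I
  r : apex ⟶ copow V J

variable {V}

/-- A 2-cell of discrete spans over a pair of maps of sets. -/
structure DSpanHom {I J K L : Type w} (a : I ⟶ K) (b : J ⟶ L) (A : DSpan V I J)
    (B : DSpan V K L) where
  hom : A.apex ⟶ B.apex
  w_l : hom ≫ B.l = A.l ≫ copowMap a
  w_r : hom ≫ B.r = A.r ≫ copowMap b

theorem DSpanHom.ext {I J K L : Type w} {a : I ⟶ K} {b : J ⟶ L} {A : DSpan V I J}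
    {B : DSpan V K L} {f g : DSpanHom a b A B} (e : f.hom = g.hom) : f = g := by
  cases f; cases g; cases e; rfl

theorem DSpanHom.heq {I J K L : Type w} {a a' : I ⟶ K} {b b' : J ⟶ L} {A : DSpan V I J}
    {B : DSpan V K L} {f : DSpanHom a b A B} {g : DSpanHom a' b' A B} (ha : a = a') (hb : b = b')
    (e : f.hom = g.hom) : f ≍ g := by
  subst ha; subst hb; exact heq_of_eq (DSpanHom.ext e)

namespace DSpan

/-- The identity span. -/
noncomputable abbrev one (I : Type w) : DSpan V I I := ⟨copow V I, 𝟙 _, 𝟙 _⟩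

variable [HasFiniteLimits V] {I J K L : Type w}

/-- The composite of two spans, given by the pullback. -/
noncomputable def comp (A : DSpan V I J) (B : DSpan V J K) : DSpan V I K where
  apex := pullback A.r B.l
  l := pullback.fst A.r B.l ≫ A.l
  r := pullback.snd A.r B.l ≫ B.r

/-- The first projection of a composite span. -/
noncomputable def p₁ (A : DSpan V I J) (B : DSpan V J K) : (A.comp B).apex ⟶ A.apex :=
  pullback.fst A.r B.l

/-- The second projection of a composite span. -/
noncomputable def p₂ (A : DSpan V I J) (B : DSpan V J K) : (A.comp B).apex ⟶ B.apex :=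
  pullback.snd A.r B.l

@[simp]
theorem comp_l (A : DSpan V I J) (B : DSpan V J K) : (A.comp B).l = p₁ A B ≫ A.l := rfl

@[simp]
theorem comp_r (A : DSpan V I J) (B : DSpan V J K) : (A.comp B).r = p₂ A B ≫ B.r := rfl

theorem condition (A : DSpan V I J) (B : DSpan V J K) : p₁ A B ≫ A.r = p₂ A B ≫ B.l :=
  pullback.condition

/-- The universal property of a composite span. -/
noncomputable def lift {A : DSpan V I J} {B : DSpan V J K} {X : V} (f : X ⟶ A.apex)
    (g : X ⟶ B.apex) (h : f ≫ A.r = g ≫ B.l) : X ⟶ (A.comp B).apex :=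
  pullback.lift f g h

variable {A : DSpan V I J} {B : DSpan V J K} {X Y : V} (f : X ⟶ A.apex)
    (g : X ⟶ B.apex) (h : f ≫ A.r = g ≫ B.l)

@[simp]
theorem lift_p₁ : lift f g h ≫ p₁ A B = f := pullback.lift_fst _ _ _

@[simp]
theorem lift_p₂ : lift f g h ≫ p₂ A B = g := pullback.lift_snd _ _ _

@[simp]
theorem lift_p₁_assoc (k : A.apex ⟶ Y) : lift f g h ≫ p₁ A B ≫ k = f ≫ k := by
  rw [← Category.assoc, lift_p₁]

@[simp]
theorem lift_p₂_assoc (k : B.apex ⟶ Y) : lift f g h ≫ p₂ A B ≫ k = g ≫ k := by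
  rw [← Category.assoc, lift_p₂]

theorem hom_ext {f g : X ⟶ (A.comp B).apex} (e : f ≫ p₁ A B = g ≫ p₁ A B)
    (e' : f ≫ p₂ A B = g ≫ p₂ A B) : f = g :=
  pullback.hom_ext e e'

end DSpan

attribute [simp] DSpanHom.w_l DSpanHom.w_r

namespace DSpanHom

section
variable {I J K L I' J' K' : Type w} {A : DSpan V I J} {B : DSpan V K L}

theorem w_l_assoc {a : I ⟶ K} {b : J ⟶ L} (f : DSpanHom a b A B) {X : V} (k : copow V K ⟶ X) :
    f.hom ≫ B.l ≫ k = A.l ≫ copowMap a ≫ k := by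
  rw [← Category.assoc, f.w_l, Category.assoc]

theorem w_r_assoc {a : I ⟶ K} {b : J ⟶ L} (f : DSpanHom a b A B) {X : V} (k : copow V L ⟶ X) :
    f.hom ≫ B.r ≫ k = A.r ≫ copowMap b ≫ k := by
  rw [← Category.assoc, f.w_r, Category.assoc]

/-- The 2-cell with identity vertical sides given by a morphism of spans. -/
def glob {A B : DSpan V I J} (f : A.apex ⟶ B.apex) (hl : f ≫ B.l = A.l) (hr : f ≫ B.r = A.r) :
    DSpanHom (𝟙 I) (𝟙 J) A B :=
  ⟨f, by rw [hl, copowMap_id, Category.comp_id], by rw [hr, copowMap_id, Category.comp_id]⟩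

@[simp]
theorem glob_hom {A B : DSpan V I J} (f : A.apex ⟶ B.apex) (hl hr) :
    (glob (A := A) (B := B) f hl hr).hom = f := rfl

/-- Vertical composition. -/
def vcomp {E F : Type w} {C : DSpan V E F} {a : I ⟶ K} {b : J ⟶ L} {a' : K ⟶ E} {b' : L ⟶ F}
    (f : DSpanHom a b A B) (g : DSpanHom a' b' B C) : DSpanHom (a ≫ a') (b ≫ b') A C where
  hom := f.hom ≫ g.hom
  w_l := by rw [Category.assoc, g.w_l, w_l_assoc, copowMap_comp]
  w_r := by rw [Category.assoc, g.w_r, w_r_assoc, copowMap_comp]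

@[simp]
theorem vcomp_hom {E F : Type w} {C : DSpan V E F} {a : I ⟶ K} {b : J ⟶ L} {a' : K ⟶ E}
    {b' : L ⟶ F} (f : DSpanHom a b A B) (g : DSpanHom a' b' B C) :
    (f.vcomp g).hom = f.hom ≫ g.hom := rfl

/-- The horizontal identity 2-cell. -/
noncomputable def hid (a : I ⟶ K) : DSpanHom a a (DSpan.one (V := V) I) (DSpan.one K) where
  hom := copowMap a
  w_l := (Category.comp_id _).trans (Category.id_comp _).symm
  w_r := (Category.comp_id _).trans (Category.id_comp _).symm

@[simp]
theorem hid_hom (a : I ⟶ K) : (hid (V := V) a).hom = copowMap a := rfl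

end

variable [HasFiniteLimits V] {I J K I' J' K' : Type w}

/-- Horizontal composition of 2-cells. -/
noncomputable def hcomp {a : I ⟶ I'} {b : J ⟶ J'} {c : K ⟶ K'} {A : DSpan V I J}
    {A' : DSpan V I' J'} {B : DSpan V J K} {B' : DSpan V J' K'}
    (f : DSpanHom a b A A') (g : DSpanHom b c B B') :
    DSpanHom a c (A.comp B) (A'.comp B') where
  hom := DSpan.lift (DSpan.p₁ A B ≫ f.hom) (DSpan.p₂ A B ≫ g.hom) (by
    rw [Category.assoc, Category.assoc, f.w_r, g.w_l, ← Category.assoc, DSpan.condition,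
      Category.assoc])
  w_l := by simp
  w_r := by simp

@[simp]
theorem hcomp_p₁ {a : I ⟶ I'} {b : J ⟶ J'} {c : K ⟶ K'} {A : DSpan V I J}
    {A' : DSpan V I' J'} {B : DSpan V J K} {B' : DSpan V J' K'}
    (f : DSpanHom a b A A') (g : DSpanHom b c B B') :
    (f.hcomp g).hom ≫ DSpan.p₁ A' B' = DSpan.p₁ A B ≫ f.hom := DSpan.lift_p₁ _ _ _

@[simp]
theorem hcomp_p₂ {a : I ⟶ I'} {b : J ⟶ J'} {c : K ⟶ K'} {A : DSpan V I J}
    {A' : DSpan V I' J'} {B : DSpan V J K} {B' : DSpan V J' K'}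
    (f : DSpanHom a b A A') (g : DSpanHom b c B B') :
    (f.hcomp g).hom ≫ DSpan.p₂ A' B' = DSpan.p₂ A B ≫ g.hom := DSpan.lift_p₂ _ _ _

@[simp]
theorem hcomp_p₁_assoc {a : I ⟶ I'} {b : J ⟶ J'} {c : K ⟶ K'} {A : DSpan V I J}
    {A' : DSpan V I' J'} {B : DSpan V J K} {B' : DSpan V J' K'}
    (f : DSpanHom a b A A') (g : DSpanHom b c B B') {X : V} (k : A'.apex ⟶ X) :
    (f.hcomp g).hom ≫ DSpan.p₁ A' B' ≫ k = DSpan.p₁ A B ≫ f.hom ≫ k :=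
  DSpan.lift_p₁_assoc _ _ _ _ |>.trans (Category.assoc _ _ _)

@[simp]
theorem hcomp_p₂_assoc {a : I ⟶ I'} {b : J ⟶ J'} {c : K ⟶ K'} {A : DSpan V I J}
    {A' : DSpan V I' J'} {B : DSpan V J K} {B' : DSpan V J' K'}
    (f : DSpanHom a b A A') (g : DSpanHom b c B B') {X : V} (k : B'.apex ⟶ X) :
    (f.hcomp g).hom ≫ DSpan.p₂ A' B' ≫ k = DSpan.p₂ A B ≫ g.hom ≫ k :=
  DSpan.lift_p₂_assoc _ _ _ _ |>.trans (Category.assoc _ _ _)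

end DSpanHom

namespace DSpan

variable [HasFiniteLimits V] {I J K L : Type w}

theorem condition_assoc (A : DSpan V I J) (B : DSpan V J K) {X : V} (k : copow V J ⟶ X) :
    p₁ A B ≫ A.r ≫ k = p₂ A B ≫ B.l ≫ k := by
  rw [← Category.assoc, condition, Category.assoc]

/-- The associator. -/
noncomputable def assocHom (A : DSpan V I J) (B : DSpan V J K) (C : DSpan V K L) :
    DSpanHom (𝟙 I) (𝟙 L) ((A.comp B).comp C) (A.comp (B.comp C)) :=
  .glob (lift (p₁ (A.comp B) C ≫ p₁ A B)
    (lift (p₁ (A.comp B) C ≫ p₂ A B) (p₂ (A.comp B) C) (by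
      rw [Category.assoc, ← comp_r, condition]))
    (by rw [comp_l, lift_p₁_assoc, Category.assoc, Category.assoc, condition]))
    (by simp) (by simp)

/-- The inverse of the associator. -/
noncomputable def assocInv (A : DSpan V I J) (B : DSpan V J K) (C : DSpan V K L) :
    DSpanHom (𝟙 I) (𝟙 L) (A.comp (B.comp C)) ((A.comp B).comp C) :=
  .glob (lift (lift (p₁ A (B.comp C)) (p₂ A (B.comp C) ≫ p₁ B C) (by
      rw [Category.assoc, ← comp_l, condition]))
    (p₂ A (B.comp C) ≫ p₂ B C)
    (by rw [comp_r, lift_p₂_assoc, Category.assoc, Category.assoc, condition]))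
    (by simp) (by simp)

/-- The left unitor. -/
noncomputable def lunitHom (A : DSpan V I J) : DSpanHom (𝟙 I) (𝟙 J) ((one I).comp A) A :=
  .glob (p₂ (one I) A) (by rw [comp_l, ← condition]) rfl

/-- The inverse of the left unitor. -/
noncomputable def lunitInv (A : DSpan V I J) : DSpanHom (𝟙 I) (𝟙 J) A ((one I).comp A) :=
  .glob (lift A.l (𝟙 _) (by rw [Category.id_comp, Category.comp_id]))
    ((lift_p₁_assoc _ _ _ _).trans (Category.comp_id _))
    ((lift_p₂_assoc _ _ _ _).trans (Category.id_comp _))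

/-- The right unitor. -/
noncomputable def runitHom (A : DSpan V I J) : DSpanHom (𝟙 I) (𝟙 J) (A.comp (one J)) A :=
  .glob (p₁ A (one J)) rfl (by rw [comp_r, condition])

/-- The inverse of the right unitor. -/
noncomputable def runitInv (A : DSpan V I J) : DSpanHom (𝟙 I) (𝟙 J) A (A.comp (one J)) :=
  .glob (lift (𝟙 _) A.r (by rw [Category.id_comp, Category.comp_id]))
    ((lift_p₁_assoc _ _ _ _).trans (Category.id_comp _))
    ((lift_p₂_assoc _ _ _ _).trans (Category.comp_id _))

section Projections

variable (A : DSpan V I J) (B : DSpan V J K) (C : DSpan V K L) {X : V}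

@[simp]
theorem assocHom_p₁ : (assocHom A B C).hom ≫ p₁ A (B.comp C) = p₁ (A.comp B) C ≫ p₁ A B :=
  lift_p₁ _ _ _

@[simp]
theorem assocHom_p₂_p₁ : (assocHom A B C).hom ≫ p₂ A (B.comp C) ≫ p₁ B C =
    p₁ (A.comp B) C ≫ p₂ A B :=
  (lift_p₂_assoc _ _ _ _).trans (lift_p₁ _ _ _)

@[simp]
theorem assocHom_p₂_p₂ : (assocHom A B C).hom ≫ p₂ A (B.comp C) ≫ p₂ B C = p₂ (A.comp B) C :=
  (lift_p₂_assoc _ _ _ _).trans (lift_p₂ _ _ _)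

@[simp]
theorem assocHom_p₁_assoc (k : A.apex ⟶ X) :
    (assocHom A B C).hom ≫ p₁ A (B.comp C) ≫ k = p₁ (A.comp B) C ≫ p₁ A B ≫ k := by
  rw [← Category.assoc, assocHom_p₁, Category.assoc]

@[simp]
theorem assocHom_p₂_p₁_assoc (k : B.apex ⟶ X) :
    (assocHom A B C).hom ≫ p₂ A (B.comp C) ≫ p₁ B C ≫ k = p₁ (A.comp B) C ≫ p₂ A B ≫ k := by
  have e := congrArg (· ≫ k) (assocHom_p₂_p₁ A B C)
  simpa only [Category.assoc] using e

@[simp]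
theorem assocHom_p₂_p₂_assoc (k : C.apex ⟶ X) :
    (assocHom A B C).hom ≫ p₂ A (B.comp C) ≫ p₂ B C ≫ k = p₂ (A.comp B) C ≫ k := by
  have e := congrArg (· ≫ k) (assocHom_p₂_p₂ A B C)
  simpa only [Category.assoc] using e

@[simp]
theorem assocInv_p₁_p₁ :
    (assocInv A B C).hom ≫ p₁ (A.comp B) C ≫ p₁ A B = p₁ A (B.comp C) :=
  (lift_p₁_assoc _ _ _ _).trans (lift_p₁ _ _ _)

@[simp]
theorem assocInv_p₁_p₂ : (assocInv A B C).hom ≫ p₁ (A.comp B) C ≫ p₂ A B =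
    p₂ A (B.comp C) ≫ p₁ B C :=
  (lift_p₁_assoc _ _ _ _).trans (lift_p₂ _ _ _)

@[simp]
theorem assocInv_p₂ : (assocInv A B C).hom ≫ p₂ (A.comp B) C = p₂ A (B.comp C) ≫ p₂ B C :=
  lift_p₂ _ _ _

@[simp]
theorem lunitHom_hom : (lunitHom A).hom = p₂ (one I) A := rfl

@[simp]
theorem runitHom_hom : (runitHom A).hom = p₁ A (one J) := rfl

@[simp]
theorem lunitInv_p₁ : (lunitInv A).hom ≫ p₁ (one I) A = A.l := lift_p₁ _ _ _

@[simp]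
theorem lunitInv_p₂ : (lunitInv A).hom ≫ p₂ (one I) A = 𝟙 _ := lift_p₂ _ _ _

@[simp]
theorem runitInv_p₁ : (runitInv A).hom ≫ p₁ A (one J) = 𝟙 _ := lift_p₁ _ _ _

@[simp]
theorem runitInv_p₂ : (runitInv A).hom ≫ p₂ A (one J) = A.r := lift_p₂ _ _ _

theorem one_condition : p₂ (one I) A ≫ A.l = p₁ (one I) A :=
  (condition (one I) A).symm.trans (Category.comp_id _)

theorem condition_one : p₁ A (one J) ≫ A.r = p₂ A (one J) :=
  (condition A (one J)).trans (Category.comp_id _)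

theorem lunit_lunitInv : (lunitHom A).hom ≫ (lunitInv A).hom = 𝟙 _ := by
  apply hom_ext
  · rw [Category.assoc, lunitInv_p₁, lunitHom_hom, one_condition, Category.id_comp]
  · rw [Category.assoc, lunitInv_p₂, lunitHom_hom, Category.comp_id, Category.id_comp]

theorem runit_runitInv : (runitHom A).hom ≫ (runitInv A).hom = 𝟙 _ := by
  apply hom_ext
  · rw [Category.assoc, runitInv_p₁, runitHom_hom, Category.comp_id, Category.id_comp]
  · rw [Category.assoc, runitInv_p₂, runitHom_hom, condition_one, Category.id_comp]

end Projections

end DSpan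

variable (V) in
/-- The pseudo-double category `Span_d(V)`: 0-cells are small sets, vertical 1-cells are maps of
sets, horizontal 1-cells are discrete spans. -/
noncomputable def SpanD [HasFiniteLimits V] : PseudoDoubleCategory where
  Obj := Type w
  Hor I J := DSpan V I J
  Sq a b A B := DSpanHom a b A B
  vid A := .glob (𝟙 A.apex) (Category.id_comp _) (Category.id_comp _)
  vcomp f g := f.vcomp g
  vid_vcomp _ := DSpanHom.heq rfl rfl (Category.id_comp _)
  vcomp_vid _ := DSpanHom.heq rfl rfl (Category.comp_id _)
  vcomp_assoc _ _ _ := DSpanHom.heq rfl rfl (Category.assoc _ _ _)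
  hid I := .one I
  hidSq a := .hid a
  hidSq_id I := DSpanHom.ext (copowMap_id I)
  hidSq_comp a b := DSpanHom.ext (copowMap_comp a b)
  hcomp A B := A.comp B
  hcompSq f g := f.hcomp g
  hcompSq_vid A B := DSpanHom.ext (DSpan.hom_ext (by simp) (by simp))
  interchange f f' g g' := DSpanHom.ext (DSpan.hom_ext (by simp) (by simp))
  assoc A B C := DSpan.assocHom A B C
  assocInv A B C := DSpan.assocInv A B C
  assoc_assocInv A B C := DSpanHom.heq rfl rfl (DSpan.hom_ext
    (DSpan.hom_ext (by simp)
      (by simp))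
    (by simp))
  assocInv_assoc A B C := DSpanHom.heq rfl rfl (DSpan.hom_ext
    (by simp)
    (DSpan.hom_ext (by simp)
      (by simp)))
  assoc_naturality f g h := DSpanHom.heq rfl rfl (DSpan.hom_ext
    (by simp)
    (DSpan.hom_ext (by simp) (by simp)))
  lunit A := DSpan.lunitHom A
  lunitInv A := DSpan.lunitInv A
  lunit_lunitInv A := DSpanHom.heq rfl rfl (DSpan.lunit_lunitInv A)
  lunitInv_lunit A := DSpanHom.heq rfl rfl (DSpan.lift_p₂ _ _ _)
  lunit_naturality f := DSpanHom.heq rfl rfl (DSpanHom.hcomp_p₂ _ _)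
  runit A := DSpan.runitHom A
  runitInv A := DSpan.runitInv A
  runit_runitInv A := DSpanHom.heq rfl rfl (DSpan.runit_runitInv A)
  runitInv_runit A := DSpanHom.heq rfl rfl (DSpan.lift_p₁ _ _ _)
  runit_naturality f := DSpanHom.heq rfl rfl (DSpanHom.hcomp_p₁ _ _)
  pentagon A B C E := DSpanHom.heq rfl rfl (DSpan.hom_ext
    (by simp)
    (DSpan.hom_ext (by simp)
      (DSpan.hom_ext (by simp) (by simp))))
  triangle A B := DSpanHom.heq rfl rfl (DSpan.hom_ext
    (by simp)
    (by simp))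

end Spans

/-! ### The pseudo-double category of matrices -/

section Closed

variable {V : Type u} [Category.{v} V]

/-- A family of morphisms with common codomain is jointly epimorphic. -/
def JointlyEpi {ι : Sort*} {A : ι → V} {B : V} (φ : ∀ j, A j ⟶ B) : Prop :=
  ∀ ⦃Y : V⦄ (f g : B ⟶ Y), (∀ j, φ j ≫ f = φ j ≫ g) → f = g

variable [CartesianMonoidalCategory V]

/-- The symmetry of the cartesian product. -/
def swap (A B : V) : A ⊗ B ⟶ B ⊗ A :=
  CartesianMonoidalCategory.lift (snd A B) (fst A B)

@[simp]
theorem swap_swap (A B : V) : swap A B ≫ swap B A = 𝟙 _ := by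
  ext <;> simp [swap]

theorem whiskerRight_swap {A B : V} (f : A ⟶ B) (X : V) :
    f ▷ X ≫ swap B X = swap A X ≫ X ◁ f := by
  ext <;> simp [swap]

theorem swap_cancel {A B Y : V} {f g : A ⊗ B ⟶ Y} (e : swap B A ≫ f = swap B A ≫ g) : f = g := by
  have := congrArg (swap A B ≫ ·) e
  simpa only [← Category.assoc, swap_swap, Category.id_comp] using this

theorem swap_whiskerRight {A B : V} (f : A ⟶ B) (X : V) :
    swap X A ≫ f ▷ X = X ◁ f ≫ swap X B := by
  ext <;> simp [swap]

variable [MonoidalClosed V]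

theorem JointlyEpi.whiskerLeft {ι : Sort*} {A : ι → V} {B : V} {φ : ∀ j, A j ⟶ B}
    (H : JointlyEpi φ) (X : V) : JointlyEpi fun j => X ◁ φ j := by
  intro Y f g e
  apply MonoidalClosed.curry_injective
  apply H
  intro j
  rw [← MonoidalClosed.curry_natural_left, ← MonoidalClosed.curry_natural_left]
  exact congrArg _ (e j)

theorem JointlyEpi.whiskerRight {ι : Sort*} {A : ι → V} {B : V} {φ : ∀ j, A j ⟶ B}
    (H : JointlyEpi φ) (X : V) : JointlyEpi fun j => φ j ▷ X := by
  intro Y f g e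
  apply swap_cancel
  apply H.whiskerLeft X
  intro j
  have := congrArg (swap X (A j) ≫ ·) (e j)
  simpa only [← Category.assoc, swap_whiskerRight] using this

end Closed

/-- Matrices with entries in `V`. -/
abbrev VMat (V : Type u) (I J : Type w) : Type max w u := I → J → V

/-- A category with small coproducts has an initial object. -/
theorem hasInitial_of_coproducts (V : Type u) [Category.{v} V] [HasCoproducts.{w} V] :
    HasInitial V :=
  haveI := has_smallest_coproducts_of_hasCoproducts.{w} (C := V)
  (inferInstance : HasCoproductsOfShape PEmpty.{1} V)

namespace VMat

variable {V : Type u} [Category.{v} V] [CartesianMonoidalCategory V] [HasCoproducts.{w} V]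

section One

open Classical in
/-- The unit matrix, with terminal entries on the diagonal and initial entries elsewhere. -/
noncomputable def one (I : Type w) : VMat V I I := fun i j =>
  haveI := hasInitial_of_coproducts.{w} V
  if i = j then 𝟙_ V else ⊥_ V

variable {I : Type w} {i j : I}

theorem one_of_eq (h : i = j) : one (V := V) I i j = 𝟙_ V := if_pos h

/-- An entry of the unit matrix off the diagonal is initial. -/
noncomputable def isInitialOne (h : i ≠ j) : IsInitial (one (V := V) I i j) :=
  haveI := hasInitial_of_coproducts.{w} V
  initialIsInitial.ofIso (eqToIso (if_neg h).symm)

/-- A diagonal entry of the unit matrix is the terminal object. -/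
noncomputable def oneι (h : i = j) : 𝟙_ V ⟶ one I i j :=
  eqToHom (one_of_eq h).symm

open Classical in
/-- Morphisms out of an entry of the unit matrix. -/
noncomputable def oneDesc {X : V} (f : i = j → (𝟙_ V ⟶ X)) : one I i j ⟶ X :=
  if h : i = j then eqToHom (one_of_eq h) ≫ f h else (isInitialOne h).to X

@[simp]
theorem oneι_desc {X : V} (f : i = j → (𝟙_ V ⟶ X)) (h : i = j) : oneι h ≫ oneDesc f = f h := by
  unfold oneDesc oneι
  rw [dif_pos h, eqToHom_trans_assoc, eqToHom_refl, Category.id_comp]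

theorem oneι_jointlyEpi : JointlyEpi fun h : i = j => oneι (V := V) h := by
  intro Y f g e
  by_cases h : i = j
  · have e' : eqToHom (one_of_eq h).symm ≫ f = eqToHom (one_of_eq h).symm ≫ g := e h
    exact (cancel_epi _).mp e'
  · exact (isInitialOne h).hom_ext _ _

end One

variable {I J K L : Type w}

/-- The composite of two matrices. -/
noncomputable def comp (M : VMat V I J) (N : VMat V J K) : VMat V I K := fun i k =>
  ∐ fun j => N j k ⊗ M i j

section
variable {M : VMat V I J} {N : VMat V J K} {i : I} {k : K}

/-- The coprojections of an entry of a composite matrix. -/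
noncomputable def compι (M : VMat V I J) (N : VMat V J K) (i : I) (k : K) (j : J) :
    N j k ⊗ M i j ⟶ comp M N i k :=
  Limits.Sigma.ι (fun j => N j k ⊗ M i j) j

/-- Morphisms out of an entry of a composite matrix. -/
noncomputable def compDesc {X : V} (f : ∀ j, N j k ⊗ M i j ⟶ X) : comp M N i k ⟶ X :=
  Limits.Sigma.desc f

@[simp]
theorem compι_desc {X : V} (f : ∀ j, N j k ⊗ M i j ⟶ X) (j : J) :
    compι M N i k j ≫ compDesc f = f j :=
  Limits.Sigma.ι_desc _ _

@[simp]
theorem compι_desc_assoc {X Y : V} (f : ∀ j, N j k ⊗ M i j ⟶ X) (j : J) (g : X ⟶ Y) :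
    compι M N i k j ≫ compDesc f ≫ g = f j ≫ g := by
  rw [← Category.assoc, compι_desc]

theorem compι_jointlyEpi (M : VMat V I J) (N : VMat V J K) (i : I) (k : K) :
    JointlyEpi (compι M N i k) := by
  intro Y f g e
  exact Limits.Sigma.hom_ext _ _ e

variable [MonoidalClosed V]

/-- Morphisms out of a product with an entry of a composite matrix. -/
noncomputable def lDesc {X Y : V} (f : ∀ j, X ⊗ (N j k ⊗ M i j) ⟶ Y) : X ⊗ comp M N i k ⟶ Y :=
  MonoidalClosed.uncurry (compDesc fun j => MonoidalClosed.curry (f j))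

@[simp]
theorem compι_lDesc {X Y : V} (f : ∀ j, X ⊗ (N j k ⊗ M i j) ⟶ Y) (j : J) :
    X ◁ compι M N i k j ≫ lDesc f = f j := by
  rw [lDesc, ← MonoidalClosed.uncurry_natural_left, compι_desc, MonoidalClosed.uncurry_curry]

/-- Morphisms out of a product with an entry of a composite matrix. -/
noncomputable def rDesc {X Y : V} (f : ∀ j, (N j k ⊗ M i j) ⊗ X ⟶ Y) : comp M N i k ⊗ X ⟶ Y :=
  swap _ _ ≫ lDesc fun j => swap _ _ ≫ f j

@[simp]
theorem compι_rDesc {X Y : V} (f : ∀ j, (N j k ⊗ M i j) ⊗ X ⟶ Y) (j : J) :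
    compι M N i k j ▷ X ≫ rDesc f = f j := by
  rw [rDesc, ← Category.assoc, whiskerRight_swap, Category.assoc, compι_lDesc, ← Category.assoc,
    swap_swap, Category.id_comp]

end

section Structure

variable [MonoidalClosed V]

/-- Morphisms out of a product with an entry of the unit matrix. -/
noncomputable def lOneDesc {i j : I} {X Y : V} (f : i = j → (X ⟶ Y)) : X ⊗ one I i j ⟶ Y :=
  MonoidalClosed.uncurry (oneDesc fun h => MonoidalClosed.curry ((ρ_ X).hom ≫ f h))

@[simp]
theorem oneι_lOneDesc {i j : I} {X Y : V} (f : i = j → (X ⟶ Y)) (h : i = j) :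
    X ◁ oneι h ≫ lOneDesc f = (ρ_ X).hom ≫ f h := by
  rw [lOneDesc, ← MonoidalClosed.uncurry_natural_left, oneι_desc, MonoidalClosed.uncurry_curry]

/-- Morphisms out of a product with an entry of the unit matrix. -/
noncomputable def rOneDesc {i j : I} {X Y : V} (f : i = j → (X ⟶ Y)) : one I i j ⊗ X ⟶ Y :=
  swap _ _ ≫ lOneDesc f

@[simp]
theorem oneι_rOneDesc {i j : I} {X Y : V} (f : i = j → (X ⟶ Y)) (h : i = j) :
    oneι h ▷ X ≫ rOneDesc f = (λ_ X).hom ≫ f h := by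
  rw [rOneDesc, ← Category.assoc, whiskerRight_swap, Category.assoc, oneι_lOneDesc,
    ← Category.assoc]
  congr 1
  rw [rightUnitor_hom, leftUnitor_hom, swap, CartesianMonoidalCategory.lift_fst]

/-- The associator. -/
noncomputable def assocHom (M : VMat V I J) (N : VMat V J K) (P : VMat V K L) (i : I) (l : L) :
    comp (comp M N) P i l ⟶ comp M (comp N P) i l :=
  compDesc fun k => lDesc fun j =>
    (α_ (P k l) (N j k) (M i j)).inv ≫ compι N P j l k ▷ M i j ≫ compι M (comp N P) i l j

/-- The inverse of the associator. -/
noncomputable def assocInv (M : VMat V I J) (N : VMat V J K) (P : VMat V K L) (i : I) (l : L) :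
    comp M (comp N P) i l ⟶ comp (comp M N) P i l :=
  compDesc fun j => rDesc fun k =>
    (α_ (P k l) (N j k) (M i j)).hom ≫ P k l ◁ compι M N i k j ≫ compι (comp M N) P i l k

section
variable (M : VMat V I J) (N : VMat V J K) (P : VMat V K L) (i : I) (l : L) {X : V}

@[simp]
theorem ι_assocHom (j : J) (k : K) :
    P k l ◁ compι M N i k j ≫ compι (comp M N) P i l k ≫ assocHom M N P i l =
    (α_ (P k l) (N j k) (M i j)).inv ≫ compι N P j l k ▷ M i j ≫ compι M (comp N P) i l j := by
  rw [assocHom, compι_desc, compι_lDesc]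

@[simp]
theorem ι_assocHom_assoc (j : J) (k : K) (f : comp M (comp N P) i l ⟶ X) :
    P k l ◁ compι M N i k j ≫ compι (comp M N) P i l k ≫ assocHom M N P i l ≫ f =
    (α_ (P k l) (N j k) (M i j)).inv ≫ compι N P j l k ▷ M i j ≫
      compι M (comp N P) i l j ≫ f := by
  have e := congrArg (· ≫ f) (ι_assocHom M N P i l j k)
  simpa only [Category.assoc] using e

@[simp]
theorem ι_assocInv (j : J) (k : K) :
    compι N P j l k ▷ M i j ≫ compι M (comp N P) i l j ≫ assocInv M N P i l =
    (α_ (P k l) (N j k) (M i j)).hom ≫ P k l ◁ compι M N i k j ≫ compι (comp M N) P i l k := by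
  rw [assocInv, compι_desc, compι_rDesc]

theorem assocHom_assocInv : assocHom M N P i l ≫ assocInv M N P i l = 𝟙 _ := by
  apply compι_jointlyEpi
  intro k
  apply (compι_jointlyEpi M N i k).whiskerLeft
  intro j
  simp

theorem assocInv_assocHom : assocInv M N P i l ≫ assocHom M N P i l = 𝟙 _ := by
  apply compι_jointlyEpi
  intro j
  apply (compι_jointlyEpi N P j l).whiskerRight
  intro k
  rw [← Category.assoc (compι M _ i l j), ← Category.assoc, ι_assocInv]
  simp

end

/-- The left unitor. -/
noncomputable def lunitHom (M : VMat V I J) (i : I) (j : J) : comp (one I) M i j ⟶ M i j :=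
  compDesc fun _ => lOneDesc fun h => eqToHom (by rw [h])

/-- The inverse of the left unitor. -/
noncomputable def lunitInv (M : VMat V I J) (i : I) (j : J) : M i j ⟶ comp (one I) M i j :=
  (ρ_ (M i j)).inv ≫ M i j ◁ oneι rfl ≫ compι (one I) M i j i

/-- The right unitor. -/
noncomputable def runitHom (M : VMat V I J) (i : I) (j : J) : comp M (one J) i j ⟶ M i j :=
  compDesc fun _ => rOneDesc fun h => eqToHom (by rw [h])

/-- The inverse of the right unitor. -/
noncomputable def runitInv (M : VMat V I J) (i : I) (j : J) : M i j ⟶ comp M (one J) i j :=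
  (λ_ (M i j)).inv ≫ oneι rfl ▷ M i j ≫ compι M (one J) i j j

section
variable (M : VMat V I J) (i : I) (j : J) {X : V}

@[simp]
theorem ι_lunitHom : M i j ◁ oneι rfl ≫ compι (one I) M i j i ≫ lunitHom M i j =
    (ρ_ (M i j)).hom := by
  rw [lunitHom, compι_desc, oneι_lOneDesc, eqToHom_refl, Category.comp_id]

@[simp]
theorem ι_lunitHom_assoc (f : M i j ⟶ X) :
    M i j ◁ oneι rfl ≫ compι (one I) M i j i ≫ lunitHom M i j ≫ f = (ρ_ (M i j)).hom ≫ f := by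
  rw [← ι_lunitHom]
  simp only [Category.assoc]

@[simp]
theorem ι_runitHom : oneι rfl ▷ M i j ≫ compι M (one J) i j j ≫ runitHom M i j =
    (λ_ (M i j)).hom := by
  rw [runitHom, compι_desc, oneι_rOneDesc, eqToHom_refl, Category.comp_id]

@[simp]
theorem ι_runitHom_assoc (f : M i j ⟶ X) :
    oneι rfl ▷ M i j ≫ compι M (one J) i j j ≫ runitHom M i j ≫ f = (λ_ (M i j)).hom ≫ f := by
  rw [← ι_runitHom]
  simp only [Category.assoc]

theorem lunit_ext {f g : comp (one I) M i j ⟶ X}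
    (e : M i j ◁ oneι rfl ≫ compι (one I) M i j i ≫ f =
      M i j ◁ oneι rfl ≫ compι (one I) M i j i ≫ g) : f = g := by
  apply compι_jointlyEpi
  intro i'
  refine (oneι_jointlyEpi.whiskerLeft _) _ _ fun h => ?_
  subst h
  exact e

theorem runit_ext {f g : comp M (one J) i j ⟶ X}
    (e : oneι rfl ▷ M i j ≫ compι M (one J) i j j ≫ f =
      oneι rfl ▷ M i j ≫ compι M (one J) i j j ≫ g) : f = g := by
  apply compι_jointlyEpi
  intro j'
  refine (oneι_jointlyEpi.whiskerRight _) _ _ fun h => ?_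
  subst h
  exact e

theorem lunitHom_lunitInv : lunitHom M i j ≫ lunitInv M i j = 𝟙 _ := by
  apply lunit_ext
  simp [lunitInv]

theorem lunitInv_lunitHom : lunitInv M i j ≫ lunitHom M i j = 𝟙 _ := by
  simp [lunitInv]

theorem runitHom_runitInv : runitHom M i j ≫ runitInv M i j = 𝟙 _ := by
  apply runit_ext
  simp [runitInv]

theorem runitInv_runitHom : runitInv M i j ≫ runitHom M i j = 𝟙 _ := by
  simp [runitInv]

end

end Structure

section Maps

variable {I J K L I' J' K' L' I'' J'' K'' : Type w}

/-- The action of a map of sets on entries of unit matrices. -/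
noncomputable def oneMap (a : I → K) (i j : I) : one (V := V) I i j ⟶ one K (a i) (a j) :=
  oneDesc fun h => oneι (by rw [h])

/-- The action of families of morphisms on entries of composite matrices. -/
noncomputable def compMap (a : I → I') (b : J → J') (c : K → K')
    {M : VMat V I J} {M' : VMat V I' J'} {N : VMat V J K} {N' : VMat V J' K'}
    (f : ∀ i j, M i j ⟶ M' (a i) (b j)) (g : ∀ j k, N j k ⟶ N' (b j) (c k)) (i : I) (k : K) :
    comp M N i k ⟶ comp M' N' (a i) (c k) :=
  compDesc fun j => (g j k ⊗ₘ f i j) ≫ compι M' N' (a i) (c k) (b j)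

@[simp]
theorem ι_oneMap (a : I → K) {i j : I} (h : i = j) :
    oneι h ≫ oneMap (V := V) a i j = oneι (by rw [h]) :=
  oneι_desc _ _

theorem ι_oneMap_assoc (a : I → K) {i j : I} (h : i = j) {X : V}
    (x : one K (a i) (a j) ⟶ X) :
    oneι h ≫ oneMap (V := V) a i j ≫ x = oneι (by rw [h]) ≫ x := by
  rw [← Category.assoc, ι_oneMap]

theorem oneMap_id (i j : I) : oneMap (V := V) (fun i : I => i) i j = 𝟙 (one I i j) := by
  apply oneι_jointlyEpi
  intro h
  rw [ι_oneMap, Category.comp_id]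

theorem oneMap_comp (a : I → J) (b : J → K) (i j : I) :
    oneMap (V := V) (fun i => b (a i)) i j = oneMap a i j ≫ oneMap b (a i) (a j) := by
  apply oneι_jointlyEpi
  intro h
  rw [ι_oneMap, ι_oneMap_assoc, ι_oneMap]

section
variable (a : I → I') (b : J → J') (c : K → K')
    {M : VMat V I J} {M' : VMat V I' J'} {N : VMat V J K} {N' : VMat V J' K'}
    (f : ∀ i j, M i j ⟶ M' (a i) (b j)) (g : ∀ j k, N j k ⟶ N' (b j) (c k))

@[simp]
theorem ι_compMap (i : I) (k : K) (j : J) :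
    compι M N i k j ≫ compMap a b c f g i k =
      (g j k ⊗ₘ f i j) ≫ compι M' N' (a i) (c k) (b j) :=
  compι_desc _ _

@[simp]
theorem ι_compMap_assoc (i : I) (k : K) (j : J) {X : V} (x : comp M' N' (a i) (c k) ⟶ X) :
    compι M N i k j ≫ compMap a b c f g i k ≫ x =
      (g j k ⊗ₘ f i j) ≫ compι M' N' (a i) (c k) (b j) ≫ x := by
  rw [← Category.assoc, ι_compMap, Category.assoc]

theorem compMap_comp (a' : I' → I'') (b' : J' → J'') (c' : K' → K'')
    {M'' : VMat V I'' J''} {N'' : VMat V J'' K''}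
    (f' : ∀ i j, M' i j ⟶ M'' (a' i) (b' j)) (g' : ∀ j k, N' j k ⟶ N'' (b' j) (c' k))
    (i : I) (k : K) :
    compMap (fun i => a' (a i)) (fun j => b' (b j)) (fun k => c' (c k)) (M' := M'') (N' := N'')
      (fun i j => f i j ≫ f' (a i) (b j)) (fun j k => g j k ≫ g' (b j) (c k)) i k =
    compMap a b c f g i k ≫ compMap a' b' c' f' g' (a i) (c k) := by
  apply compι_jointlyEpi
  intro j
  rw [ι_compMap, ι_compMap_assoc, ι_compMap, ← Category.assoc, tensorHom_comp_tensorHom]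

end

theorem compMap_id (M : VMat V I J) (N : VMat V J K) (i : I) (k : K) :
    compMap (fun i => i) (fun j => j) (fun k => k) (M' := M) (N' := N)
      (fun i j => 𝟙 (M i j)) (fun j k => 𝟙 (N j k)) i k = 𝟙 (comp M N i k) := by
  apply compι_jointlyEpi
  intro j
  rw [ι_compMap, Category.comp_id, id_tensorHom_id, Category.id_comp]

variable [MonoidalClosed V]

theorem assoc_naturality (a : I → I') (b : J → J') (c : K → K') (d : L → L')
    {M : VMat V I J} {M' : VMat V I' J'} {N : VMat V J K} {N' : VMat V J' K'}
    {P : VMat V K L} {P' : VMat V K' L'} (f : ∀ i j, M i j ⟶ M' (a i) (b j))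
    (g : ∀ j k, N j k ⟶ N' (b j) (c k)) (h : ∀ k l, P k l ⟶ P' (c k) (d l)) (i : I) (l : L) :
    compMap a c d (compMap a b c f g) h i l ≫ assocHom M' N' P' (a i) (d l) =
      assocHom M N P i l ≫ compMap a b d f (compMap b c d g h) i l := by
  apply compι_jointlyEpi
  intro k
  apply (compι_jointlyEpi M N i k).whiskerLeft
  intro j
  beta_reduce
  rw [ι_assocHom_assoc, ι_compMap, ι_compMap_assoc, ← id_tensorHom, tensorHom_comp_tensorHom_assoc,
    ι_compMap, Category.id_comp, ← tensorHom_id, tensorHom_comp_tensorHom_assoc, ι_compMap,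
    Category.id_comp]
  have e₁ : h k l ⊗ₘ ((g j k ⊗ₘ f i j) ≫ compι M' N' (a i) (c k) (b j)) =
      (h k l ⊗ₘ (g j k ⊗ₘ f i j)) ≫ P' (c k) (d l) ◁ compι M' N' (a i) (c k) (b j) := by
    rw [← id_tensorHom, tensorHom_comp_tensorHom, Category.comp_id]
  have e₂ : ((h k l ⊗ₘ g j k) ≫ compι N' P' (b j) (d l) (c k)) ⊗ₘ f i j =
      ((h k l ⊗ₘ g j k) ⊗ₘ f i j) ≫ compι N' P' (b j) (d l) (c k) ▷ M' (a i) (b j) := by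
    rw [← tensorHom_id, tensorHom_comp_tensorHom, Category.comp_id]
  rw [e₁, e₂, Category.assoc, Category.assoc, ι_assocHom, ← associator_inv_naturality_assoc]

theorem lunit_naturality (a : I → I') (b : J → J') {M : VMat V I J} {M' : VMat V I' J'}
    (f : ∀ i j, M i j ⟶ M' (a i) (b j)) (i : I) (j : J) :
    compMap a a b (oneMap a) f i j ≫ lunitHom M' (a i) (b j) = lunitHom M i j ≫ f i j := by
  apply lunit_ext
  rw [ι_lunitHom_assoc, ι_compMap_assoc, ← id_tensorHom, tensorHom_comp_tensorHom_assoc, ι_oneMap,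
    Category.id_comp]
  have e : f i j ⊗ₘ oneι (V := V) (rfl : a i = a i) =
      (f i j ▷ 𝟙_ V) ≫ M' (a i) (b j) ◁ oneι rfl := by
    rw [← id_tensorHom, ← tensorHom_id, tensorHom_comp_tensorHom, Category.comp_id,
      Category.id_comp]
  rw [e, Category.assoc, ι_lunitHom, rightUnitor_naturality]

theorem runit_naturality (a : I → I') (b : J → J') {M : VMat V I J} {M' : VMat V I' J'}
    (f : ∀ i j, M i j ⟶ M' (a i) (b j)) (i : I) (j : J) :
    compMap a b b f (oneMap b) i j ≫ runitHom M' (a i) (b j) = runitHom M i j ≫ f i j := by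
  apply runit_ext
  rw [ι_runitHom_assoc, ι_compMap_assoc, ← tensorHom_id, tensorHom_comp_tensorHom_assoc, ι_oneMap,
    Category.id_comp]
  have e : oneι (V := V) (rfl : b j = b j) ⊗ₘ f i j =
      (𝟙_ V ◁ f i j) ≫ oneι rfl ▷ M' (a i) (b j) := by
    rw [← id_tensorHom, ← tensorHom_id, tensorHom_comp_tensorHom, Category.comp_id,
      Category.id_comp]
  rw [e, Category.assoc, ι_runitHom, leftUnitor_naturality]

theorem pentagon {H : Type w} (M : VMat V I J) (N : VMat V J K) (P : VMat V K L) (Q : VMat V L H)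
    (i : I) (h : H) :
    compMap (fun i => i) (fun j => j) (fun k => k) (N' := Q) (assocHom M N P)
        (fun l h => 𝟙 (Q l h)) i h ≫
      assocHom M (comp N P) Q i h ≫
      compMap (fun i => i) (fun j => j) (fun k => k) (M' := M) (fun i j => 𝟙 (M i j))
        (assocHom N P Q) i h =
    assocHom (comp M N) P Q i h ≫ assocHom M N (comp P Q) i h := by
  apply compι_jointlyEpi
  intro l
  apply (compι_jointlyEpi (comp M N) P i l).whiskerLeft
  intro k
  apply ((compι_jointlyEpi M N i k).whiskerLeft (P k l)).whiskerLeft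
  intro j
  beta_reduce
  have lhs₁ : Q l h ◁ P k l ◁ compι M N i k j ≫ Q l h ◁ compι (comp M N) P i l k ≫
      Q l h ◁ assocHom M N P i l = Q l h ◁ ((α_ (P k l) (N j k) (M i j)).inv ≫
        compι N P j l k ▷ M i j ≫ compι M (comp N P) i l j) := by
    rw [← ι_assocHom]; simp only [whiskerLeft_comp]
  have lhs₂ : (Q l h ◁ compι N P j l k) ▷ M i j ≫ compι (comp N P) Q j h l ▷ M i j ≫
      assocHom N P Q j h ▷ M i j = ((α_ (Q l h) (P k l) (N j k)).inv ≫
        compι P Q k h l ▷ N j k ≫ compι N (comp P Q) j h k) ▷ M i j := by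
    rw [← ι_assocHom]; simp only [comp_whiskerRight]
  rw [ι_compMap_assoc, id_tensorHom, reassoc_of% lhs₁]
  simp only [whiskerLeft_comp, Category.assoc, ι_assocHom_assoc, ι_compMap, tensorHom_id]
  rw [associator_inv_naturality_middle_assoc, reassoc_of% lhs₂,
    associator_inv_naturality_right_assoc, whisker_exchange_assoc, ι_assocHom,
    associator_inv_naturality_left_assoc]
  simp only [comp_whiskerRight, Category.assoc]
  rw [pentagon_inv_assoc]

theorem triangle (M : VMat V I J) (N : VMat V J K) (i : I) (k : K) :
    assocHom M (one J) N i k ≫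
      compMap (fun i => i) (fun j => j) (fun k => k) (M' := M) (fun i j => 𝟙 (M i j))
        (lunitHom N) i k =
    compMap (fun i => i) (fun j => j) (fun k => k) (N' := N) (runitHom M)
      (fun j k => 𝟙 (N j k)) i k := by
  apply compι_jointlyEpi
  intro j
  apply (compι_jointlyEpi M (one J) i j).whiskerLeft
  intro j'
  refine ((oneι_jointlyEpi.whiskerRight _).whiskerLeft _) _ _ fun h => ?_
  subst h
  beta_reduce
  have e₁ : N j' k ◁ oneι rfl ▷ M i j' ≫ N j' k ◁ compι M (one J) i j' j' ≫
      N j' k ◁ runitHom M i j' = N j' k ◁ (λ_ (M i j')).hom := by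
    rw [← ι_runitHom]; simp only [whiskerLeft_comp]
  have e₂ : (N j' k ◁ oneι rfl) ▷ M i j' ≫ compι (one J) N j' k j' ▷ M i j' ≫
      lunitHom N j' k ▷ M i j' = (ρ_ (N j' k)).hom ▷ M i j' := by
    rw [← ι_lunitHom]; simp only [comp_whiskerRight]
  rw [ι_assocHom_assoc, ι_compMap, ι_compMap, id_tensorHom, tensorHom_id, reassoc_of% e₁,
    associator_inv_naturality_middle_assoc, reassoc_of% e₂, triangle_assoc_comp_right_assoc]

end Maps

end VMat

/-- A 2-cell of matrices over a pair of maps of sets: a family of morphisms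
`M i j ⟶ N (a i) (b j)`. -/
abbrev MatHom {V : Type u} [Category.{v} V] {I J K L : Type w} (a : I ⟶ K) (b : J ⟶ L)
    (M : VMat V I J) (N : VMat V K L) : Type max w v :=
  ∀ i j, M i j ⟶ N (a i) (b j)

/-- The pseudo-double category `V-Mat`: 0-cells are small sets, vertical 1-cells are maps of sets,
horizontal 1-cells are matrices with entries in `V`. -/
noncomputable def MatD (V : Type u) [Category.{v} V] [CartesianMonoidalCategory V]
    [HasCoproducts.{w} V] [MonoidalClosed V] : PseudoDoubleCategory where
  Obj := Type w
  Hor I J := VMat V I J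
  Sq a b M N := MatHom a b M N
  vid M := fun i j => 𝟙 (M i j)
  vcomp {_ _ _ _ _ _ a b _ _ _ _ _} f g := fun i j => f i j ≫ g (a i) (b j)
  vid_vcomp _ := heq_of_eq (funext fun _ => funext fun _ => Category.id_comp _)
  vcomp_vid _ := heq_of_eq (funext fun _ => funext fun _ => Category.comp_id _)
  vcomp_assoc _ _ _ := heq_of_eq (funext fun _ => funext fun _ => Category.assoc _ _ _)
  hid I := .one I
  hidSq a := VMat.oneMap a
  hidSq_id I := funext fun i => funext fun j => VMat.oneMap_id i j
  hidSq_comp a b := funext fun i => funext fun j => VMat.oneMap_comp a b i j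
  hcomp M N := M.comp N
  hcompSq {_ _ _ _ _ _ a b c _ _ _ _} f g := VMat.compMap a b c f g
  hcompSq_vid M N := funext fun i => funext fun j => VMat.compMap_id M N i j
  interchange {_ _ _ _ _ _ _ _ _ a b c a' b' c' _ _ _ _ _ _} f f' g g' :=
    funext fun i => funext fun j => VMat.compMap_comp a b c f g a' b' c' f' g' i j
  assoc M N P := VMat.assocHom M N P
  assocInv M N P := VMat.assocInv M N P
  assoc_assocInv M N P :=
    heq_of_eq (funext fun i => funext fun j => VMat.assocHom_assocInv M N P i j)
  assocInv_assoc M N P :=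
    heq_of_eq (funext fun i => funext fun j => VMat.assocInv_assocHom M N P i j)
  assoc_naturality {_ _ _ _ _ _ _ _ a b c d _ _ _ _ _ _} f g h :=
    heq_of_eq (funext fun i => funext fun j => VMat.assoc_naturality a b c d f g h i j)
  lunit M := VMat.lunitHom M
  lunitInv M := VMat.lunitInv M
  lunit_lunitInv M := heq_of_eq (funext fun i => funext fun j => VMat.lunitHom_lunitInv M i j)
  lunitInv_lunit M := heq_of_eq (funext fun i => funext fun j => VMat.lunitInv_lunitHom M i j)
  lunit_naturality {_ _ _ _ a b _ _} f :=
    heq_of_eq (funext fun i => funext fun j => VMat.lunit_naturality a b f i j)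
  runit M := VMat.runitHom M
  runitInv M := VMat.runitInv M
  runit_runitInv M := heq_of_eq (funext fun i => funext fun j => VMat.runitHom_runitInv M i j)
  runitInv_runit M := heq_of_eq (funext fun i => funext fun j => VMat.runitInv_runitHom M i j)
  runit_naturality {_ _ _ _ a b _ _} f :=
    heq_of_eq (funext fun i => funext fun j => VMat.runit_naturality a b f i j)
  pentagon M N P Q := heq_of_eq (funext fun i => funext fun j => VMat.pentagon M N P Q i j)
  triangle M N := heq_of_eq (funext fun i => funext fun j => VMat.triangle M N i j)

/-! ### The oplax double functor `Int` -/

section IntD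

variable {V : Type u} [Category.{v} V] [CartesianMonoidalCategory V] [HasCoproducts.{w} V]
  {I J K L I' J' K' I'' J'' : Type w}

/-- The span `I • 1 ⟵ ∐ M i j ⟶ J • 1` of a matrix `M`. -/
noncomputable def intObj (M : VMat V I J) : DSpan V I J where
  apex := ∐ fun p : I × J => M p.1 p.2
  l := Limits.Sigma.desc fun p => const _ p.1
  r := Limits.Sigma.desc fun p => const _ p.2

/-- The coprojections of the apex of `intObj M`. -/
noncomputable def intι (M : VMat V I J) (i : I) (j : J) : M i j ⟶ (intObj M).apex :=
  Limits.Sigma.ι (fun p : I × J => M p.1 p.2) (i, j)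

/-- Morphisms out of the apex of `intObj M`. -/
noncomputable def intDesc {M : VMat V I J} {X : V} (f : ∀ i j, M i j ⟶ X) :
    (intObj M).apex ⟶ X :=
  Limits.Sigma.desc fun p => f p.1 p.2

section
variable (M : VMat V I J) (i : I) (j : J) {X Y : V}

@[simp]
theorem intι_desc (f : ∀ i j, M i j ⟶ X) : intι M i j ≫ intDesc f = f i j :=
  Limits.Sigma.ι_desc _ _

@[simp]
theorem intι_desc_assoc (f : ∀ i j, M i j ⟶ X) (g : X ⟶ Y) :
    intι M i j ≫ intDesc f ≫ g = f i j ≫ g := by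
  rw [← Category.assoc, intι_desc]

@[simp]
theorem intι_l : intι M i j ≫ (intObj M).l = const _ i := Limits.Sigma.ι_desc _ _

@[simp]
theorem intι_r : intι M i j ≫ (intObj M).r = const _ j := Limits.Sigma.ι_desc _ _

theorem intι_l_assoc (g : copow V I ⟶ Y) :
    intι M i j ≫ (intObj M).l ≫ g = const _ i ≫ g := by
  rw [← Category.assoc, intι_l]

theorem intι_r_assoc (g : copow V J ⟶ Y) :
    intι M i j ≫ (intObj M).r ≫ g = const _ j ≫ g := by
  rw [← Category.assoc, intι_r]

variable {M} in
theorem int_hom_ext {f g : (intObj M).apex ⟶ X} (e : ∀ i j, intι M i j ≫ f = intι M i j ≫ g) :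
    f = g :=
  Limits.Sigma.hom_ext _ _ fun p => e p.1 p.2

end

/-- The morphism of apexes induced by a 2-cell of matrices. -/
noncomputable def intHom (a : I → I') (b : J → J') {M : VMat V I J} {M' : VMat V I' J'}
    (f : ∀ i j, M i j ⟶ M' (a i) (b j)) : (intObj M).apex ⟶ (intObj M').apex :=
  intDesc fun i j => f i j ≫ intι M' (a i) (b j)

@[simp]
theorem ι_intHom (a : I → I') (b : J → J') {M : VMat V I J} {M' : VMat V I' J'}
    (f : ∀ i j, M i j ⟶ M' (a i) (b j)) (i : I) (j : J) :
    intι M i j ≫ intHom a b f = f i j ≫ intι M' (a i) (b j) :=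
  intι_desc _ _ _ _

@[simp]
theorem ι_intHom_assoc (a : I → I') (b : J → J') {M : VMat V I J} {M' : VMat V I' J'}
    (f : ∀ i j, M i j ⟶ M' (a i) (b j)) (i : I) (j : J) {X : V} (x : (intObj M').apex ⟶ X) :
    intι M i j ≫ intHom a b f ≫ x = f i j ≫ intι M' (a i) (b j) ≫ x := by
  rw [← Category.assoc, ι_intHom, Category.assoc]

theorem intHom_comp (a : I → I') (b : J → J') (a' : I' → I'') (b' : J' → J'') {M : VMat V I J}
    {M' : VMat V I' J'} {M'' : VMat V I'' J''} (f : ∀ i j, M i j ⟶ M' (a i) (b j))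
    (g : ∀ i j, M' i j ⟶ M'' (a' i) (b' j)) :
    intHom (fun i => a' (a i)) (fun j => b' (b j)) (fun i j => f i j ≫ g (a i) (b j)) =
      intHom a b f ≫ intHom a' b' g := by
  refine int_hom_ext fun i j => ?_
  simp

theorem intHom_id (M : VMat V I J) :
    intHom (M := M) (M' := M) (fun i => i) (fun j => j) (fun i j => 𝟙 (M i j)) = 𝟙 _ := by
  refine int_hom_ext fun i j => ?_
  simp

/-- The action of `Int` on 2-cells. -/
noncomputable def intMap (a : I ⟶ I') (b : J ⟶ J') {M : VMat V I J} {M' : VMat V I' J'}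
    (f : ∀ i j, M i j ⟶ M' (a i) (b j)) : DSpanHom a b (intObj M) (intObj M') where
  hom := intHom a b f
  w_l := int_hom_ext fun i j => by
    rw [ι_intHom_assoc, intι_l_assoc, const_map, intι_l, comp_const]
  w_r := int_hom_ext fun i j => by
    rw [ι_intHom_assoc, intι_r_assoc, const_map, intι_r, comp_const]

@[simp]
theorem intMap_hom (a : I ⟶ I') (b : J ⟶ J') {M : VMat V I J} {M' : VMat V I' J'}
    (f : ∀ i j, M i j ⟶ M' (a i) (b j)) : (intMap a b f).hom = intHom a b f := rfl

theorem intMap_vcomp (a : I ⟶ I') (b : J ⟶ J') (a' : I' ⟶ I'') (b' : J' ⟶ J'')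
    {M : VMat V I J} {M' : VMat V I' J'} {M'' : VMat V I'' J''} (f : MatHom a b M M')
    (g : MatHom a' b' M' M'') :
    (intMap (M := M) (M' := M'') (a ≫ a') (b ≫ b') fun i j => f i j ≫ g (a i) (b j)).hom =
      (intMap a b f).hom ≫ (intMap a' b' g).hom :=
  intHom_comp a b a' b' f g

/-- The comparison of `Int` for horizontal identities. -/
noncomputable def intη (I : Type w) :
    DSpanHom (𝟙 I) (𝟙 I) (intObj (VMat.one (V := V) I)) (DSpan.one I) :=
  .glob (intDesc fun i _ => VMat.oneDesc fun _ => copowι V i)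
    (int_hom_ext fun i j => VMat.oneι_jointlyEpi _ _ fun h => by
      beta_reduce
      rw [intι_l, Category.comp_id, intι_desc, VMat.oneι_desc, comp_const, const,
        toUnit_unique (toUnit (𝟙_ V)) (𝟙 _), Category.id_comp])
    (int_hom_ext fun i j => VMat.oneι_jointlyEpi _ _ fun h => by
      subst h
      beta_reduce
      rw [intι_r, Category.comp_id, intι_desc, VMat.oneι_desc, comp_const, const,
        toUnit_unique (toUnit (𝟙_ V)) (𝟙 _), Category.id_comp])

@[simp]
theorem ι_intη {i j : I} (h : i = j) :
    VMat.oneι h ≫ intι (VMat.one (V := V) I) i j ≫ (intη I).hom = copowι V i := by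
  rw [intη, DSpanHom.glob_hom, intι_desc, VMat.oneι_desc]

theorem intη_naturality (a : I ⟶ J) :
    (intMap (V := V) a a (VMat.oneMap a)).hom ≫ (intη J).hom = (intη I).hom ≫ copowMap a := by
  refine int_hom_ext fun i j => VMat.oneι_jointlyEpi _ _ fun h => ?_
  beta_reduce
  rw [intMap_hom, ι_intHom_assoc, VMat.ι_oneMap_assoc, ι_intη]
  have e := congrArg (· ≫ copowMap a) (ι_intη (V := V) h)
  simp only [Category.assoc, copowι_map] at e
  exact e.symm

variable [HasFiniteLimits V]

/-- The comparison of `Int` for horizontal composition. -/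
noncomputable def intδ (M : VMat V I J) (N : VMat V J K) :
    DSpanHom (𝟙 I) (𝟙 K) (intObj (M.comp N)) ((intObj M).comp (intObj N)) :=
  .glob (intDesc fun i k => VMat.compDesc fun j =>
      DSpan.lift (snd _ _ ≫ intι M i j) (fst _ _ ≫ intι N j k) (by simp))
    (int_hom_ext fun i k => VMat.compι_jointlyEpi _ _ _ _ _ _ fun j => by
      rw [intι_l, intι_desc_assoc, VMat.compι_desc_assoc, DSpan.comp_l, DSpan.lift_p₁_assoc,
        Category.assoc, intι_l, comp_const, comp_const])
    (int_hom_ext fun i k => VMat.compι_jointlyEpi _ _ _ _ _ _ fun j => by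
      rw [intι_r, intι_desc_assoc, VMat.compι_desc_assoc, DSpan.comp_r, DSpan.lift_p₂_assoc,
        Category.assoc, intι_r, comp_const, comp_const])

section
variable (M : VMat V I J) (N : VMat V J K) (i : I) (j : J) (k : K) {X : V}

@[simp]
theorem ι_intδ_p₁ : VMat.compι M N i k j ≫ intι (M.comp N) i k ≫ (intδ M N).hom ≫
    DSpan.p₁ (intObj M) (intObj N) = snd _ _ ≫ intι M i j := by
  rw [intδ, DSpanHom.glob_hom, intι_desc_assoc, VMat.compι_desc_assoc, DSpan.lift_p₁]

@[simp]
theorem ι_intδ_p₂ : VMat.compι M N i k j ≫ intι (M.comp N) i k ≫ (intδ M N).hom ≫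
    DSpan.p₂ (intObj M) (intObj N) = fst _ _ ≫ intι N j k := by
  rw [intδ, DSpanHom.glob_hom, intι_desc_assoc, VMat.compι_desc_assoc, DSpan.lift_p₂]

@[simp]
theorem ι_intδ_p₁_assoc (x : (intObj M).apex ⟶ X) :
    VMat.compι M N i k j ≫ intι (M.comp N) i k ≫ (intδ M N).hom ≫
      DSpan.p₁ (intObj M) (intObj N) ≫ x = snd _ _ ≫ intι M i j ≫ x := by
  have e := congrArg (· ≫ x) (ι_intδ_p₁ M N i j k)
  simpa only [Category.assoc] using e

@[simp]
theorem ι_intδ_p₂_assoc (x : (intObj N).apex ⟶ X) :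
    VMat.compι M N i k j ≫ intι (M.comp N) i k ≫ (intδ M N).hom ≫
      DSpan.p₂ (intObj M) (intObj N) ≫ x = fst _ _ ≫ intι N j k ≫ x := by
  have e := congrArg (· ≫ x) (ι_intδ_p₂ M N i j k)
  simpa only [Category.assoc] using e

end

theorem intδ_naturality (a : I ⟶ I') (b : J ⟶ J') (c : K ⟶ K')
    {M : VMat V I J} {M' : VMat V I' J'} {N : VMat V J K} {N' : VMat V J' K'}
    (f : ∀ i j, M i j ⟶ M' (a i) (b j)) (g : ∀ j k, N j k ⟶ N' (b j) (c k)) :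
    (intMap a c (VMat.compMap a b c f g)).hom ≫ (intδ M' N').hom =
      (intδ M N).hom ≫ ((intMap a b f).hcomp (intMap b c g)).hom := by
  refine int_hom_ext fun i k => VMat.compι_jointlyEpi _ _ _ _ _ _ fun j => DSpan.hom_ext ?_ ?_
  · simp
  · simp

variable [MonoidalClosed V]

theorem int_associativity (M : VMat V I J) (N : VMat V J K) (P : VMat V K L) :
    (intδ (M.comp N) P).hom ≫
      ((intδ M N).hcomp (.glob (A := intObj P) (B := intObj P) (𝟙 _) (Category.id_comp _)
        (Category.id_comp _))).hom ≫
      (DSpan.assocHom (intObj M) (intObj N) (intObj P)).hom =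
    intHom (fun i => i) (fun j => j) (VMat.assocHom M N P) ≫ (intδ M (N.comp P)).hom ≫
      (DSpanHom.hcomp (.glob (A := intObj M) (B := intObj M) (𝟙 _) (Category.id_comp _)
        (Category.id_comp _)) (intδ N P)).hom := by
  refine int_hom_ext fun i l => VMat.compι_jointlyEpi _ _ _ _ _ _ fun k =>
    (VMat.compι_jointlyEpi M N i k).whiskerLeft _ _ _ fun j =>
      DSpan.hom_ext ?_ (DSpan.hom_ext ?_ ?_)
  · beta_reduce
    simp
  · beta_reduce
    simp
  · beta_reduce
    simp

theorem int_left_unitality (M : VMat V I J) :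
    (intδ (VMat.one I) M).hom ≫
      ((intη I).hcomp (.glob (A := intObj M) (B := intObj M) (𝟙 _) (Category.id_comp _)
        (Category.id_comp _))).hom ≫ (DSpan.lunitHom (intObj M)).hom =
    intHom (fun i => i) (fun j => j) (VMat.lunitHom M) := by
  refine int_hom_ext fun i j => VMat.lunit_ext _ _ _ ?_
  simp [rightUnitor_hom]

theorem int_right_unitality (M : VMat V I J) :
    (intδ M (VMat.one J)).hom ≫
      (DSpanHom.hcomp (.glob (A := intObj M) (B := intObj M) (𝟙 _) (Category.id_comp _)
        (Category.id_comp _)) (intη J)).hom ≫ (DSpan.runitHom (intObj M)).hom =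
    intHom (fun i => i) (fun j => j) (VMat.runitHom M) := by
  refine int_hom_ext fun i j => VMat.runit_ext _ _ _ ?_
  simp [leftUnitor_hom]

variable (V) in
/-- The oplax double functor `Int : V-Mat ⟶ Span_d(V)`. -/
noncomputable def IntD : OplaxDoubleFunctor (MatD.{w} V) (SpanD.{w} V) where
  obj := 𝟭 (Type w)
  hor M := intObj M
  sq {_ _ _ _ a b _ _} f := intMap a b f
  sq_vid M := DSpanHom.heq rfl rfl (intHom_id M)
  sq_vcomp {_ _ _ _ _ _ a b a' b' _ _ _} f g :=
    DSpanHom.heq rfl rfl (intMap_vcomp a b a' b' f g)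
  δ M N := intδ M N
  η I := intη I
  δ_naturality {_ _ _ _ _ _ a b c _ _ _ _} f g :=
    DSpanHom.heq rfl rfl (intδ_naturality a b c f g)
  η_naturality a := DSpanHom.heq rfl rfl (intη_naturality a)
  associativity M N P := DSpanHom.heq rfl rfl (int_associativity M N P)
  left_unitality M := DSpanHom.heq rfl rfl (int_left_unitality M)
  right_unitality M := DSpanHom.heq rfl rfl (int_right_unitality M)

end IntD

/-! ### The lax double functor `En` -/

section EnD

variable {V : Type u} [Category.{v} V] [CartesianMonoidalCategory V] [HasCoproducts.{w} V]
  [HasFiniteLimits V] {I J K L I' J' K' I'' J'' : Type w}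

/-- The matrix of a discrete span: its entry of index `(i, j)` is the pullback of
`A ⟶ (I • 1) ⊗ (J • 1)` along the pair of coprojections `1 ⟶ (I • 1) ⊗ (J • 1)`. -/
noncomputable def enObj (A : DSpan V I J) : VMat V I J := fun i j =>
  pullback (CartesianMonoidalCategory.lift A.l A.r)
    (CartesianMonoidalCategory.lift (copowι V i) (copowι V j))

/-- The projection of an entry of `enObj A` to the apex. -/
noncomputable def enπ (A : DSpan V I J) (i : I) (j : J) : enObj A i j ⟶ A.apex :=
  pullback.fst _ _

section
variable (A : DSpan V I J) (i : I) (j : J) {X : V}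

@[simp]
theorem enπ_l : enπ A i j ≫ A.l = const _ i := by
  have e := congrArg (· ≫ fst _ _) (pullback.condition
    (f := CartesianMonoidalCategory.lift A.l A.r)
    (g := CartesianMonoidalCategory.lift (copowι V i) (copowι V j)))
  simp only [Category.assoc, CartesianMonoidalCategory.lift_fst] at e
  exact e.trans (congrArg (· ≫ copowι V i) (toUnit_unique _ _))

@[simp]
theorem enπ_r : enπ A i j ≫ A.r = const _ j := by
  have e := congrArg (· ≫ snd _ _) (pullback.condition
    (f := CartesianMonoidalCategory.lift A.l A.r)
    (g := CartesianMonoidalCategory.lift (copowι V i) (copowι V j)))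
  simp only [Category.assoc, CartesianMonoidalCategory.lift_snd] at e
  exact e.trans (congrArg (· ≫ copowι V j) (toUnit_unique _ _))

variable {A i j}

/-- Morphisms into an entry of `enObj A`. -/
noncomputable def enLift (f : X ⟶ A.apex) (hl : f ≫ A.l = const X i) (hr : f ≫ A.r = const X j) :
    X ⟶ enObj A i j :=
  pullback.lift f (toUnit X) (by
    rw [comp_lift, comp_lift, hl, hr])

@[simp]
theorem enLift_π (f : X ⟶ A.apex) (hl : f ≫ A.l = const X i) (hr : f ≫ A.r = const X j) :
    enLift f hl hr ≫ enπ A i j = f :=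
  pullback.lift_fst _ _ _

@[simp]
theorem enLift_π_assoc (f : X ⟶ A.apex) (hl : f ≫ A.l = const X i) (hr : f ≫ A.r = const X j)
    {Y : V} (k : A.apex ⟶ Y) : enLift f hl hr ≫ enπ A i j ≫ k = f ≫ k := by
  rw [← Category.assoc, enLift_π]

theorem en_hom_ext {f g : X ⟶ enObj A i j} (e : f ≫ enπ A i j = g ≫ enπ A i j) : f = g :=
  pullback.hom_ext e (toUnit_unique _ _)

end

theorem enπ_l_assoc (A : DSpan V I J) (i : I) (j : J) {X : V} (k : copow V I ⟶ X) :
    enπ A i j ≫ A.l ≫ k = const _ i ≫ k := by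
  rw [← Category.assoc, enπ_l]

theorem enπ_r_assoc (A : DSpan V I J) (i : I) (j : J) {X : V} (k : copow V J ⟶ X) :
    enπ A i j ≫ A.r ≫ k = const _ j ≫ k := by
  rw [← Category.assoc, enπ_r]

/-- The action of `En` on 2-cells. -/
noncomputable def enMap {a : I ⟶ I'} {b : J ⟶ J'} {A : DSpan V I J} {A' : DSpan V I' J'}
    (f : DSpanHom a b A A') (i : I) (j : J) : enObj A i j ⟶ enObj A' (a i) (b j) :=
  enLift (enπ A i j ≫ f.hom)
    (by rw [Category.assoc, f.w_l, enπ_l_assoc, const_map])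
    (by rw [Category.assoc, f.w_r, enπ_r_assoc, const_map])

@[simp]
theorem enMap_π {a : I ⟶ I'} {b : J ⟶ J'} {A : DSpan V I J} {A' : DSpan V I' J'}
    (f : DSpanHom a b A A') (i : I) (j : J) :
    enMap f i j ≫ enπ A' (a i) (b j) = enπ A i j ≫ f.hom :=
  enLift_π _ _ _

@[simp]
theorem enMap_π_assoc {a : I ⟶ I'} {b : J ⟶ J'} {A : DSpan V I J} {A' : DSpan V I' J'}
    (f : DSpanHom a b A A') (i : I) (j : J) {X : V} (k : A'.apex ⟶ X) :
    enMap f i j ≫ enπ A' (a i) (b j) ≫ k = enπ A i j ≫ f.hom ≫ k := by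
  rw [← Category.assoc, enMap_π, Category.assoc]

theorem enMap_comp {a : I ⟶ I'} {b : J ⟶ J'} {a' : I' ⟶ I''} {b' : J' ⟶ J''} {A : DSpan V I J}
    {A' : DSpan V I' J'} {A'' : DSpan V I'' J''} (f : DSpanHom a b A A')
    (g : DSpanHom a' b' A' A'') (i : I) (j : J) :
    enMap (f.vcomp g) i j = enMap f i j ≫ enMap g (a i) (b j) :=
  have e : (enMap f i j ≫ enMap g (a i) (b j)) ≫ enπ A'' (a' (a i)) (b' (b j)) =
      enπ A i j ≫ f.hom ≫ g.hom := by simp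
  en_hom_ext ((enMap_π _ i j).trans e.symm)

/-- The action of `En` on 2-cells with identity vertical sides. -/
noncomputable def enGlob {A B : DSpan V I J} (f : DSpanHom (𝟙 I) (𝟙 J) A B) (i : I) (j : J) :
    enObj A i j ⟶ enObj B i j :=
  enMap f i j

@[simp]
theorem enGlob_π {A B : DSpan V I J} (f : DSpanHom (𝟙 I) (𝟙 J) A B) (i : I) (j : J) :
    enGlob f i j ≫ enπ B i j = enπ A i j ≫ f.hom :=
  enMap_π _ _ _

/-- The comparison of `En` for horizontal identities. -/
noncomputable def enε (I : Type w) (i j : I) :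
    VMat.one (V := V) I i j ⟶ enObj (DSpan.one I) i j :=
  VMat.oneDesc fun h => enLift (copowι V i)
    (by rw [Category.comp_id, const, toUnit_unique (toUnit (𝟙_ V)) (𝟙 _), Category.id_comp])
    (by rw [Category.comp_id, const, toUnit_unique (toUnit (𝟙_ V)) (𝟙 _), Category.id_comp, h])

@[simp]
theorem ι_enε_π {i j : I} (h : i = j) :
    VMat.oneι h ≫ enε I i j ≫ enπ (DSpan.one I) i j = copowι V i := by
  rw [enε, ← Category.assoc, VMat.oneι_desc, enLift_π]

/-- The comparison of `En` for horizontal composition. -/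
noncomputable def enμ (A : DSpan V I J) (B : DSpan V J K) (i : I) (k : K) :
    VMat.comp (enObj A) (enObj B) i k ⟶ enObj (A.comp B) i k :=
  VMat.compDesc fun j => enLift
    (DSpan.lift (snd _ _ ≫ enπ A i j) (fst _ _ ≫ enπ B j k) (by simp)) (by simp) (by simp)

section
variable (A : DSpan V I J) (B : DSpan V J K) (i : I) (j : J) (k : K) {X : V}

@[simp]
theorem ι_enμ_p₁ : VMat.compι (enObj A) (enObj B) i k j ≫ enμ A B i k ≫
    enπ (A.comp B) i k ≫ DSpan.p₁ A B = snd _ _ ≫ enπ A i j := by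
  rw [enμ, VMat.compι_desc_assoc, enLift_π_assoc, DSpan.lift_p₁]

@[simp]
theorem ι_enμ_p₂ : VMat.compι (enObj A) (enObj B) i k j ≫ enμ A B i k ≫
    enπ (A.comp B) i k ≫ DSpan.p₂ A B = fst _ _ ≫ enπ B j k := by
  rw [enμ, VMat.compι_desc_assoc, enLift_π_assoc, DSpan.lift_p₂]

@[simp]
theorem ι_enμ_p₁_assoc (x : A.apex ⟶ X) :
    VMat.compι (enObj A) (enObj B) i k j ≫ enμ A B i k ≫
      enπ (A.comp B) i k ≫ DSpan.p₁ A B ≫ x = snd _ _ ≫ enπ A i j ≫ x := by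
  have e := congrArg (· ≫ x) (ι_enμ_p₁ A B i j k)
  simpa only [Category.assoc] using e

@[simp]
theorem ι_enμ_p₂_assoc (x : B.apex ⟶ X) :
    VMat.compι (enObj A) (enObj B) i k j ≫ enμ A B i k ≫
      enπ (A.comp B) i k ≫ DSpan.p₂ A B ≫ x = fst _ _ ≫ enπ B j k ≫ x := by
  have e := congrArg (· ≫ x) (ι_enμ_p₂ A B i j k)
  simpa only [Category.assoc] using e

end

theorem enμ_naturality {a : I ⟶ I'} {b : J ⟶ J'} {c : K ⟶ K'} {A : DSpan V I J}
    {A' : DSpan V I' J'} {B : DSpan V J K} {B' : DSpan V J' K'}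
    (f : DSpanHom a b A A') (g : DSpanHom b c B B') (i : I) (k : K) :
    VMat.compMap a b c (enMap f) (enMap g) i k ≫ enμ A' B' (a i) (c k) =
      enμ A B i k ≫ enMap (f.hcomp g) i k := by
  refine VMat.compι_jointlyEpi _ _ _ _ _ _ fun j => en_hom_ext (DSpan.hom_ext ?_ ?_)
  · simp
  · simp

theorem enε_naturality (a : I ⟶ J) (i j : I) :
    VMat.oneMap a i j ≫ enε (V := V) J (a i) (a j) =
      enε I i j ≫ enMap (DSpanHom.hid a) i j := by
  refine VMat.oneι_jointlyEpi _ _ fun h => en_hom_ext ?_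
  beta_reduce
  simp only [Category.assoc, enMap_π, DSpanHom.hid_hom]
  rw [VMat.ι_oneMap_assoc, ι_enε_π]
  have e := congrArg (· ≫ copowMap a) (ι_enε_π (V := V) h)
  simp only [Category.assoc, copowι_map] at e
  exact e.symm

variable [MonoidalClosed V]

theorem en_associativity (A : DSpan V I J) (B : DSpan V J K) (C : DSpan V K L) (i : I) (l : L) :
    VMat.compMap (fun i => i) (fun k => k) (fun l => l) (N' := enObj C) (enμ A B)
        (fun k l => 𝟙 (enObj C k l)) i l ≫
      enμ (A.comp B) C i l ≫ enGlob (DSpan.assocHom A B C) i l =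
    VMat.assocHom (enObj A) (enObj B) (enObj C) i l ≫
      VMat.compMap (fun i => i) (fun k => k) (fun l => l) (M' := enObj A)
        (fun i j => 𝟙 (enObj A i j)) (enμ B C) i l ≫ enμ A (B.comp C) i l := by
  refine VMat.compι_jointlyEpi _ _ _ _ _ _ fun k =>
    (VMat.compι_jointlyEpi _ _ i k).whiskerLeft _ _ _ fun j =>
      en_hom_ext (DSpan.hom_ext ?_ (DSpan.hom_ext ?_ ?_))
  · beta_reduce
    simp
  · beta_reduce
    simp
  · beta_reduce
    simp

theorem en_left_unitality (A : DSpan V I J) (i : I) (j : J) :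
    VMat.compMap (fun i => i) (fun k => k) (fun l => l) (N' := enObj A) (enε I)
        (fun i j => 𝟙 (enObj A i j)) i j ≫
      enμ (DSpan.one I) A i j ≫ enGlob (DSpan.lunitHom A) i j =
    VMat.lunitHom (enObj A) i j := by
  refine VMat.lunit_ext _ _ _ (en_hom_ext ?_)
  simp [rightUnitor_hom]

theorem en_right_unitality (A : DSpan V I J) (i : I) (j : J) :
    VMat.compMap (fun i => i) (fun k => k) (fun l => l) (M' := enObj A)
        (fun i j => 𝟙 (enObj A i j)) (enε J) i j ≫
      enμ A (DSpan.one J) i j ≫ enGlob (DSpan.runitHom A) i j =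
    VMat.runitHom (enObj A) i j := by
  refine VMat.runit_ext _ _ _ (en_hom_ext ?_)
  simp [leftUnitor_hom]

variable (V) in
/-- The lax double functor `En : Span_d(V) ⟶ V-Mat`. -/
noncomputable def EnD : LaxDoubleFunctor (SpanD.{w} V) (MatD.{w} V) where
  obj := 𝟭 (Type w)
  hor A := enObj A
  sq f := enMap f
  sq_vid A := heq_of_eq (funext fun i => funext fun j => en_hom_ext
    ((enMap_π _ i j).trans ((Category.comp_id _).trans (Category.id_comp _).symm)))
  sq_vcomp f g := heq_of_eq (funext fun i => funext fun j => enMap_comp f g i j)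
  μ A B := enμ A B
  ε I := enε I
  μ_naturality f g := heq_of_eq (funext fun i => funext fun j => enμ_naturality f g i j)
  ε_naturality a := heq_of_eq (funext fun i => funext fun j => enε_naturality a i j)
  associativity A B C := heq_of_eq (funext fun i => funext fun j => en_associativity A B C i j)
  left_unitality A := heq_of_eq (funext fun i => funext fun j => en_left_unitality A i j)
  right_unitality A := heq_of_eq (funext fun i => funext fun j => en_right_unitality A i j)

end EnD

end MatSpan

/-!
Write `Int` for the passage from matrices to discrete spans and `En` for the passage back. At the
level of 2-cells, a 2-cell `M ⟶ En A` over a pair of maps of sets is the same as a 2-cell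
`Int M ⟶ A`, so the oplax double functor `Int` is left adjoint to the lax double functor `En`, and
unit and counit relate the comparison 2-cells of the two (`intEnAdj`). All four conditions are
shown to say that the unit and the counit of this adjunction are invertible (`IntEnIsIso`).

* A double equivalence induces an equivalence between the categories whose objects are all
  horizontal 1-cells and whose morphisms are all 2-cells. If one of two adjoint functors is an
  equivalence, then unit and counit are invertible (`IntEnIsIso.of_isEquivalence`).

* Because `V` is cartesian closed, `(I • 1) ⊗ (J • 1)` is the copower of `I × J`
  (`isIso_copowPair`), so that the entries of `En A` are the fibres of one morphism to
  `(I × J) • 1`. Hence the unit and the counit of `Int ⊣ En` at `I` and `J` are those of the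
  adjunction `V^Λ ⇄ V / (Λ • 1)` for any `Λ` in bijection with `I × J` (`intEnIsIso_iff`).

* If unit and counit are invertible, then so are all comparison 2-cells. For the composition
  comparison of `En`, the fibre of a composite span at `(i, k)` is, by the counit over the middle
  set `J`, the coproduct of its parts over the `j` in `J`, and such a part is the product of the
  fibres at `(i, j)` and `(j, k)` (`IntEnIsIso.isIso_enμ`). The unit comparison of `Int` is always
  invertible (`isIso_intη`). The other two comparisons follow from the equations between the unit
  and the comparison 2-cells. Inverting comparison 2-cells turns lax into oplax double functors and
  conversely, so unit and counit become isomorphisms of lax and of oplax double functors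
  (`DoubleAdjunction.isDoubleEquivalence`).

* The functor `∏ᵢ V / Xᵢ ⥤ V / ∐ᵢ Xᵢ` is a slice of `V^I ⥤ V / (I • 1)`, so it is an equivalence if
  the latter is, and the latter is the special case in which all `Xᵢ` are terminal
  (`isExtensive_iff`).
-/

namespace MatSpan

open PseudoDoubleCategory

/-! ### Invertible 2-cells -/

section Invertible

variable {D : PseudoDoubleCategory}

/-- An inverse in the category of horizontal 1-cells automatically has identity vertical sides, and
bundling the sides replaces heterogeneous equalities by equalities of morphisms. -/
theorem isInvertible_iff_isIso_tot {A B : D.Obj} {M N : D.Hor A B} (α : D.Sq (𝟙 A) (𝟙 B) M N) :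
    IsInvertible α ↔ IsIso (tot α) := by
  constructor
  · rintro ⟨β, h, h'⟩
    exact ⟨tot β, tot_eq (α := D.vcomp α β) (by simp) (by simp) h,
      tot_eq (α := D.vcomp β α) (by simp) (by simp) h'⟩
  · rintro ⟨β, h, h'⟩
    have hl : β.left = 𝟙 A := by
      have e : 𝟙 A ≫ β.left = 𝟙 A := congrArg TotHom.left h
      simpa using e
    have hr : β.right = 𝟙 B := by
      have e : 𝟙 B ≫ β.right = 𝟙 B := congrArg TotHom.right h
      simpa using e
    have e : tot (recast hl hr β.sq) = β := tot_recast hl hr β.sq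
    refine ⟨recast hl hr β.sq, heq_of_tot ?_, heq_of_tot ?_⟩
    · rw [tot_vcomp, e, h]; rfl
    · rw [tot_vcomp, e, h']; rfl

namespace PseudoDoubleCategory.IsInvertible

/-- A chosen inverse of an invertible 2-cell. -/
noncomputable def inv {A B : D.Obj} {M N : D.Hor A B}
    {α : D.Sq (𝟙 A) (𝟙 B) M N} (h : IsInvertible α) : D.Sq (𝟙 A) (𝟙 B) N M :=
  h.choose

variable {A B : D.Obj} {M N : D.Hor A B} {α : D.Sq (𝟙 A) (𝟙 B) M N}

theorem tot_comp_inv (h : IsInvertible α) : tot α ≫ tot h.inv = 𝟙 _ :=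
  tot_eq (α := D.vcomp α h.inv) (by simp) (by simp) h.choose_spec.1

theorem inv_comp_tot (h : IsInvertible α) : tot h.inv ≫ tot α = 𝟙 _ :=
  tot_eq (α := D.vcomp h.inv α) (by simp) (by simp) h.choose_spec.2

theorem isInvertible_inv (h : IsInvertible α) : IsInvertible h.inv :=
  ⟨α, h.choose_spec.2, h.choose_spec.1⟩

end PseudoDoubleCategory.IsInvertible

/-- Horizontal composition of 2-cells is functorial, stated for bundled 2-cells so that the vertical
sides need to agree only propositionally. -/
theorem tot_hcompSq_comp {A B C A' B' C' A'' B'' C'' : D.Obj}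
    {f : A ⟶ A'} {g : B ⟶ B'} {h : C ⟶ C'} {f' : A' ⟶ A''} {g' : B' ⟶ B''} {h' : C' ⟶ C''}
    {f'' : A ⟶ A''} {g'' : B ⟶ B''} {h'' : C ⟶ C''}
    {M : D.Hor A B} {M' : D.Hor A' B'} {M'' : D.Hor A'' B''}
    {N : D.Hor B C} {N' : D.Hor B' C'} {N'' : D.Hor B'' C''}
    {α : D.Sq f g M M'} {α' : D.Sq f' g' M' M''} {α'' : D.Sq f'' g'' M M''}
    {β : D.Sq g h N N'} {β' : D.Sq g' h' N' N''} {β'' : D.Sq g'' h'' N N''}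
    (e : tot α ≫ tot α' = tot α'') (e' : tot β ≫ tot β' = tot β'') :
    tot (D.hcompSq α β) ≫ tot (D.hcompSq α' β') = tot (D.hcompSq α'' β'') := by
  rw [← tot_interchange]
  exact hcompSq_congr e e'

theorem tot_hcompSq_vid {A B C : D.Obj} (M : D.Hor A B) (N : D.Hor B C) :
    tot (D.hcompSq (D.vid M) (D.vid N)) = 𝟙 _ :=
  (congrArg tot (D.hcompSq_vid M N)).trans (tot_vid _)

theorem tot_hcompSq_comp_eq_id {A B C A' B' C' : D.Obj}
    {f : A ⟶ A'} {g : B ⟶ B'} {h : C ⟶ C'} {f' : A' ⟶ A} {g' : B' ⟶ B} {h' : C' ⟶ C}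
    {M : D.Hor A B} {M' : D.Hor A' B'} {N : D.Hor B C} {N' : D.Hor B' C'}
    {α : D.Sq f g M M'} {α' : D.Sq f' g' M' M} {β : D.Sq g h N N'} {β' : D.Sq g' h' N' N}
    (e : tot α ≫ tot α' = 𝟙 _) (e' : tot β ≫ tot β' = 𝟙 _) :
    tot (D.hcompSq α β) ≫ tot (D.hcompSq α' β') = 𝟙 _ :=
  (tot_hcompSq_comp (e.trans (tot_vid M).symm) (e'.trans (tot_vid N).symm)).trans
    (tot_hcompSq_vid M N)

theorem PseudoDoubleCategory.IsInvertible.hcompSq {A B C : D.Obj} {M M' : D.Hor A B}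
    {N N' : D.Hor B C} {α : D.Sq (𝟙 A) (𝟙 B) M M'} {β : D.Sq (𝟙 B) (𝟙 C) N N'}
    (h : IsInvertible α) (h' : IsInvertible β) : IsInvertible (D.hcompSq α β) :=
  (isInvertible_iff_isIso_tot _).2 ⟨tot (D.hcompSq h.inv h'.inv),
    tot_hcompSq_comp_eq_id h.tot_comp_inv h'.tot_comp_inv,
    tot_hcompSq_comp_eq_id h.inv_comp_tot h'.inv_comp_tot⟩

theorem tot_hidSq_comp {A B C : D.Obj} (f : A ⟶ B) (g : B ⟶ C) :
    tot (D.hidSq f) ≫ tot (D.hidSq g) = tot (D.hidSq (f ≫ g)) :=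
  (congrArg tot (D.hidSq_comp f g)).symm

theorem tot_hidSq_id (A : D.Obj) : tot (D.hidSq (𝟙 A)) = 𝟙 _ :=
  congrArg tot (D.hidSq_id A)

theorem tot_hidSq_comp_eq_id {A B : D.Obj} {f : A ⟶ B} {g : B ⟶ A} (e : f ≫ g = 𝟙 A) :
    tot (D.hidSq f) ≫ tot (D.hidSq g) = 𝟙 _ := by
  rw [tot_hidSq_comp, e, tot_hidSq_id]

end Invertible

/-! ### Lax and oplax structures on pseudo-double functors -/

/-- Transposition of a commutative square along its two inverse pairs. -/
theorem comp_eq_comp_of_inverses {C : Type*} [Category* C] {X Y Z W : C} {a : X ⟶ Y} {b : Y ⟶ W}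
    {c : X ⟶ Z} {d : Z ⟶ W} {b' : W ⟶ Y} {c' : Z ⟶ X} (e : a ≫ b = c ≫ d) (hb : b ≫ b' = 𝟙 Y)
    (hc : c' ≫ c = 𝟙 Z) : c' ≫ a = d ≫ b' := by
  calc c' ≫ a = c' ≫ (a ≫ b) ≫ b' := by rw [Category.assoc, hb, Category.comp_id]
    _ = (c' ≫ c) ≫ d ≫ b' := by rw [e]; simp only [Category.assoc]
    _ = d ≫ b' := by rw [hc, Category.id_comp]

theorem comp_eq_of_inverse {C : Type*} [Category* C] {X Y Z : C} {a : X ⟶ Y} {b : Y ⟶ Z}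
    {c : X ⟶ Z} {a' : Y ⟶ X} (e : c = a ≫ b) (h : a' ≫ a = 𝟙 Y) : a' ≫ c = b := by
  rw [e, ← Category.assoc, h, Category.id_comp]

theorem eq_comp_of_inverse {C : Type*} [Category* C] {X Y Z : C} {a : X ⟶ Y} {b : Y ⟶ Z}
    {c : X ⟶ Z} {b' : Z ⟶ Y} (e : a ≫ b = c) (h : b ≫ b' = 𝟙 Y) : a = c ≫ b' := by
  rw [← e, Category.assoc, h, Category.comp_id]

/-- The composite of two left-cancelling pairs. -/
theorem comp_inverses {C : Type*} [Category* C] {X Y Z : C} {a : X ⟶ Y} {b : Y ⟶ Z}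
    {a' : Y ⟶ X} {b' : Z ⟶ Y} (ha : a ≫ a' = 𝟙 X) (hb : b ≫ b' = 𝟙 Y) :
    (a ≫ b) ≫ b' ≫ a' = 𝟙 X := by
  rw [Category.assoc, ← Category.assoc b, hb, Category.id_comp, ha]

section Pseudo

variable {D E : PseudoDoubleCategory}

theorem tot_vid_comp_tot_vid {D : PseudoDoubleCategory} {A B : D.Obj} (M : D.Hor A B) :
    tot (D.vid M) ≫ tot (D.vid M) = 𝟙 _ :=
  Category.id_comp _

/-- A pseudo-double functor presented as an oplax double functor, presented as a lax one. -/
noncomputable def OplaxDoubleFunctor.toLax (F : OplaxDoubleFunctor D E) (h : F.IsPseudo) :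
    LaxDoubleFunctor D E where
  toVerticallyStrictFunctor := F.toVerticallyStrictFunctor
  μ M N := (h.1 M N).inv
  ε A := (h.2 A).inv
  μ_naturality {_ _ _ _ _ _ _ _ _ M M' N N'} α β := heq_of_tot
    (comp_eq_comp_of_inverses (F.tot_δ_naturality α β) (h.1 M' N').tot_comp_inv
      (h.1 M N).inv_comp_tot).symm
  ε_naturality {A B} f := heq_of_tot
    (comp_eq_comp_of_inverses (F.tot_η_naturality f) (h.2 B).tot_comp_inv
      (h.2 A).inv_comp_tot).symm
  associativity M N P := heq_of_tot <| by
    have e := F.tot_associativity M N P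
    rw [← Category.assoc] at e
    have e' := comp_eq_comp_of_inverses e.symm
      (comp_inverses (h.1 M (D.hcomp N P)).tot_comp_inv
        (tot_hcompSq_comp_eq_id (tot_vid_comp_tot_vid (F.hor M)) (h.1 N P).tot_comp_inv))
      (comp_inverses (tot_hcompSq_comp_eq_id (h.1 M N).inv_comp_tot
        (tot_vid_comp_tot_vid (F.hor P))) (h.1 (D.hcomp M N) P).inv_comp_tot)
    exact (Category.assoc _ _ _).symm.trans e'
  left_unitality {A B} M := heq_of_tot <| by
    have e := F.tot_left_unitality M
    rw [← Category.assoc] at e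
    exact (Category.assoc _ _ _).symm.trans (comp_eq_of_inverse e.symm
      (comp_inverses (tot_hcompSq_comp_eq_id (h.2 A).inv_comp_tot
        (tot_vid_comp_tot_vid (F.hor M))) (h.1 (D.hid A) M).inv_comp_tot))
  right_unitality {A B} M := heq_of_tot <| by
    have e := F.tot_right_unitality M
    rw [← Category.assoc] at e
    exact (Category.assoc _ _ _).symm.trans (comp_eq_of_inverse e.symm
      (comp_inverses (tot_hcompSq_comp_eq_id (tot_vid_comp_tot_vid (F.hor M))
        (h.2 B).inv_comp_tot) (h.1 M (D.hid B)).inv_comp_tot))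

/-- A pseudo-double functor presented as a lax double functor, presented as an oplax one. -/
noncomputable def LaxDoubleFunctor.toOplax (G : LaxDoubleFunctor D E) (h : G.IsPseudo) :
    OplaxDoubleFunctor D E where
  toVerticallyStrictFunctor := G.toVerticallyStrictFunctor
  δ M N := (h.1 M N).inv
  η A := (h.2 A).inv
  δ_naturality {_ _ _ _ _ _ _ _ _ M M' N N'} α β := heq_of_tot
    (comp_eq_comp_of_inverses (G.tot_μ_naturality α β) (h.1 M' N').tot_comp_inv
      (h.1 M N).inv_comp_tot).symm
  η_naturality {A B} f := heq_of_tot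
    (comp_eq_comp_of_inverses (G.tot_ε_naturality f) (h.2 B).tot_comp_inv
      (h.2 A).inv_comp_tot).symm
  associativity M N P := heq_of_tot <| by
    have e := G.tot_associativity M N P
    rw [← Category.assoc] at e
    have e' := comp_eq_comp_of_inverses e.symm
      (comp_inverses (tot_hcompSq_comp_eq_id (tot_vid_comp_tot_vid (G.hor M))
        (h.1 N P).tot_comp_inv) (h.1 M (D.hcomp N P)).tot_comp_inv)
      (comp_inverses (h.1 (D.hcomp M N) P).inv_comp_tot
        (tot_hcompSq_comp_eq_id (h.1 M N).inv_comp_tot (tot_vid_comp_tot_vid (G.hor P))))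
    exact (Category.assoc _ _ _).symm.trans e'
  left_unitality {A B} M := heq_of_tot <| by
    have e := G.tot_left_unitality M
    rw [← Category.assoc] at e
    exact (Category.assoc _ _ _).symm.trans (comp_eq_of_inverse e.symm
      (comp_inverses (h.1 (D.hid A) M).inv_comp_tot (tot_hcompSq_comp_eq_id (h.2 A).inv_comp_tot
        (tot_vid_comp_tot_vid (G.hor M)))))
  right_unitality {A B} M := heq_of_tot <| by
    have e := G.tot_right_unitality M
    rw [← Category.assoc] at e
    exact (Category.assoc _ _ _).symm.trans (comp_eq_of_inverse e.symm
      (comp_inverses (h.1 M (D.hid B)).inv_comp_tot (tot_hcompSq_comp_eq_id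
        (tot_vid_comp_tot_vid (G.hor M)) (h.2 B).inv_comp_tot)))

theorem OplaxDoubleFunctor.isPseudo_toLax (F : OplaxDoubleFunctor D E) (h : F.IsPseudo) :
    (F.toLax h).IsPseudo :=
  ⟨fun M N => (h.1 M N).isInvertible_inv, fun A => (h.2 A).isInvertible_inv⟩

theorem LaxDoubleFunctor.isPseudo_toOplax (G : LaxDoubleFunctor D E) (h : G.IsPseudo) :
    (G.toOplax h).IsPseudo :=
  ⟨fun M N => (h.1 M N).isInvertible_inv, fun A => (h.2 A).isInvertible_inv⟩

end Pseudo

/-! ### Vertical transformations on categories of horizontal 1-cells -/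

section Transformations

variable {D E : PseudoDoubleCategory}

/-- The forgetful functor sending a horizontal 1-cell to its source. -/
def PseudoDoubleCategory.srcFunctor (D : PseudoDoubleCategory) : D.Tot ⥤ D.Obj where
  obj X := X.src
  map f := f.left

/-- The forgetful functor sending a horizontal 1-cell to its target. -/
def PseudoDoubleCategory.tgtFunctor (D : PseudoDoubleCategory) : D.Tot ⥤ D.Obj where
  obj X := X.tgt
  map f := f.right

/-- The functor between the categories of horizontal 1-cells and 2-cells induced by a vertically
strict functor. -/
def VerticallyStrictFunctor.totFunctor (F : VerticallyStrictFunctor D E) : D.Tot ⥤ E.Tot where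
  obj X := ⟨F.obj.obj X.src, F.obj.obj X.tgt, F.hor X.hor⟩
  map f := ⟨F.obj.map f.left, F.obj.map f.right, F.sq f.sq⟩
  map_id X := F.tot_sq_vid X.hor
  map_comp f g := F.tot_sq_vcomp f.sq g.sq

theorem VerticallyStrictFunctor.tot_sq_comp_eq_id (F : VerticallyStrictFunctor D E)
    {A B A' B' : D.Obj} {f : A ⟶ A'} {g : B ⟶ B'} {f' : A' ⟶ A} {g' : B' ⟶ B}
    {M : D.Hor A B} {M' : D.Hor A' B'} {α : D.Sq f g M M'} {β : D.Sq f' g' M' M}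
    (e : tot α ≫ tot β = 𝟙 _) : tot (F.sq α) ≫ tot (F.sq β) = 𝟙 _ :=
  (F.totFunctor.map_comp (tot α) (tot β)).symm.trans <|
    (congrArg F.totFunctor.map e).trans (F.totFunctor.map_id _)

namespace VerticalTransformation

variable {F G : VerticallyStrictFunctor D E} (σ : VerticalTransformation F G)

theorem tot_naturality {A B A' B' : D.Obj} {f : A ⟶ A'} {g : B ⟶ B'} {M : D.Hor A B}
    {M' : D.Hor A' B'} (α : D.Sq f g M M') :
    tot (F.sq α) ≫ tot (σ.sq M') = tot (σ.sq M) ≫ tot (G.sq α) :=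
  tot_vcomp_eq (by simp) (by simp) (σ.naturality α)

/-- The natural transformation induced by a vertical transformation. -/
def totNatTrans : F.totFunctor ⟶ G.totFunctor where
  app X := tot (σ.sq X.hor)
  naturality _ _ f := σ.tot_naturality f.sq

/-- The natural isomorphism induced by a pair of inverse vertical transformations. -/
def AreInverse.totIso {σ : VerticalTransformation F G} {τ : VerticalTransformation G F}
    (h : σ.AreInverse τ) : F.totFunctor ≅ G.totFunctor where
  hom := σ.totNatTrans
  inv := τ.totNatTrans
  hom_inv_id := by
    ext X
    exact tot_eq (α := E.vcomp _ _) (congrArg (fun t => t.app X.src) h.app_left)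
      (congrArg (fun t => t.app X.tgt) h.app_left) (h.sq_left X.hor)
  inv_hom_id := by
    ext X
    exact tot_eq (α := E.vcomp _ _) (congrArg (fun t => t.app X.src) h.app_right)
      (congrArg (fun t => t.app X.tgt) h.app_right) (h.sq_right X.hor)

/-- The component at a 0-cell is a vertical side of the component at the horizontal identity, so it
is invertible if the latter is. -/
theorem isIso_app_of_isIso_tot (h : ∀ {A B : D.Obj} (M : D.Hor A B), IsIso (tot (σ.sq M))) :
    IsIso σ.app := by
  have (A : D.Obj) : IsIso (σ.app.app A) := by
    have := h (D.hid A)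
    exact inferInstanceAs (IsIso (E.srcFunctor.map (tot (σ.sq (D.hid A)))))
  exact NatIso.isIso_of_isIso_app _

/-- A vertical transformation whose components are invertible has an inverse. -/
theorem exists_areInverse (h : ∀ {A B : D.Obj} (M : D.Hor A B), IsIso (tot (σ.sq M))) :
    ∃ τ : VerticalTransformation G F, σ.AreInverse τ := by
  have := σ.isIso_app_of_isIso_tot h
  have {A B : D.Obj} (M : D.Hor A B) : IsIso (tot (σ.sq M)) := h M
  have hl {A B : D.Obj} (M : D.Hor A B) :
      (inv (tot (σ.sq M))).left = (inv σ.app).app A := by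
    rw [NatIso.isIso_inv_app]
    exact E.srcFunctor.map_inv (tot (σ.sq M))
  have hr {A B : D.Obj} (M : D.Hor A B) :
      (inv (tot (σ.sq M))).right = (inv σ.app).app B := by
    rw [NatIso.isIso_inv_app]
    exact E.tgtFunctor.map_inv (tot (σ.sq M))
  have ht {A B : D.Obj} (M : D.Hor A B) :
      tot (recast (hl M) (hr M) (inv (tot (σ.sq M))).sq) = inv (tot (σ.sq M)) :=
    tot_recast _ _ _
  refine ⟨⟨inv σ.app, fun M => recast (hl M) (hr M) (inv (tot (σ.sq M))).sq, fun α => ?_⟩,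
    IsIso.hom_inv_id _, IsIso.inv_hom_id _, fun M => ?_, fun M => ?_⟩
  · apply heq_of_tot
    rw [tot_vcomp, tot_vcomp, ht, ht]
    exact (comp_eq_comp_of_inverses (σ.tot_naturality α) (IsIso.hom_inv_id _)
      (IsIso.inv_hom_id _)).symm
  · apply heq_of_tot
    rw [tot_vcomp, ht, IsIso.hom_inv_id, tot_vid]
  · apply heq_of_tot
    rw [tot_vcomp, ht, IsIso.inv_hom_id, tot_vid]

variable {σ} {τ : VerticalTransformation G F}

theorem AreInverse.symm (h : σ.AreInverse τ) : τ.AreInverse σ :=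
  ⟨h.app_right, h.app_left, h.sq_right, h.sq_left⟩

theorem AreInverse.tot_comp (h : σ.AreInverse τ) {A B : D.Obj} (M : D.Hor A B) :
    tot (σ.sq M) ≫ tot (τ.sq M) = 𝟙 _ :=
  congrArg (fun t => t.app ⟨A, B, M⟩) h.totIso.hom_inv_id

theorem AreInverse.app_comp (h : σ.AreInverse τ) (A : D.Obj) :
    σ.app.app A ≫ τ.app.app A = 𝟙 _ :=
  congrArg (fun t => t.app A) h.app_left

end VerticalTransformation

/-- Compatibility with the comparison 2-cells passes to the inverse of a transformation, so only the
invertibility of the components is needed. -/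
theorem OplaxDoubleFunctor.Transformation.isomorphic {F G : OplaxDoubleFunctor D E}
    (σ : Transformation F G) (h : ∀ {A B : D.Obj} (M : D.Hor A B), IsIso (tot (σ.sq M))) :
    F.Isomorphic G := by
  obtain ⟨τ, hτ⟩ := σ.exists_areInverse h
  refine ⟨σ, ⟨τ, fun {A B C} M N => ?_, fun A => ?_⟩, hτ⟩
  · have e : tot (σ.sq (D.hcomp M N)) ≫ tot (G.δ M N) =
        tot (F.δ M N) ≫ tot (E.hcompSq (σ.sq M) (σ.sq N)) :=
      tot_vcomp_eq (by simp) (by simp) (σ.comp_δ M N)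
    exact heq_of_tot (comp_eq_comp_of_inverses e.symm (tot_hcompSq_comp_eq_id (hτ.tot_comp M)
      (hτ.tot_comp N)) (hτ.symm.tot_comp _))
  · have e : tot (σ.sq (D.hid A)) ≫ tot (G.η A) =
        tot (F.η A) ≫ tot (E.hidSq (σ.app.app A)) :=
      tot_vcomp_eq (by simp) (by simp) (σ.comp_η A)
    exact heq_of_tot (comp_eq_comp_of_inverses e.symm (tot_hidSq_comp_eq_id (hτ.app_comp A))
      (hτ.symm.tot_comp _))

/-- Compatibility with the comparison 2-cells passes to the inverse of a transformation, so only the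
invertibility of the components is needed. -/
theorem LaxDoubleFunctor.Transformation.isomorphic {F G : LaxDoubleFunctor D E}
    (σ : Transformation F G) (h : ∀ {A B : D.Obj} (M : D.Hor A B), IsIso (tot (σ.sq M))) :
    F.Isomorphic G := by
  obtain ⟨τ, hτ⟩ := σ.exists_areInverse h
  refine ⟨σ, ⟨τ, fun {A B C} M N => ?_, fun A => ?_⟩, hτ⟩
  · have e : tot (F.μ M N) ≫ tot (σ.sq (D.hcomp M N)) =
        tot (E.hcompSq (σ.sq M) (σ.sq N)) ≫ tot (G.μ M N) :=
      tot_vcomp_eq (by simp) (by simp) (σ.μ_comp M N)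
    exact heq_of_tot (comp_eq_comp_of_inverses e (hτ.tot_comp _) (tot_hcompSq_comp_eq_id
      (hτ.symm.tot_comp M) (hτ.symm.tot_comp N))).symm
  · have e : tot (F.ε A) ≫ tot (σ.sq (D.hid A)) =
        tot (E.hidSq (σ.app.app A)) ≫ tot (G.ε A) :=
      tot_vcomp_eq (by simp) (by simp) (σ.ε_comp A)
    exact heq_of_tot (comp_eq_comp_of_inverses e (hτ.tot_comp _)
      (tot_hidSq_comp_eq_id (hτ.symm.app_comp A))).symm

theorem OplaxDoubleFunctor.Isomorphic.symm {F G : OplaxDoubleFunctor D E} :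
    F.Isomorphic G → G.Isomorphic F :=
  fun ⟨σ, τ, h⟩ => ⟨τ, σ, h.symm⟩

theorem LaxDoubleFunctor.Isomorphic.symm {F G : LaxDoubleFunctor D E} :
    F.Isomorphic G → G.Isomorphic F :=
  fun ⟨σ, τ, h⟩ => ⟨τ, σ, h.symm⟩

theorem OplaxDoubleFunctor.IsDoubleEquivalence.isEquivalence_totFunctor
    {F : OplaxDoubleFunctor D E} (h : F.IsDoubleEquivalence) : F.totFunctor.IsEquivalence := by
  obtain ⟨-, G, -, ⟨σ, τ, e⟩, ⟨σ', τ', e'⟩⟩ := h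
  exact (CategoryTheory.Equivalence.mk F.totFunctor G.totFunctor e.totIso.symm
    e'.totIso).isEquivalence_functor

theorem LaxDoubleFunctor.IsDoubleEquivalence.isEquivalence_totFunctor
    {F : LaxDoubleFunctor D E} (h : F.IsDoubleEquivalence) : F.totFunctor.IsEquivalence := by
  obtain ⟨-, G, -, ⟨σ, τ, e⟩, ⟨σ', τ', e'⟩⟩ := h
  exact (CategoryTheory.Equivalence.mk F.totFunctor G.totFunctor e.totIso.symm
    e'.totIso).isEquivalence_functor

end Transformations

/-! ### Adjunctions between an oplax and a lax double functor -/

section DoubleAdjunctions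

variable {D E : PseudoDoubleCategory}

/-- A vertical adjunction between an oplax double functor `F` and a lax double functor `G`: a unit
and a counit that satisfy the triangle identities and relate the comparison 2-cells of `F` to those
of `G`. All equations are between 2-cells bundled with their vertical sides. -/
structure DoubleAdjunction (F : OplaxDoubleFunctor D E) (G : LaxDoubleFunctor E D) where
  /-- the unit -/
  unit : VerticalTransformation (.id D)
    (F.toVerticallyStrictFunctor.comp G.toVerticallyStrictFunctor)
  /-- the counit -/
  counit : VerticalTransformation (G.toVerticallyStrictFunctor.comp F.toVerticallyStrictFunctor)
    (.id E)
  left_triangle : ∀ {A B : D.Obj} (M : D.Hor A B),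
    tot (F.sq (unit.sq M)) ≫ tot (counit.sq (F.hor M)) = 𝟙 _
  right_triangle : ∀ {A B : E.Obj} (M : E.Hor A B),
    tot (unit.sq (G.hor M)) ≫ tot (G.sq (counit.sq M)) = 𝟙 _
  unit_hcomp : ∀ {A B C : D.Obj} (M : D.Hor A B) (N : D.Hor B C),
    tot (unit.sq (D.hcomp M N)) ≫ tot (G.sq (F.δ M N)) =
      tot (D.hcompSq (unit.sq M) (unit.sq N)) ≫ tot (G.μ (F.hor M) (F.hor N))
  unit_hid : ∀ A : D.Obj,
    tot (unit.sq (D.hid A)) ≫ tot (G.sq (F.η A)) =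
      tot (D.hidSq (unit.app.app A)) ≫ tot (G.ε (F.obj.obj A))
  counit_hcomp : ∀ {A B C : E.Obj} (M : E.Hor A B) (N : E.Hor B C),
    tot (F.sq (G.μ M N)) ≫ tot (counit.sq (E.hcomp M N)) =
      tot (F.δ (G.hor M) (G.hor N)) ≫ tot (E.hcompSq (counit.sq M) (counit.sq N))
  counit_hid : ∀ A : E.Obj,
    tot (F.sq (G.ε A)) ≫ tot (counit.sq (E.hid A)) =
      tot (F.η (G.obj.obj A)) ≫ tot (E.hidSq (counit.app.app A))

namespace DoubleAdjunction

variable {F : OplaxDoubleFunctor D E} {G : LaxDoubleFunctor E D} (adj : DoubleAdjunction F G)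

/-- The induced adjunction between categories of horizontal 1-cells and 2-cells. -/
def totAdjunction : F.totFunctor ⊣ G.totFunctor :=
  Adjunction.mkOfUnitCounit
    { unit := adj.unit.totNatTrans
      counit := adj.counit.totNatTrans
      left_triangle := by
        ext X
        exact (congrArg (_ ≫ ·) (Category.id_comp _)).trans (adj.left_triangle X.hor)
      right_triangle := by
        ext X
        exact (congrArg (_ ≫ ·) (Category.id_comp _)).trans (adj.right_triangle X.hor) }

theorem isIso_unit (h : F.totFunctor.IsEquivalence) {A B : D.Obj} (M : D.Hor A B) :
    IsIso (tot (adj.unit.sq M)) :=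
  inferInstanceAs (IsIso (adj.totAdjunction.unit.app ⟨A, B, M⟩))

theorem isIso_counit (h : F.totFunctor.IsEquivalence) {A B : E.Obj} (M : E.Hor A B) :
    IsIso (tot (adj.counit.sq M)) :=
  have := adj.totAdjunction.isEquivalence_right_of_isEquivalence_left
  inferInstanceAs (IsIso (adj.totAdjunction.counit.app ⟨A, B, M⟩))

theorem isEquivalence_left_of_right (adj : DoubleAdjunction F G)
    (h : G.totFunctor.IsEquivalence) :
    F.totFunctor.IsEquivalence :=
  adj.totAdjunction.isEquivalence_left_of_isEquivalence_right

/-- The unit as a transformation of oplax double functors. -/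
noncomputable def unitOplax (hG : G.IsPseudo) :
    OplaxDoubleFunctor.Transformation (.id D) (F.comp (G.toOplax hG)) where
  toVerticalTransformation := adj.unit
  comp_δ M N := heq_of_tot <|
    (congrArg (tot (adj.unit.sq (D.hcomp M N)) ≫ ·) (F.tot_compδ (G.toOplax hG) M N)).trans <|
      (Category.assoc _ _ _).symm.trans <|
        (eq_comp_of_inverse (adj.unit_hcomp M N).symm (hG.1 _ _).tot_comp_inv).symm.trans
          (Category.id_comp _).symm
  comp_η A := heq_of_tot <|
    (congrArg (tot (adj.unit.sq (D.hid A)) ≫ ·) (F.tot_compη (G.toOplax hG) A)).trans <|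
      (Category.assoc _ _ _).symm.trans <|
        (eq_comp_of_inverse (adj.unit_hid A).symm (hG.2 _).tot_comp_inv).symm.trans
          (Category.id_comp _).symm

/-- The counit as a transformation of oplax double functors. -/
noncomputable def counitOplax (hG : G.IsPseudo) :
    OplaxDoubleFunctor.Transformation ((G.toOplax hG).comp F) (.id E) where
  toVerticalTransformation := adj.counit
  comp_δ M N := heq_of_tot <|
    (Category.comp_id _).trans <|
      (comp_eq_of_inverse (adj.counit_hcomp M N).symm
        (F.tot_sq_comp_eq_id (hG.1 M N).inv_comp_tot)).symm.trans <|
      (Category.assoc _ _ _).symm.trans <|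
        (congrArg (· ≫ tot (E.hcompSq (adj.counit.sq M) (adj.counit.sq N)))
          ((G.toOplax hG).tot_compδ F M N)).symm
  comp_η A := heq_of_tot <|
    (Category.comp_id _).trans <|
      (comp_eq_of_inverse (adj.counit_hid A).symm
        (F.tot_sq_comp_eq_id (hG.2 A).inv_comp_tot)).symm.trans <|
      (Category.assoc _ _ _).symm.trans <|
        (congrArg (· ≫ tot (E.hidSq (adj.counit.app.app A)))
          ((G.toOplax hG).tot_compη F A)).symm

/-- The unit as a transformation of lax double functors. -/
noncomputable def unitLax (hF : F.IsPseudo) :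
    LaxDoubleFunctor.Transformation (.id D) ((F.toLax hF).comp G) where
  toVerticalTransformation := adj.unit
  μ_comp M N := heq_of_tot <|
    (Category.id_comp _).trans <|
      (eq_comp_of_inverse (adj.unit_hcomp M N)
        (G.tot_sq_comp_eq_id (hF.1 M N).tot_comp_inv)).trans <|
      (Category.assoc _ _ _).trans <|
        (congrArg (tot (D.hcompSq (adj.unit.sq M) (adj.unit.sq N)) ≫ ·)
          ((F.toLax hF).tot_compμ G M N)).symm
  ε_comp A := heq_of_tot <|
    (Category.id_comp _).trans <|
      (eq_comp_of_inverse (adj.unit_hid A)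
        (G.tot_sq_comp_eq_id (hF.2 A).tot_comp_inv)).trans <|
      (Category.assoc _ _ _).trans <|
        (congrArg (tot (D.hidSq (adj.unit.app.app A)) ≫ ·)
          ((F.toLax hF).tot_compε G A)).symm

/-- The counit as a transformation of lax double functors. -/
noncomputable def counitLax (hF : F.IsPseudo) :
    LaxDoubleFunctor.Transformation (G.comp (F.toLax hF)) (.id E) where
  toVerticalTransformation := adj.counit
  μ_comp M N := heq_of_tot <|
    (congrArg (· ≫ tot (adj.counit.sq (E.hcomp M N))) (G.tot_compμ (F.toLax hF) M N)).trans <|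
      (Category.assoc _ _ _).trans <|
        (comp_eq_of_inverse (adj.counit_hcomp M N) (hF.1 _ _).inv_comp_tot).trans
          (Category.comp_id _).symm
  ε_comp A := heq_of_tot <|
    (congrArg (· ≫ tot (adj.counit.sq (E.hid A))) (G.tot_compε (F.toLax hF) A)).trans <|
      (Category.assoc _ _ _).trans <|
        (comp_eq_of_inverse (adj.counit_hid A) (hF.2 _).inv_comp_tot).trans
          (Category.comp_id _).symm

/-- A double adjunction with invertible unit, counit and comparison 2-cells consists of double
equivalences. -/
theorem isDoubleEquivalence (hF : F.IsPseudo) (hG : G.IsPseudo)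
    (hu : ∀ {A B : D.Obj} (M : D.Hor A B), IsIso (tot (adj.unit.sq M)))
    (hc : ∀ {A B : E.Obj} (M : E.Hor A B), IsIso (tot (adj.counit.sq M))) :
    F.IsDoubleEquivalence ∧ G.IsDoubleEquivalence :=
  ⟨⟨hF, G.toOplax hG, G.isPseudo_toOplax hG, ((adj.unitOplax hG).isomorphic hu).symm,
    (adj.counitOplax hG).isomorphic hc⟩,
   ⟨hG, F.toLax hF, F.isPseudo_toLax hF, (adj.counitLax hF).isomorphic hc,
    ((adj.unitLax hF).isomorphic hu).symm⟩⟩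

end DoubleAdjunction

end DoubleAdjunctions

/-! ### The adjunction between `Int` and `En` -/

section IntEn

variable {V : Type u} [Category.{v} V] [CartesianMonoidalCategory V] [HasCoproducts.{w} V]
  [HasFiniteLimits V] {I J K I' J' K' : Type w}

/-- The unit of the adjunction between `Int` and `En`: it sends an entry of a matrix to a fibre of
the coproduct of all entries. -/
noncomputable def enUnit (M : VMat V I J) (i : I) (j : J) : M i j ⟶ enObj (intObj M) i j :=
  enLift (intι M i j) (intι_l M i j) (intι_r M i j)

@[simp]
theorem enUnit_π (M : VMat V I J) (i : I) (j : J) :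
    enUnit M i j ≫ enπ (intObj M) i j = intι M i j :=
  enLift_π _ _ _

@[simp]
theorem enUnit_π_assoc (M : VMat V I J) (i : I) (j : J) {X : V} (k : (intObj M).apex ⟶ X) :
    enUnit M i j ≫ enπ (intObj M) i j ≫ k = intι M i j ≫ k := by
  rw [← Category.assoc, enUnit_π]

/-- The counit of the adjunction between `Int` and `En`: it maps the coproduct of the fibres of a
span to its apex. -/
noncomputable def enCounit (A : DSpan V I J) : DSpanHom (𝟙 I) (𝟙 J) (intObj (enObj A)) A :=
  .glob (intDesc (enπ A)) (int_hom_ext fun i j => by simp) (int_hom_ext fun i j => by simp)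

@[simp]
theorem ι_enCounit (A : DSpan V I J) (i : I) (j : J) :
    intι (enObj A) i j ≫ (enCounit A).hom = enπ A i j :=
  intι_desc _ _ _ _

@[simp]
theorem ι_enCounit_assoc (A : DSpan V I J) (i : I) (j : J) {X : V} (k : A.apex ⟶ X) :
    intι (enObj A) i j ≫ (enCounit A).hom ≫ k = enπ A i j ≫ k := by
  rw [← Category.assoc, ι_enCounit]

theorem enUnit_naturality (a : I ⟶ I') (b : J ⟶ J') {M : VMat V I J} {M' : VMat V I' J'}
    (f : ∀ i j, M i j ⟶ M' (a i) (b j)) (i : I) (j : J) :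
    f i j ≫ enUnit M' (a i) (b j) = enUnit M i j ≫ enMap (intMap a b f) i j :=
  en_hom_ext (by simp)

theorem enCounit_naturality {a : I ⟶ I'} {b : J ⟶ J'} {A : DSpan V I J} {A' : DSpan V I' J'}
    (f : DSpanHom a b A A') :
    intHom a b (enMap f) ≫ (enCounit A').hom = (enCounit A).hom ≫ f.hom :=
  int_hom_ext fun i j => by simp

theorem enUnit_hcomp (M : VMat V I J) (N : VMat V J K) (i : I) (k : K) :
    enUnit (M.comp N) i k ≫ enGlob (intδ M N) i k =
      VMat.compMap (fun i => i) (fun j => j) (fun k => k) (M' := enObj (intObj M))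
        (N' := enObj (intObj N)) (enUnit M) (enUnit N) i k ≫ enμ (intObj M) (intObj N) i k :=
  VMat.compι_jointlyEpi _ _ _ _ _ _ fun j => en_hom_ext (DSpan.hom_ext (by simp) (by simp))

theorem enUnit_hid (I : Type w) (i j : I) :
    enUnit (VMat.one (V := V) I) i j ≫ enGlob (intη I) i j = enε I i j :=
  VMat.oneι_jointlyEpi _ _ fun h => en_hom_ext (by simp)

theorem enCounit_hcomp (A : DSpan V I J) (B : DSpan V J K) :
    intHom (fun i => i) (fun k => k) (enμ A B) ≫ (enCounit (A.comp B)).hom =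
      (intδ (enObj A) (enObj B)).hom ≫ ((enCounit A).hcomp (enCounit B)).hom :=
  int_hom_ext fun i k => VMat.compι_jointlyEpi _ _ _ _ _ _ fun j =>
    DSpan.hom_ext (by simp) (by simp)

theorem enCounit_hid (I : Type w) :
    intHom (M' := enObj (DSpan.one I)) (fun i => i) (fun j => j) (enε (V := V) I) ≫
      (enCounit (DSpan.one I)).hom = (intη I).hom :=
  int_hom_ext fun i j => VMat.oneι_jointlyEpi _ _ fun h => by simp

theorem intHom_enUnit_enCounit (M : VMat V I J) :
    intHom (M' := enObj (intObj M)) (fun i => i) (fun j => j) (enUnit M) ≫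
      (enCounit (intObj M)).hom = 𝟙 _ :=
  int_hom_ext fun i j => by simp

theorem enUnit_enGlob_enCounit (A : DSpan V I J) (i : I) (j : J) :
    enUnit (enObj A) i j ≫ enGlob (enCounit A) i j = 𝟙 _ :=
  en_hom_ext (by simp)

variable [MonoidalClosed V]

variable (V) in
/-- The adjunction between the double functors `Int` and `En`. -/
noncomputable def intEnAdj : DoubleAdjunction (IntD.{w} V) (EnD.{w} V) where
  unit :=
    { app := 𝟙 (𝟭 (Type w))
      sq := fun M => enUnit M
      naturality := fun {_ _ _ _ a b _ _} f =>
        heq_of_eq (funext fun i => funext fun j => enUnit_naturality a b f i j) }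
  counit :=
    { app := 𝟙 (𝟭 (Type w))
      sq := fun A => enCounit A
      naturality := fun f => DSpanHom.heq rfl rfl (enCounit_naturality f) }
  left_triangle M := tot_eq (D := SpanD.{w} V) rfl rfl
    (DSpanHom.heq rfl rfl (intHom_enUnit_enCounit M))
  right_triangle A := tot_eq (D := MatD.{w} V) rfl rfl
    (heq_of_eq (funext fun i => funext fun j => enUnit_enGlob_enCounit A i j))
  unit_hcomp M N := tot_vcomp_eq (D := MatD.{w} V) rfl rfl
    (heq_of_eq (funext fun i => funext fun k => enUnit_hcomp M N i k))
  unit_hid I := tot_vcomp_eq (D := MatD.{w} V) rfl rfl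
    (heq_of_eq (funext fun i => funext fun j =>
      (enUnit_hid I i j).trans
        ((congrArg (· ≫ enε I i j) (VMat.oneMap_id i j)).trans (Category.id_comp _)).symm))
  counit_hcomp A B := tot_vcomp_eq (D := SpanD.{w} V) rfl rfl
    (DSpanHom.heq rfl rfl (enCounit_hcomp A B))
  counit_hid I := tot_vcomp_eq (D := SpanD.{w} V) rfl rfl
    (DSpanHom.heq rfl rfl ((enCounit_hid I).trans
      ((congrArg ((intη (V := V) I).hom ≫ ·) (copowMap_id I)).trans (Category.comp_id _)).symm))

end IntEn

section Invertible

variable {V : Type u} [Category.{v} V] [CartesianMonoidalCategory V] [HasCoproducts.{w} V]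
  {I J : Type w}

theorem matD_isInvertible_iff [MonoidalClosed V] {M N : VMat V I J} (f : ∀ i j, M i j ⟶ N i j) :
    IsInvertible (D := MatD.{w} V) (M := M) (N := N) f ↔ ∀ i j, IsIso (f i j) := by
  constructor
  · rintro ⟨g, h, h'⟩ i j
    exact ⟨g i j, congrFun (congrFun (eq_of_heq h) i) j, congrFun (congrFun (eq_of_heq h') i) j⟩
  · intro h
    let g (i : I) (j : J) : N i j ⟶ M i j := @inv V _ (M i j) (N i j) (f i j) (h i j)
    exact ⟨g,
      heq_of_eq (funext fun i => funext fun j => @IsIso.hom_inv_id V _ _ _ (f i j) (h i j)),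
      heq_of_eq (funext fun i => funext fun j => @IsIso.inv_hom_id V _ _ _ (f i j) (h i j))⟩

theorem spanD_isInvertible_iff [HasFiniteLimits V] {A B : DSpan V I J}
    (f : DSpanHom (𝟙 I) (𝟙 J) A B) :
    IsInvertible (D := SpanD.{w} V) (M := A) (N := B) f ↔ IsIso f.hom := by
  constructor
  · rintro ⟨g, h, h'⟩
    exact ⟨g.hom, congrArg DSpanHom.hom (eq_of_heq h), congrArg DSpanHom.hom (eq_of_heq h')⟩
  · intro h
    have hl : f.hom ≫ B.l = A.l := by rw [f.w_l, copowMap_id, Category.comp_id]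
    have hr : f.hom ≫ B.r = A.r := by rw [f.w_r, copowMap_id, Category.comp_id]
    exact ⟨.glob (inv f.hom) ((IsIso.inv_comp_eq f.hom).2 hl.symm)
      ((IsIso.inv_comp_eq f.hom).2 hr.symm),
      DSpanHom.heq rfl rfl (IsIso.hom_inv_id f.hom),
      DSpanHom.heq rfl rfl (IsIso.inv_hom_id f.hom)⟩

variable [HasFiniteLimits V] [MonoidalClosed V]

variable (V) in
/-- The components of the unit and of the counit of the adjunction between `Int` and `En` are
invertible. -/
structure IntEnIsIso : Prop where
  unit {I J : Type w} (M : VMat V I J) (i : I) (j : J) : IsIso (enUnit M i j)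
  counit {I J : Type w} (A : DSpan V I J) : IsIso (enCounit A).hom

/-- Only the underlying functor between categories of horizontal 1-cells and 2-cells matters here,
not the comparison 2-cells. -/
theorem IntEnIsIso.of_isEquivalence (h : (IntD.{w} V).totFunctor.IsEquivalence) :
    IntEnIsIso.{w} V where
  unit M := (matD_isInvertible_iff _).1 <| (isInvertible_iff_isIso_tot _).2 <|
    (intEnAdj.{w} V).isIso_unit h M
  counit A := (spanD_isInvertible_iff _).1 <| (isInvertible_iff_isIso_tot _).2 <|
    (intEnAdj.{w} V).isIso_counit h A

end Invertible

/-! ### Invertibility of the comparison 2-cells -/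

section Comparison

variable {V : Type u} [Category.{v} V] [CartesianMonoidalCategory V] [HasCoproducts.{w} V]
  {I J K : Type w}

/-- The coproduct of all entries of the unit matrix is the copower, without any hypothesis
on `V`. -/
theorem isIso_intη (I : Type w) : IsIso (intη (V := V) I).hom := by
  -- The off-diagonal entries are initial, so only the diagonal summands matter.
  refine ⟨Limits.Sigma.desc fun i => VMat.oneι rfl ≫ intι (VMat.one I) i i,
    int_hom_ext fun i j => VMat.oneι_jointlyEpi _ _ fun h => ?_,
    copow_hom_ext fun i => ?_⟩
  · subst h
    have e := ι_intη (V := V) (rfl : i = i)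
    beta_reduce
    rw [reassoc_of% e, Limits.Sigma.ι_desc, Category.comp_id]
  · rw [Limits.Sigma.ι_desc_assoc, Category.assoc]
    exact (ι_intη rfl).trans (Category.comp_id _).symm

theorem isIso_intHom {M N : VMat V I J} (f : ∀ i j, M i j ⟶ N i j) [∀ i j, IsIso (f i j)] :
    IsIso (intHom (M' := N) (fun i => i) (fun j => j) f) :=
  ⟨intHom (M' := M) (fun i => i) (fun j => j) fun i j => inv (f i j),
    int_hom_ext fun i j => by simp, int_hom_ext fun i j => by simp⟩

theorem isIso_enGlob [HasFiniteLimits V] {A B : DSpan V I J} (f : DSpanHom (𝟙 I) (𝟙 J) A B)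
    [IsIso f.hom] (i : I) (j : J) : IsIso (enGlob f i j) := by
  have hl : inv f.hom ≫ A.l = B.l := by
    rw [IsIso.inv_comp_eq, f.w_l, copowMap_id, Category.comp_id]
  have hr : inv f.hom ≫ A.r = B.r := by
    rw [IsIso.inv_comp_eq, f.w_r, copowMap_id, Category.comp_id]
  exact ⟨enLift (enπ B i j ≫ inv f.hom) (by rw [Category.assoc, hl, enπ_l])
    (by rw [Category.assoc, hr, enπ_r]), en_hom_ext (by
      have e := enGlob_π f i j
      simp [reassoc_of% e]), en_hom_ext (by simp)⟩

variable [HasFiniteLimits V]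

namespace IntEnIsIso

/-- A globular 2-cell of spans is invertible if the induced morphisms of fibres are. -/
theorem isIso_of_isIso_enGlob (h : IntEnIsIso.{w} V) {A B : DSpan V I J}
    (f : DSpanHom (𝟙 I) (𝟙 J) A B) (hf : ∀ i j, IsIso (enGlob f i j)) : IsIso f.hom := by
  have e : intHom (M' := enObj B) (fun i => i) (fun j => j) (enGlob f) ≫ (enCounit B).hom =
      (enCounit A).hom ≫ f.hom := enCounit_naturality f
  have := isIso_intHom (N := enObj B) (enGlob f)
  have := h.counit A
  have := h.counit B
  have : IsIso ((enCounit A).hom ≫ f.hom) := e ▸ inferInstance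
  exact IsIso.of_isIso_comp_left (enCounit A).hom f.hom

/-- By the compatibility of the unit with horizontal identities, the unit comparison of `En` is the
unit at the identity matrix followed by the image of the unit comparison of `Int`. -/
theorem isIso_enε (h : IntEnIsIso.{w} V) (i j : I) : IsIso (enε (V := V) I i j) := by
  have := h.unit (VMat.one I) i j
  have := isIso_intη (V := V) I
  have := isIso_enGlob (intη (V := V) I) i j
  rw [← enUnit_hid]
  infer_instance

/-- The fibre of a composite span at `(i, k)`, as a span whose left leg is the map to the middle
copower. The right leg goes to the copower of a point, so that this encodes a morphism to
`J • 1`. -/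
noncomputable def midSpan (A : DSpan V I J) (B : DSpan V J K) (i : I) (k : K) :
    DSpan V J PUnit.{w + 1} where
  apex := enObj (A.comp B) i k
  l := enπ (A.comp B) i k ≫ DSpan.p₁ A B ≫ A.r
  r := const _ PUnit.unit

section

variable (A : DSpan V I J) (B : DSpan V J K) (i : I) (k : K) (j : J)

/-- The projection to the fibre of a composite span at `(i, k)` from its part over `j`. -/
noncomputable def midπ : enObj (midSpan A B i k) j PUnit.unit ⟶ enObj (A.comp B) i k :=
  enπ (midSpan A B i k) j PUnit.unit

theorem midπ_p₁_r : midπ A B i k j ≫ enπ (A.comp B) i k ≫ DSpan.p₁ A B ≫ A.r = const _ j :=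
  enπ_l (midSpan A B i k) j PUnit.unit

theorem midπ_p₂_l : midπ A B i k j ≫ enπ (A.comp B) i k ≫ DSpan.p₂ A B ≫ B.l = const _ j := by
  rw [← DSpan.condition, midπ_p₁_r]

theorem midπ_p₁_l : midπ A B i k j ≫ enπ (A.comp B) i k ≫ DSpan.p₁ A B ≫ A.l = const _ i := by
  rw [← DSpan.comp_l, enπ_l, comp_const]

theorem midπ_p₂_r : midπ A B i k j ≫ enπ (A.comp B) i k ≫ DSpan.p₂ A B ≫ B.r = const _ k := by
  rw [← DSpan.comp_r, enπ_r, comp_const]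

/-- The part of the fibre of a composite span at `(i, k)` over `j` maps to the product of the
fibres at `(i, j)` and `(j, k)`. -/
noncomputable def midProd :
    enObj (midSpan A B i k) j PUnit.unit ⟶ enObj B j k ⊗ enObj A i j :=
  CartesianMonoidalCategory.lift
    (enLift (midπ A B i k j ≫ enπ (A.comp B) i k ≫ DSpan.p₂ A B)
      (by simpa only [Category.assoc] using midπ_p₂_l A B i k j)
      (by simpa only [Category.assoc] using midπ_p₂_r A B i k j))
    (enLift (midπ A B i k j ≫ enπ (A.comp B) i k ≫ DSpan.p₁ A B)
      (by simpa only [Category.assoc] using midπ_p₁_l A B i k j)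
      (by simpa only [Category.assoc] using midπ_p₁_r A B i k j))

theorem midProd_enμ :
    midProd A B i k j ≫ VMat.compι (enObj A) (enObj B) i k j ≫ enμ A B i k =
      midπ A B i k j :=
  en_hom_ext (DSpan.hom_ext (by simp [midProd]) (by simp [midProd]))

/-- The inverse of `midProd`. -/
noncomputable def prodMid :
    enObj B j k ⊗ enObj A i j ⟶ enObj (midSpan A B i k) j PUnit.unit :=
  enLift (VMat.compι (enObj A) (enObj B) i k j ≫ enμ A B i k)
    (by simp [midSpan]) (by simp [midSpan])

theorem prodMid_π :
    prodMid A B i k j ≫ midπ A B i k j = VMat.compι (enObj A) (enObj B) i k j ≫ enμ A B i k :=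
  enLift_π _ _ _

theorem prodMid_midProd : prodMid A B i k j ≫ midProd A B i k j = 𝟙 _ := by
  have e := prodMid_π A B i k j
  have e₁ : prodMid A B i k j ≫ midProd A B i k j ≫ fst _ _ = fst _ _ := en_hom_ext (by
    simp [midProd, reassoc_of% e])
  have e₂ : prodMid A B i k j ≫ midProd A B i k j ≫ snd _ _ = snd _ _ := en_hom_ext (by
    simp [midProd, reassoc_of% e])
  ext <;> simp [e₁, e₂]

end

/-- The fibre of a composite span at `(i, k)` is the coproduct of its parts over the elements of
the middle set, and the part over `j` is the product of the fibres at `(i, j)` and `(j, k)`. -/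
theorem isIso_enμ (h : IntEnIsIso.{w} V) (A : DSpan V I J) (B : DSpan V J K) (i : I) (k : K) :
    IsIso (enμ A B i k) := by
  obtain ⟨s, hs, hs'⟩ : ∃ s : enObj (A.comp B) i k ⟶ (intObj (enObj (midSpan A B i k))).apex,
      (enCounit (midSpan A B i k)).hom ≫ s = 𝟙 _ ∧
        s ≫ intDesc (fun j _ => midπ A B i k j) = 𝟙 _ :=
    (h.counit (midSpan A B i k)).out
  have e (j : J) : midπ A B i k j ≫ s = intι _ j PUnit.unit :=
    (ι_enCounit_assoc (midSpan A B i k) j PUnit.unit s).symm.trans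
      ((congrArg (intι _ j PUnit.unit ≫ ·) hs).trans (Category.comp_id _))
  refine ⟨s ≫ intDesc fun j _ => midProd A B i k j ≫ VMat.compι (enObj A) (enObj B) i k j,
    VMat.compι_jointlyEpi _ _ _ _ _ _ fun j => ?_, ?_⟩
  · have e' := prodMid_π A B i k j
    beta_reduce
    rw [← reassoc_of% e', reassoc_of% (e j), intι_desc, ← Category.assoc, prodMid_midProd,
      Category.id_comp, Category.comp_id]
  · rw [Category.assoc, ← hs']
    congr 1
    refine int_hom_ext fun j _ => ?_
    rw [intι_desc_assoc, Category.assoc, midProd_enμ, intι_desc]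

variable [MonoidalClosed V]

/-- By the compatibility of the unit with horizontal composition, `En` sends the comparison of `Int`
to an invertible 2-cell, and `En` reflects invertibility. -/
theorem isIso_intδ (h : IntEnIsIso.{w} V) (M : VMat V I J) (N : VMat V J K) :
    IsIso (intδ M N).hom := by
  refine h.isIso_of_isIso_enGlob _ fun i k => ?_
  have := h.unit (M.comp N) i k
  have := h.isIso_enμ (intObj M) (intObj N) i k
  have : IsIso (VMat.compMap (fun i => i) (fun j => j) (fun k => k) (M' := enObj (intObj M))
      (N' := enObj (intObj N)) (enUnit M) (enUnit N) i k) :=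
    (matD_isInvertible_iff (M := M.comp N) (N := (enObj (intObj M)).comp (enObj (intObj N))) _).1
      (IsInvertible.hcompSq (D := MatD.{w} V) ((matD_isInvertible_iff (enUnit M)).2 (h.unit M))
        ((matD_isInvertible_iff (enUnit N)).2 (h.unit N))) i k
  have : IsIso (enUnit (M.comp N) i k ≫ enGlob (intδ M N) i k) := by
    rw [enUnit_hcomp]
    infer_instance
  exact IsIso.of_isIso_comp_left (enUnit (M.comp N) i k) _

/-- If the unit and the counit of the adjunction between `Int` and `En` are invertible, then both
are double equivalences. -/
theorem isDoubleEquivalence (h : IntEnIsIso.{w} V) :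
    (IntD.{w} V).IsDoubleEquivalence ∧ (EnD.{w} V).IsDoubleEquivalence :=
  (intEnAdj.{w} V).isDoubleEquivalence
    ⟨fun M N => (spanD_isInvertible_iff _).2 (h.isIso_intδ M N),
      fun _ => (spanD_isInvertible_iff _).2 (isIso_intη _)⟩
    ⟨fun A B => (matD_isInvertible_iff _).2 (h.isIso_enμ A B),
      fun _ => (matD_isInvertible_iff _).2 h.isIso_enε⟩
    (fun M => (isInvertible_iff_isIso_tot _).1 ((matD_isInvertible_iff _).2 (h.unit M)))
    (fun A => (isInvertible_iff_isIso_tot _).1 ((spanD_isInvertible_iff _).2 (h.counit A)))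

end IntEnIsIso

end Comparison

/-! ### Fibres over copowers of products of sets -/

section Fibres

variable {V : Type u} [Category.{v} V] [CartesianMonoidalCategory V] [HasCoproducts.{w} V]
  {I J Λ : Type w}

/-- The morphism `Λ • 1 ⟶ (I • 1) ⊗ (J • 1)` induced by a bijection of `Λ` with `I × J`. -/
noncomputable def copowPair (e : Λ ≃ I × J) : copow V Λ ⟶ copow V I ⊗ copow V J :=
  Limits.Sigma.desc fun x =>
    CartesianMonoidalCategory.lift (copowι V (e x).1) (copowι V (e x).2)

theorem copowι_copowPair (e : Λ ≃ I × J) (x : Λ) : copowι V x ≫ copowPair e =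
    CartesianMonoidalCategory.lift (copowι V (e x).1) (copowι V (e x).2) :=
  Limits.Sigma.ι_desc _ _

theorem copowι_rightUnitor_whiskerLeft (i : I) (j : J) :
    copowι V i ≫ (ρ_ (copow V I)).inv ≫ copow V I ◁ copowι V j =
      CartesianMonoidalCategory.lift (copowι V i) (copowι V j) := by
  ext
  · simp
  · simp [toUnit_unique (toUnit (𝟙_ V)) (𝟙 _)]

theorem copow_tensor_hom_ext [MonoidalClosed V] {X : V} {f g : copow V I ⊗ copow V J ⟶ X}
    (h : ∀ i j, CartesianMonoidalCategory.lift (copowι V i) (copowι V j) ≫ f =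
      CartesianMonoidalCategory.lift (copowι V i) (copowι V j) ≫ g) : f = g := by
  have hJ : JointlyEpi (copowι V (I := J)) := fun _ _ _ e => copow_hom_ext e
  refine hJ.whiskerLeft (copow V I) f g fun j => ?_
  rw [← cancel_epi (ρ_ (copow V I)).inv]
  refine copow_hom_ext fun i => ?_
  beta_reduce
  rw [reassoc_of% copowι_rightUnitor_whiskerLeft i j,
    reassoc_of% copowι_rightUnitor_whiskerLeft i j]
  exact h i j

/-- In a cartesian closed category, `(I • 1) ⊗ (J • 1)` is the copower of `I × J`. -/
theorem isIso_copowPair [MonoidalClosed V] (e : Λ ≃ I × J) : IsIso (copowPair (V := V) e) := by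
  let s : copow V I ⊗ copow V J ⟶ copow V Λ :=
    MonoidalClosed.uncurry (Limits.Sigma.desc fun j => MonoidalClosed.curry
      ((ρ_ (copow V I)).hom ≫ Limits.Sigma.desc fun i => copowι V (e.symm (i, j))))
  have hs (i : I) (j : J) : CartesianMonoidalCategory.lift (copowι V i) (copowι V j) ≫ s =
      copowι V (e.symm (i, j)) := by
    have e : copow V I ◁ copowι V j ≫ s =
        (ρ_ (copow V I)).hom ≫ Limits.Sigma.desc fun i => copowι V (e.symm (i, j)) := by
      rw [← MonoidalClosed.uncurry_natural_left, Limits.Sigma.ι_desc, MonoidalClosed.uncurry_curry]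
    rw [← copowι_rightUnitor_whiskerLeft, Category.assoc, Category.assoc, e,
      Iso.inv_hom_id_assoc, Limits.Sigma.ι_desc]
  refine ⟨s, copow_hom_ext fun x => ?_, copow_tensor_hom_ext fun i j => ?_⟩
  · rw [reassoc_of% copowι_copowPair, hs, Category.comp_id]
    simp
  · rw [reassoc_of% hs, copowι_copowPair, Category.comp_id]
    simp

variable [HasFiniteLimits V]

theorem coprodAdj_counit_app_left (B : Over (copow V Λ)) :
    ((coprodAdj V Λ).counit.app B).left =
      Limits.Sigma.desc fun x => pullback.fst B.hom (copowι V x) :=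
  congrArg Limits.Sigma.desc (funext fun x => Category.id_comp
    (pullback.fst B.hom (copowι V x)))

section

variable [MonoidalClosed V] (e : Λ ≃ I × J) {A : DSpan V I J} {X : V} (b : X ⟶ copow V Λ)
  (w : X ≅ A.apex) (hw : b ≫ copowPair e = w.hom ≫ CartesianMonoidalCategory.lift A.l A.r) (x : Λ)

/-- The fibre at `x` of a morphism to `Λ • 1` is an entry of the matrix of the corresponding
span. -/
noncomputable def fibreIso : pullback b (copowι V x) ≅ enObj A (e x).1 (e x).2 :=
  have := isIso_copowPair (V := V) e
  have hx : copowι V x ≫ copowPair e = 𝟙 (𝟙_ V) ≫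
      CartesianMonoidalCategory.lift (copowι V (e x).1) (copowι V (e x).2) := by
    rw [copowι_copowPair, Category.id_comp]
  @asIso _ _ _ _ (pullback.map b (copowι V x) (CartesianMonoidalCategory.lift A.l A.r)
    (CartesianMonoidalCategory.lift (copowι V (e x).1) (copowι V (e x).2)) w.hom (𝟙 _)
    (copowPair e) hw hx) (pullback.map_isIso _ _ _ _ _ _ _ _ _)

theorem fibreIso_hom_π :
    (fibreIso e b w hw x).hom ≫ enπ A (e x).1 (e x).2 = pullback.fst b (copowι V x) ≫ w.hom :=
  pullback.lift_fst (f := CartesianMonoidalCategory.lift A.l A.r) _ _ _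

end

/-- Up to the reindexing of coproducts along `e`, the counit at a span with legs to `I • 1` and
`J • 1` is the counit at the corresponding object over `Λ • 1`. -/
theorem isIso_enCounit_iff [MonoidalClosed V] (e : Λ ≃ I × J) (A : DSpan V I J)
    (B : Over (copow V Λ)) (w : B.left ≅ A.apex)
    (hw : B.hom ≫ copowPair e = w.hom ≫ CartesianMonoidalCategory.lift A.l A.r) :
    IsIso (enCounit A).hom ↔ IsIso ((coprodAdj V Λ).counit.app B) := by
  let t : (∐ fun x => pullback B.hom (copowι V x)) ≅ (intObj (enObj A)).apex :=
    Limits.Sigma.whiskerEquiv e fun x => (fibreIso e B.hom w hw x).symm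
  let c : (∐ fun x => pullback B.hom (copowι V x)) ⟶ B.left :=
    Limits.Sigma.desc fun x => pullback.fst B.hom (copowι V x)
  have ht : t.hom ≫ (enCounit A).hom = c ≫ w.hom := by
    refine Limits.Sigma.hom_ext _ _ fun x => ?_
    have h₁ : Limits.Sigma.ι (fun x => pullback B.hom (copowι V x)) x ≫ t.hom =
        (fibreIso e B.hom w hw x).hom ≫ intι (enObj A) (e x).1 (e x).2 :=
      Limits.Sigma.ι_comp_map' _ _ _
    rw [reassoc_of% h₁, ι_enCounit, fibreIso_hom_π, Limits.Sigma.ι_desc_assoc]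
  calc IsIso (enCounit A).hom ↔ IsIso (t.hom ≫ (enCounit A).hom) :=
        (isIso_comp_left_iff t.hom _).symm
    _ ↔ IsIso (c ≫ w.hom) := by rw [ht]
    _ ↔ IsIso c := isIso_comp_right_iff _ _
    _ ↔ IsIso ((coprodAdj V Λ).counit.app B).left := by rw [coprodAdj_counit_app_left]; rfl
    _ ↔ IsIso ((coprodAdj V Λ).counit.app B) :=
        isIso_iff_of_reflects_iso ((coprodAdj V Λ).counit.app B) (Over.forget _)

/-- Up to the reindexing of coproducts along `e`, the unit at a matrix is the unit at the
corresponding family indexed by `Λ`. -/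
theorem isIso_enUnit_iff [MonoidalClosed V] (e : Λ ≃ I × J) (M : VMat V I J) (x : Λ) :
    IsIso (enUnit M (e x).1 (e x).2) ↔
      IsIso ((coprodAdj V Λ).unit.app (fun x => M (e x).1 (e x).2) x) := by
  let b : (∐ fun x => M (e x).1 (e x).2) ⟶ copow V Λ :=
    Limits.Sigma.map fun x => toUnit (M (e x).1 (e x).2)
  let w : (∐ fun x => M (e x).1 (e x).2) ≅ (intObj M).apex :=
    Limits.Sigma.whiskerEquiv (f := fun x => M (e x).1 (e x).2)
      (g := fun p : I × J => M p.1 p.2) e fun x => Iso.refl _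
  have hx (x : Λ) : Limits.Sigma.ι (fun x => M (e x).1 (e x).2) x ≫ w.hom =
      intι M (e x).1 (e x).2 :=
    (Limits.Sigma.ι_comp_map' (f := fun x => M (e x).1 (e x).2)
      (g := fun p : I × J => M p.1 p.2) _ _ _).trans (Category.id_comp _)
  have hw : b ≫ copowPair e =
      w.hom ≫ CartesianMonoidalCategory.lift (intObj M).l (intObj M).r := by
    refine Limits.Sigma.hom_ext _ _ fun x => ?_
    have h₁ : Limits.Sigma.ι (fun x => M (e x).1 (e x).2) x ≫ b = const _ x :=
      Limits.Sigma.ι_map (fun x => toUnit (M (e x).1 (e x).2)) x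
    rw [reassoc_of% h₁, reassoc_of% hx, copowι_copowPair, comp_lift, comp_lift, intι_l, intι_r]
  let m : M (e x).1 (e x).2 ⟶ pullback b (copowι V x) :=
    toFibre (𝟙 ((coprodFunctor V Λ).obj fun x => M (e x).1 (e x).2)) x
  have hm : m ≫ pullback.fst b (copowι V x) =
      Limits.Sigma.ι (fun x => M (e x).1 (e x).2) x :=
    (toFibre_fst (𝟙 ((coprodFunctor V Λ).obj fun x => M (e x).1 (e x).2)) x).trans
      (Category.comp_id _)
  have h : m ≫ (fibreIso e b w hw x).hom = enUnit M (e x).1 (e x).2 :=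
    en_hom_ext (by
      rw [Category.assoc, fibreIso_hom_π, enUnit_π, ← hx, reassoc_of% hm])
  rw [← h, isIso_comp_right_iff]
  rfl

/-- The adjunction between `Int` and `En` has invertible unit and counit if and only if the
adjunctions between families and slices over copowers do: matrices indexed by `I` and `J` are
families indexed by `I × J`, and families indexed by `I` are matrices with one column. -/
theorem intEnIsIso_iff [MonoidalClosed V] : IntEnIsIso.{w} V ↔
    ∀ I : Type w, IsIso (coprodAdj V I).unit ∧ IsIso (coprodAdj V I).counit := by
  constructor
  · intro h I
    let e : I ≃ I × PUnit.{w + 1} := (Equiv.prodPUnit I).symm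
    have hu (A : I → V) : IsIso ((coprodAdj V I).unit.app A) :=
      (isIso_pi_iff _).2 fun i =>
        (isIso_enUnit_iff e (fun i _ => A i) i).1 (h.unit (fun i _ => A i) i PUnit.unit)
    have hc (B : Over (copow V I)) : IsIso ((coprodAdj V I).counit.app B) := by
      let A : DSpan V I PUnit.{w + 1} :=
        ⟨B.left, B.hom ≫ copowPair e ≫ fst _ _, B.hom ≫ copowPair e ≫ snd _ _⟩
      refine (isIso_enCounit_iff e A B (Iso.refl _) ?_).1 (h.counit A)
      ext <;> simp [A]
    exact ⟨NatIso.isIso_of_isIso_app _, NatIso.isIso_of_isIso_app _⟩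
  · intro h
    refine ⟨fun {I J} M i j => ?_, fun {I J} A => ?_⟩
    · have := (h (I × J)).1
      exact (isIso_enUnit_iff (Equiv.refl (I × J)) M (i, j)).2
        ((isIso_pi_iff ((coprodAdj V (I × J)).unit.app fun x => M x.1 x.2)).1
          inferInstance (i, j))
    · have := (h (I × J)).2
      have := isIso_copowPair (V := V) (Equiv.refl (I × J))
      exact (isIso_enCounit_iff (Equiv.refl (I × J)) A (Over.mk
        (CartesianMonoidalCategory.lift A.l A.r ≫ inv (copowPair (Equiv.refl (I × J)))))
        (Iso.refl _) (by simp)).2 inferInstance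

end Fibres

/-! ### Extensivity -/

section Extensivity

variable {V : Type u} [Category.{v} V] [CartesianMonoidalCategory V] [HasCoproducts.{w} V]
  {I : Type w}

theorem sigmaMap_hom_toUnit {X : I → V} (A : ∀ i, Over (X i)) :
    Limits.Sigma.map (fun i => (A i).hom) ≫ Limits.Sigma.map (fun i => toUnit (X i)) =
      Limits.Sigma.map fun i => toUnit (A i).left :=
  Limits.Sigma.hom_ext _ _ fun i => by simp

/-- Families over the members of `X` are families over `X`, so `coprodOver V X` is an equivalence as
a slice of the equivalence `coprodFunctor V I`. -/
theorem isEquivalence_coprodOver [(coprodFunctor V I).IsEquivalence] (X : I → V) :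
    (coprodOver V X).IsEquivalence where
  faithful := ⟨fun {A B f g} e => by
    have e' : (coprodFunctor V I).map (fun i => (f i).left) =
        (coprodFunctor V I).map (fun i => (g i).left) :=
      Over.OverMorphism.ext (congrArg (fun t => t.left) e)
    funext i
    exact Over.OverMorphism.ext (congrFun ((coprodFunctor V I).map_injective e') i)⟩
  full := ⟨fun {A B} h => by
    let k : (∐ fun i => (A i).left) ⟶ ∐ fun i => (B i).left := h.left
    have w : k ≫ Limits.Sigma.map (fun i => (B i).hom) =
        Limits.Sigma.map (fun i => (A i).hom) := Over.w h
    let h' : (coprodFunctor V I).obj (fun i => (A i).left) ⟶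
        (coprodFunctor V I).obj (fun i => (B i).left) := Over.homMk k (by
      change k ≫ Limits.Sigma.map (fun i => toUnit (B i).left) =
        Limits.Sigma.map (fun i => toUnit (A i).left)
      rw [← sigmaMap_hom_toUnit, ← sigmaMap_hom_toUnit, ← w, Category.assoc])
    obtain ⟨f, hf⟩ := (coprodFunctor V I).map_surjective h'
    have hf' : Limits.Sigma.map f = k := congrArg (fun t => t.left) hf
    -- The components of `f` are morphisms over `X`, as `coprodFunctor V I` is faithful.
    have e : f ≫ (fun i => (B i).hom) = fun i => (A i).hom := by
      refine (coprodFunctor V I).map_injective (Over.OverMorphism.ext ?_)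
      change Limits.Sigma.map (fun i => f i ≫ (B i).hom) = Limits.Sigma.map fun i => (A i).hom
      rw [← w, ← hf']
      exact Limits.Sigma.hom_ext _ _ fun i => by
        rw [Limits.Sigma.ι_map, Limits.Sigma.ι_map_assoc, Limits.Sigma.ι_map, Category.assoc]
    exact ⟨fun i => Over.homMk (f i) (congrFun e i), Over.OverMorphism.ext hf'⟩⟩
  essSurj := ⟨fun Y => by
    let Y' : Over (copow V I) := Over.mk (Y.hom ≫ Limits.Sigma.map fun i => toUnit (X i))
    let A := (coprodFunctor V I).objPreimage Y'
    let t : (coprodFunctor V I).obj A ≅ Y' := (coprodFunctor V I).objObjPreimageIso Y'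
    let y : (coprodFunctor V I).obj A ⟶ (coprodFunctor V I).obj X :=
      t.hom ≫ (Over.homMk Y.hom rfl : Y' ⟶ (coprodFunctor V I).obj X)
    -- The composite of `t` with the structure morphism of `Y` comes from a family of
    -- morphisms to `X`.
    obtain ⟨a, ha⟩ := (coprodFunctor V I).map_surjective y
    have ha' : t.hom.left ≫ Y.hom = Limits.Sigma.map a :=
      (congrArg (fun t => t.left) ha).symm
    exact ⟨fun i => Over.mk (a i), ⟨Over.isoMk ((Over.forget _).mapIso t) ha'⟩⟩⟩

variable (V I) in
/-- The functor sending a family of objects to the family of its morphisms to the terminal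
object. -/
def familyOverUnit : (I → V) ⥤ ∀ _ : I, Over (𝟙_ V) where
  obj A := fun i => Over.mk (toUnit (A i))
  map f := fun i => Over.homMk (f i) (toUnit_unique _ _)

instance : (familyOverUnit V I).IsEquivalence where
  faithful := ⟨fun {_ _ _ _} e => funext fun i => congrArg (fun t => t.left) (congrFun e i)⟩
  full := ⟨fun h => ⟨fun i => (h i).left, rfl⟩⟩
  essSurj := ⟨fun Y => ⟨fun i => (Y i).left,
    ⟨Pi.isoMk fun _ => Over.isoMk (Iso.refl _) (toUnit_unique _ _)⟩⟩⟩

/-- One direction is the case of terminal objects `Xᵢ`, the other the passage to slices. -/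
theorem isExtensive_iff [HasFiniteLimits V] : IsExtensive.{w} V ↔
    ∀ I : Type w, IsIso (coprodAdj V I).unit ∧ IsIso (coprodAdj V I).counit := by
  constructor
  · intro h I
    have := h.isEquivalence I fun _ => 𝟙_ V
    have : (coprodFunctor V I).IsEquivalence :=
      Functor.isEquivalence_of_iso
        (Iso.refl (familyOverUnit V I ⋙ coprodOver V fun _ => 𝟙_ V))
    have := (coprodAdj V I).isEquivalence_right_of_isEquivalence_left
    exact ⟨inferInstance, inferInstance⟩
  · intro h
    refine ⟨inferInstance, fun I X => ?_⟩
    obtain ⟨h₁, h₂⟩ := h I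
    have : (coprodFunctor V I).IsEquivalence :=
      (coprodAdj V I).toEquivalence.isEquivalence_functor
    exact isEquivalence_coprodOver X

end Extensivity

end MatSpan

theorem mainTheorem3 (V : Type u) [Category.{v} V] [CartesianMonoidalCategory V]
    [MonoidalClosed V] [HasFiniteLimits V] [HasCoproducts.{w} V] :
    List.TFAE [
      (∀ I : Type w,
        IsIso (MatSpan.coprodAdj V I).unit ∧ IsIso (MatSpan.coprodAdj V I).counit),
      MatSpan.IsExtensive.{w} V,
      (MatSpan.IntD.{w} V).IsDoubleEquivalence,
      (MatSpan.EnD.{w} V).IsDoubleEquivalence] := by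
  tfae_have 1 ↔ 2 := MatSpan.isExtensive_iff.symm
  tfae_have 1 → 3 := fun h => (MatSpan.intEnIsIso_iff.2 h).isDoubleEquivalence.1
  tfae_have 1 → 4 := fun h => (MatSpan.intEnIsIso_iff.2 h).isDoubleEquivalence.2
  tfae_have 3 → 1 := fun h =>
    MatSpan.intEnIsIso_iff.1 (.of_isEquivalence h.isEquivalence_totFunctor)
  tfae_have 4 → 1 := fun h =>
    MatSpan.intEnIsIso_iff.1 (.of_isEquivalence
      ((MatSpan.intEnAdj V).isEquivalence_left_of_right h.isEquivalence_totFunctor))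
  tfae_finish
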